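/- **Proposition 6.6 (Bounding local Dirichlet solutions to $\tilde c$-Monge–Ampère inequalities).** *Setting.* Let $n\ge 1$, and let $U,V\subset\mathbf R^n$ be open and bounded. Let $c\in C^4(\overline U\times\overline V)$ satisfy: - (bi-twist) for all $(\bar x,\bar y)\in\overline U\times\overline V$, the maps $x\in\overline U\mapsto -D_yc(x,\bar y)$ and $y\in\overline V\mapsto -D_xc(\bar x,y)$ are diffeomorphisms onto their ranges; - (bi-convexity) for all $(\bar x,\bar y)\in\overline U\times\overline V$, the sets $-D_yc(U,\bar y)$ and $-D_xc(\bar x,V)$ are convex; - (non-negative cross-curvature) $-\frac{\partial^4}{\partial s^2\partial t^2}\big|_{(0,0)}c(x(s),y(t))\ge 0$ for all curves $x:[-1,1]\to\overline U$, $y:[-1,1]\to\overline V$ such that $t\mapsto (D_yc(x(t),y(0)),D_xc(x(0),y(t)))$ is an affinely parameterized line segment. Let $u:\overline U\to\mathbf R$ be $c$-convex, i.e. $u(x)=\sup_{y\in\overline V}(-c(x,y)-u^{c^*}(y))$, where $u^{c^*}(y)=\sup_{x\in\overline U}(-c(x,y)-u(x))$. Fix $\tilde y\in\overline V$, put $\overline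 U_{\tilde y}:=-D_yc(\overline U,\tilde y)$, let $q\in\overline U_{\tilde y}\mapsto x(q)\in\overline U$ be the inverse of $x\mapsto -D_yc(x,\tilde y)$, and set $$\tilde c(q,y)=c(x(q),y)-c(x(q),\tilde y),\qquad \tilde u(q)=u(x(q))+c(x(q),\tilde y).$$ (The function $\tilde u$ is then automatically convex and $\tilde c$-convex.) For $A\subset\overline U_{\tilde y}$ let $|\partial^{\tilde c}\tilde u|(A)$ be the Lebesgue measure of the set of $y\in\overline V$ such that $\tilde u(q)+\tilde u^{\tilde c^*}(y)+\tilde c(q,y)=0$ for some $q\in A$, where $\tilde u^{\tilde c^*}(y)=\sup_{q\in\overline U_{\tilde y}}(-\tilde c(q,y)-\tilde u(q))$. Write $\mathrm{Leb}$ for Lebesgue measure, $$\gamma^\pm_{\tilde c}:=\|\det(D^2_{qy}\tilde c)^{\pm1}\|_{L^\infty(Z\times V)},\qquad \beta_c^\pm:=\|(D^2_{xy}c)^{\pm1}\|_{L^\infty(U\times V)},$$ $$\varepsilon_c^{-1}:=2(\beta_c^+)^4(\beta_c^-)^6\|D^3_{xxy}c\|_{L^\infty(U\times V)}$$ (with $\varepsilon_c=+\infty$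 if the right-hand side vanishes), where $Z$ is the section introduced below. *Claim.* There are constants $K,C,C_1,C_2>0$ depending only on $n$ such that, with $\varepsilon_c':=\varepsilon_c/K$ (which depends only on $n$ and the cost), the following holds for all $U,V,c,u,\tilde y$ as above and all $\lambda>0$. Let $Z:=\{q\in\overline U_{\tilde y}:\tilde u(q)\le 0\}$ have non-empty interior, and assume that $\tilde u=0$ on $\partial Z$, that $\lambda\,\mathrm{Leb}(A)\le|\partial^{\tilde c}\tilde u|(A)\le\frac1\lambda\mathrm{Leb}(A)$ for every Borel $A\subset Z$, and that $\operatorname{diam}Z\le\varepsilon_c'$. Then $$C_1\frac{\lambda}{\gamma^-_{\tilde c}}\le\frac{|\inf_Z\tilde u|^n}{\mathrm{Leb}(Z)^2}\le C_2\frac{\gamma^+_{\tilde c}}{\lambda}.$$ Moreover, if $\Pi^+$ and $\Pi^-$ are parallel hyperplanes supporting $Z$ from two opposite sides (each meets $Z$, and $Z$ lies in the closed slab between them), and $\ell_{\Pi^+}$ is the maximal length of the segments in which lines orthogonal to $\Pi^+$ meet $Z$, then $$\frac{|\tilde u(q)|^n}{\mathrm{Leb}(Z)^2}\le C\,\frac{\gamma^+_{\tilde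 c}}{\lambda}\,\frac{\min\{\operatorname{dist}(q,\Pi^+),\operatorname{dist}(q,\Pi^-)\}}{\ell_{\Pi^+}}\qquad\text{for all }q\in\operatorname{int}Z.$$ -/

import Mathlib

open MeasureTheory Set

noncomputable section

namespace OptTransport

/-- Euclidean space `ℝⁿ`; cotangent spaces are identified with it. -/
abbrev E (n : ℕ) := EuclideanSpace ℝ (Fin n)

variable {n : ℕ}

/-- `D_x c(x, y)`, as a vector. -/
def Dx (c : E n → E n → ℝ) (x y : E n) : E n := gradient (fun x' => c x' y) x

/-- `D_y c(x, y)`, as a vector. -/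
def Dy (c : E n → E n → ℝ) (x y : E n) : E n := gradient (fun y' => c x y') y

/-- The mixed second derivative `D²_{xy} c(x, y)`: the derivative in `x` of `D_y c`. -/
def Dxy (c : E n → E n → ℝ) (x y : E n) : E n →L[ℝ] E n :=
  fderiv ℝ (fun x' => Dy c x' y) x

/-- `D³_{xxy} c(x, y)`: the second derivative in `x` of `D_y c`. -/
def Dxxy (c : E n → E n → ℝ) (x y : E n) : E n →L[ℝ] E n →L[ℝ] E n :=
  fderiv ℝ (fun x' => Dxy c x' y) x

/-- For a map `f` of class `C¹` near a compact set `S`: `f` is a diffeomorphism from `S` onto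
its range, i.e. injective with invertible differential at each point of `S`. -/
def IsDiffeoOntoRange (f : E n → E n) (S : Set (E n)) : Prop :=
  InjOn f S ∧ ∀ x ∈ S, (fderiv ℝ f x).IsInvertible

/-- The standing hypotheses on a cost on `closure U × closure V`. -/
structure IsNonnegCrossCurved (U V : Set (E n)) (c : E n → E n → ℝ) : Prop where
  isOpen_U : IsOpen U
  isOpen_V : IsOpen V
  isBounded_U : Bornology.IsBounded U
  isBounded_V : Bornology.IsBounded V
  /-- `c` is `C⁴` up to the boundary. -/
  smooth : ∃ W : Set (E n × E n), IsOpen W ∧ closure U ×ˢ closure V ⊆ W ∧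
    ContDiffOn ℝ 4 (fun p : E n × E n => c p.1 p.2) W
  /-- bi-twist -/
  twist_x : ∀ y ∈ closure V, IsDiffeoOntoRange (fun x => -Dy c x y) (closure U)
  twist_y : ∀ x ∈ closure U, IsDiffeoOntoRange (fun y => -Dx c x y) (closure V)
  /-- bi-convexity -/
  convex_U : ∀ y ∈ closure V, Convex ℝ ((fun x => -Dy c x y) '' U)
  convex_V : ∀ x ∈ closure U, Convex ℝ ((fun y => -Dx c x y) '' V)
  /-- non-negative cross-curvature -/
  cross : ∀ x y : ℝ → E n,
    (∀ t ∈ Icc (-1 : ℝ) 1, x t ∈ closure U ∧ y t ∈ closure V) →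
    (∃ a v b w : E n, ∀ t ∈ Icc (-1 : ℝ) 1,
      Dy c (x t) (y 0) = a + t • v ∧ Dx c (x 0) (y t) = b + t • w) →
    0 ≤ -(iteratedDeriv 2 (fun s : ℝ => iteratedDeriv 2 (fun t : ℝ => c (x s) (y t)) 0) 0)

/-- The transform `v^c(x) = sup_{y ∈ Y} (-c(x, y) - v(y))`. -/
def cTransform (c : E n → E n → ℝ) (Y : Set (E n)) (v : E n → ℝ) (x : E n) : ℝ :=
  sSup ((fun y => -c x y - v y) '' Y)

/-- The transform `u^{c*}(y) = sup_{x ∈ X} (-c(x, y) - u(x))`. -/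
def cStarTransform (c : E n → E n → ℝ) (X : Set (E n)) (u : E n → ℝ) (y : E n) : ℝ :=
  cTransform (fun y' x' => c x' y') X u y

/-- `u` is `c`-convex on `X` (with respect to `Y`): `u = u^{c* c}` on `X`, where both suprema
are finite. -/
def IsCConvex (c : E n → E n → ℝ) (X Y : Set (E n)) (u : E n → ℝ) : Prop :=
  (∀ y ∈ Y, BddAbove ((fun x => -c x y - u x) '' X)) ∧
  (∀ x ∈ X, BddAbove ((fun y => -c x y - cStarTransform c X u y) '' Y)) ∧
  ∀ x ∈ X, u x = cTransform c Y (cStarTransform c X u) x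

/-- The image `∂ᶜu(A)` of a set `A` under the `c`-subdifferential
`∂ᶜu = {(x, y) ∈ X × Y | u(x) + u^{c*}(y) + c(x, y) = 0}`. -/
def cSubdiff (c : E n → E n → ℝ) (X Y : Set (E n)) (u : E n → ℝ) (A : Set (E n)) : Set (E n) :=
  {y | ∃ x ∈ A, x ∈ X ∧ y ∈ Y ∧ u x + cStarTransform c X u y + c x y = 0}

/-- `λ ≤ |∂ᶜu| ≤ Λ` on `Z`, where `|∂ᶜu|(A)` is the Lebesgue measure of `∂ᶜu(A)`. -/
def CMongeAmpereBounds (c : E n → E n → ℝ) (X Y : Set (E n)) (u : E n → ℝ)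
    (lam Lam : ℝ) (Z : Set (E n)) : Prop :=
  ∀ A ⊆ Z, MeasurableSet A →
    ENNReal.ofReal lam * volume A ≤ volume (cSubdiff c X Y u A) ∧
    volume (cSubdiff c X Y u A) ≤ ENNReal.ofReal Lam * volume A

/-- The cost exponential coordinate `q(x) = -D_y c(x, y₀)` from `y₀`. -/
def expCoord (c : E n → E n → ℝ) (y₀ x : E n) : E n := -Dy c x y₀

/-- `closure U` in cost exponential coordinates from `y₀`. -/
def coordDomain (c : E n → E n → ℝ) (U : Set (E n)) (y₀ : E n) : Set (E n) :=
  expCoord c y₀ '' closure U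

/-- The inverse `x(q)` of the coordinate map on `closure U`. -/
def expCoordInv (c : E n → E n → ℝ) (U : Set (E n)) (y₀ q : E n) : E n :=
  Function.invFunOn (expCoord c y₀) (closure U) q

/-- The modified cost `c(x(q), y) - c(x(q), y₀)`. -/
def modCost (c : E n → E n → ℝ) (U : Set (E n)) (y₀ q y : E n) : ℝ :=
  c (expCoordInv c U y₀ q) y - c (expCoordInv c U y₀ q) y₀

/-- The modified potential `u(x(q)) + c(x(q), y₀)`. -/
def modPot (c : E n → E n → ℝ) (U : Set (E n)) (y₀ : E n) (u : E n → ℝ) (q : E n) : ℝ :=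
  u (expCoordInv c U y₀ q) + c (expCoordInv c U y₀ q) y₀

/-- The section `{q | ũ(q) ≤ 0}` of the modified potential. -/
def zeroSection (c : E n → E n → ℝ) (U : Set (E n)) (y₀ : E n) (u : E n → ℝ) : Set (E n) :=
  {q ∈ coordDomain c U y₀ | modPot c U y₀ u q ≤ 0}

/-- The (essential) supremum norm `‖f‖_{L^∞(A × B)}`. -/
def linftyNorm {F : Type*} [NormedAddCommGroup F] (f : E n → E n → F) (A B : Set (E n)) : ℝ :=
  (eLpNorm (fun p : E n × E n => f p.1 p.2) ⊤ (volume.restrict (A ×ˢ B))).toReal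

/-- `γ⁺ = ‖det D²_{xy} c‖_{L^∞(A × B)}`. -/
def gammaPlus (c : E n → E n → ℝ) (A B : Set (E n)) : ℝ :=
  linftyNorm (fun x y => (Dxy c x y).det) A B

/-- `γ⁻ = ‖det (D²_{xy} c)⁻¹‖_{L^∞(A × B)}`. -/
def gammaMinus (c : E n → E n → ℝ) (A B : Set (E n)) : ℝ :=
  linftyNorm (fun x y => ((Dxy c x y).det)⁻¹) A B

/-- `β⁺ = ‖D²_{xy} c‖_{L^∞(A × B)}`. -/
def betaPlus (c : E n → E n → ℝ) (A B : Set (E n)) : ℝ :=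
  linftyNorm (fun x y => Dxy c x y) A B

/-- `β⁻ = ‖(D²_{xy} c)⁻¹‖_{L^∞(A × B)}`. -/
def betaMinus (c : E n → E n → ℝ) (A B : Set (E n)) : ℝ :=
  linftyNorm (fun x y => (Dxy c x y).inverse) A B

/-- `1 / ε_c`, the reciprocal of the length scale of the cost `c`. -/
def invEps (c : E n → E n → ℝ) (U V : Set (E n)) : ℝ :=
  2 * betaPlus c U V ^ 4 * betaMinus c U V ^ 6 * linftyNorm (fun x y => Dxxy c x y) U V

/-- The hyperplane `{q | ⟨e, q⟩ = a}` with normal `e`. -/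
def hyperplane (e : E n) (a : ℝ) : Set (E n) := {q | inner ℝ e q = a}

/-- `hyperplane e a` and `hyperplane e b` support `Z` from two opposite sides. -/
def SupportFromOppositeSides (Z : Set (E n)) (e : E n) (a b : ℝ) : Prop :=
  (Z ∩ hyperplane e a).Nonempty ∧ (Z ∩ hyperplane e b).Nonempty ∧
    ∀ q ∈ Z, b ≤ inner ℝ e q ∧ inner ℝ e q ≤ a

/-- The maximal length of the segments in which the lines of direction `e` meet `Z`. -/
def maxSegmentLength (Z : Set (E n)) (e : E n) : ℝ :=
  ⨆ p : E n, Metric.diam (Z ∩ range fun t : ℝ => p + t • e)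

end OptTransport

end

/-! The proof transplants Alexandrov's two estimates for the Monge–Ampère equation to the coordinate
`q`, where the functions `-c̃(·, y)`, up to additive constants, play the part of affine functions.
Write `p(q, y) = -D_q c̃(q, y)`, so that `p(·, ỹ) = 0`. Non-negative cross-curvature yields two
mirror-image facts, since the hypotheses are symmetric in `x` and `y`. Each `-c̃(·, y)` is convex,
hence so are `ũ` and `Z`. And a set of `y` cut out by upper bounds on `c̃(q, y) - c̃(q', y)` has a
convex `p(q, ·)`-image (`CrossCurvedCost.neg_sub_le`, `ConvexCost.convex_image_bounded`). The second
fact makes local supports global (`ConvexCost.isSupport_of_local`).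

Upper bounds (`ConvexCost.pow_mul_le`). Fix `q₀` inside `Z`, put `h = -ũ(q₀)`, and let `A` be the
set of `y` for which the translate of `-c̃(·, y)` through `(q₀, ũ(q₀))` is nonpositive on `Z`.
Sliding such a translate down until it touches the graph shows that `A` lies in the subdifferential
image of `Z`, so `|A| ≤ |Z| / λ`. For a unit vector `b`, let `m` maximise `⟪b, ·⟫` on `Z` and `d =
⟪b, m - q₀⟫`; some `y ∈ A` has `p(m, y) = (h / d) b`. The smallness of `diam Z` makes `p(q₀, y)`
differ from this by a fraction `1 / K` at most. Over an orthonormal frame, the convex set `p(q₀, A)`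
thus contains `0` and `n` almost orthogonal vectors of lengths about `h / d i`, and its volume
controls `h ^ n / ∏ d i`. The frame is greedy (`exists_adapted_frame`): it starts with a chord of
`Z` of length `r` and direction `e`, and its other directions have widths realised by chords of `Z`.
Hence `r` times those widths is at most `n ^ n |Z|`, and `h ^ n r ≤ C (γ⁺ / λ) |Z|² d`, with `d` now
the distance in direction `e`. Letting the chord vary gives both upper bounds.

Lower bound (`ConvexCost.mul_sq_volume_le`). The same frame inscribes in `Z` a box comparable with
`Z`. Supports touching inside half of that box have gradients at its centre in a polar box, and
comparing volumes through `γ⁻` finishes. -/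

namespace OptTransport
open scoped RealInnerProductSpace Topology
open Filter

variable {n : ℕ}

/-! ### Volumes, determinants and adapted frames of convex bodies -/

/-- The symmetric parallelepiped with centre `a` spanned by the vectors `s • v i`. -/
def symBox (a : E n) (v : Fin n → E n) (s : ℝ) : Set (E n) :=
  {q | ∃ t : Fin n → ℝ, (∀ i, |t i| ≤ s) ∧ q = a + ∑ i, t i • v i}

theorem volume_parallelepiped (b : OrthonormalBasis (Fin n) ℝ (E n)) (v : Fin n → E n) :
    volume (parallelepiped v) = ENNReal.ofReal |b.toBasis.det v| := by
  rw [← b.addHaar_eq_volume, Measure.addHaar_parallelepiped]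

theorem symBox_eq_image (a : E n) (v : Fin n → E n) {s : ℝ} (hs : 0 ≤ s) :
    symBox a v s = (fun x => (a - ∑ i, s • v i) + x) '' parallelepiped (fun i => (2 * s) • v i) := by
  ext q
  simp only [symBox, mem_ofPred_eq, mem_image, mem_parallelepiped_iff]
  constructor
  · rintro ⟨t, ht, rfl⟩
    refine ⟨∑ i, ((t i + s) / (2 * s)) • (2 * s) • v i, ⟨fun i => (t i + s) / (2 * s), ⟨fun i => ?_, fun i => ?_⟩, rfl⟩, ?_⟩
    · have := abs_le.1 (ht i)
      exact div_nonneg (by linarith) (by linarith)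
    · have := abs_le.1 (ht i)
      exact div_le_one_of_le₀ (by linarith) (by linarith)
    · have : ∀ i, ((t i + s) / (2 * s)) • (2 * s) • v i = t i • v i + s • v i := by
        intro i
        rw [smul_smul, ← add_smul]
        congr 1
        rcases hs.eq_or_lt with h | h
        · have := abs_le.1 (ht i)
          subst h
          simp only [mul_zero]
          linarith [this.1, this.2]
        · field_simp
      simp only [this, Finset.sum_add_distrib]
      abel
  · rintro ⟨x, ⟨t, ⟨ht0, ht1⟩, rfl⟩, rfl⟩
    refine ⟨fun i => -s + t i * (2 * s), fun i => ?_, ?_⟩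
    · have h0 := ht0 i
      have h1 := ht1 i
      simp only [Pi.zero_apply, Pi.one_apply] at h0 h1
      rw [abs_le]
      constructor <;> nlinarith
    · simp only [add_smul, Finset.sum_add_distrib, smul_smul, neg_smul, Finset.sum_neg_distrib]
      abel

theorem volume_symBox (b : OrthonormalBasis (Fin n) ℝ (E n)) (a : E n) (v : Fin n → E n) {s : ℝ}
    (hs : 0 ≤ s) :
    volume (symBox a v s) = ENNReal.ofReal ((2 * s) ^ n * |b.toBasis.det v|) := by
  rw [symBox_eq_image a v hs, image_add_left, measure_preimage_add, volume_parallelepiped b]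
  have := b.toBasis.det.map_smul_univ (fun _ => 2 * s) v
  rw [this]
  simp [abs_mul, abs_of_nonneg hs]

theorem isCompact_symBox (a : E n) (v : Fin n → E n) (s : ℝ) : IsCompact (symBox a v s) := by
  have : symBox a v s = (fun t : Fin n → ℝ => a + ∑ i, t i • v i) '' (Set.pi univ fun _ => Icc (-s) s) := by
    ext q
    simp only [symBox, mem_ofPred_eq, mem_image, Set.mem_pi, mem_univ, true_imp_iff, mem_Icc, abs_le]
    constructor
    · rintro ⟨t, h, rfl⟩; exact ⟨t, h, rfl⟩
    · rintro ⟨t, h, rfl⟩; exact ⟨t, h, rfl⟩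
  rw [this]
  exact (isCompact_univ_pi fun _ => isCompact_Icc).image (by fun_prop)

/-- The coordinate matrix is upper triangular. Adapted frames deliver their segments in this form.
-/
theorem det_eq_prod_of_triangular (b : OrthonormalBasis (Fin n) ℝ (E n)) (v : Fin n → E n)
    (h : ∀ i j, i < j → ⟪b j, v i⟫ = 0) : b.toBasis.det v = ∏ i, ⟪b i, v i⟫ := by
  rw [Module.Basis.det_apply, Matrix.det_of_isUpperTriangular]
  · simp [Module.Basis.toMatrix_apply, OrthonormalBasis.repr_apply_apply]
  · intro i j hij
    simpa [Module.Basis.toMatrix_apply, OrthonormalBasis.repr_apply_apply] using h j i hij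

/-- A convex set contains the parallelepiped built from the average of `n` of its segments. -/
theorem symBox_subset_of_convex (hn : 0 < n) {Z : Set (E n)} (hZ : Convex ℝ Z)
    {x x' : Fin n → E n} (hx : ∀ i, x i ∈ Z) (hx' : ∀ i, x' i ∈ Z) :
    symBox (∑ i, (1 / (2 * n : ℝ)) • (x i + x' i)) (fun i => x i - x' i) (1 / (2 * n)) ⊆ Z := by
  rintro q ⟨t, ht, rfl⟩
  have hn' : (0 : ℝ) < n := by exact_mod_cast hn
  -- The point is the average of `n` points, the `i`-th on the segment joining `x' i` to `x i` with
  -- weights `1/2 ± n * t i`; these are nonnegative because `|t i| ≤ 1/(2n)`.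
  have key : ∑ i, (1 / (2 * n : ℝ)) • (x i + x' i) + ∑ i, t i • (x i - x' i)
      = ∑ i : Fin n, (1 / (n : ℝ)) • ((1 / 2 + n * t i) • x i + (1 / 2 - n * t i) • x' i) := by
    rw [← Finset.sum_add_distrib]
    refine Finset.sum_congr rfl fun i _ => ?_
    have e1 : (1 / (n : ℝ)) * (1 / 2 + n * t i) = 1 / (2 * n) + t i := by field_simp
    have e2 : (1 / (n : ℝ)) * (1 / 2 - n * t i) = 1 / (2 * n) - t i := by field_simp
    rw [smul_add (1 / (n : ℝ)), smul_smul, smul_smul, e1, e2]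
    module
  rw [key]
  refine hZ.sum_mem (fun _ _ => by positivity) (by simp [hn'.ne']) fun i _ => ?_
  have h := abs_le.1 (ht i)
  have e : (n : ℝ) * (1 / (2 * n)) = 1 / 2 := by field_simp
  have h1 : (n : ℝ) * t i ≤ 1 / 2 := by rw [← e]; exact mul_le_mul_of_nonneg_left h.2 hn'.le
  have h2 : -(1 / 2) ≤ (n : ℝ) * t i := by
    rw [← e, ← mul_neg]; exact mul_le_mul_of_nonneg_left h.1 hn'.le
  exact hZ (hx i) (hx' i) (by linarith) (by linarith) (by ring)

theorem le_volume_of_convex_segments (hn : 0 < n) (b : OrthonormalBasis (Fin n) ℝ (E n))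
    {Z : Set (E n)} (hZ : Convex ℝ Z)
    {x x' : Fin n → E n} (hx : ∀ i, x i ∈ Z) (hx' : ∀ i, x' i ∈ Z) :
    ENNReal.ofReal ((1 / n : ℝ) ^ n * |b.toBasis.det fun i => x i - x' i|) ≤ volume Z := by
  refine le_trans (le_of_eq ?_) (measure_mono (symBox_subset_of_convex hn hZ hx hx'))
  rw [volume_symBox b _ _ (by positivity)]
  congr 3
  have hn' : (0 : ℝ) < n := by exact_mod_cast hn
  field_simp

/-- A convex set containing the origin and `n` points contains a parallelepiped. -/
theorem le_volume_of_convex_zero_mem (hn : 0 < n) (b : OrthonormalBasis (Fin n) ℝ (E n))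
    {P : Set (E n)} (hP : Convex ℝ P) (h0 : 0 ∈ P) {p : Fin n → E n} (hp : ∀ i, p i ∈ P) :
    ENNReal.ofReal ((1 / n : ℝ) ^ n * |b.toBasis.det p|) ≤ volume P := by
  have := le_volume_of_convex_segments hn b hP hp (x' := fun _ => 0) (fun _ => h0)
  simpa using this

/-- `Z` lies in the box centred at `z₀` with half-axes `w i • b i`. Since `z₀` need not be central,
the half-axes are full widths, which costs `2 ^ n`. -/
theorem volume_le_prod_of_width (b : OrthonormalBasis (Fin n) ℝ (E n)) {Z : Set (E n)}
    {w : Fin n → ℝ} {z₀ : E n} (hz₀ : z₀ ∈ Z)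
    (hw : ∀ i, ∀ q ∈ Z, ∀ q' ∈ Z, ⟪b i, q - q'⟫ ≤ w i) :
    volume Z ≤ ENNReal.ofReal (2 ^ n * ∏ i, w i) := by
  have hw0 : ∀ i, 0 ≤ w i := fun i => by simpa using hw i z₀ hz₀ z₀ hz₀
  have hsub : Z ⊆ symBox z₀ (fun i => w i • b i) 1 := by
    intro q hq
    refine ⟨fun i => ⟪b i, q - z₀⟫ / w i, fun i => ?_, ?_⟩
    · rw [abs_div, abs_of_nonneg (hw0 i)]
      refine div_le_one_of_le₀ (abs_le.2 ⟨?_, hw i q hq z₀ hz₀⟩) (hw0 i)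
      have := hw i z₀ hz₀ q hq
      rw [← neg_sub q z₀, inner_neg_right] at this
      linarith
    · have h1 : ∀ i, (⟪b i, q - z₀⟫ / w i) • w i • b i = ⟪b i, q - z₀⟫ • b i := by
        intro i
        rw [smul_smul]
        congr 1
        rcases (hw0 i).eq_or_lt with h | h
        · have h1 := hw i q hq z₀ hz₀
          have h2 := hw i z₀ hz₀ q hq
          rw [← neg_sub q z₀, inner_neg_right] at h2
          rw [← h] at h1 h2 ⊢
          simp only [mul_zero]; linarith
        · field_simp
      simp only [h1]
      rw [b.sum_repr' (q - z₀)]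
      abel
  refine (measure_mono hsub).trans (le_of_eq ?_)
  rw [volume_symBox b _ _ zero_le_one, det_eq_prod_of_triangular]
  · congr 1
    simp only [mul_one, inner_smul_right, real_inner_self_eq_norm_sq, b.norm_eq_one, one_pow]
    rw [abs_of_nonneg (Finset.prod_nonneg fun i _ => hw0 i)]
  · intro i j hij
    simp [inner_smul_right, b.inner_eq_zero hij.ne']

/-- The linear map `p ↦ ∑ ⟪v i, p⟫ • b i` has determinant `det v` and sends the set into a cube of
side `2 * M`. -/
theorem volume_polar_le (b : OrthonormalBasis (Fin n) ℝ (E n)) (v : Fin n → E n) {M : ℝ}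
    (hM : 0 ≤ M) (hv : b.toBasis.det v ≠ 0) :
    volume {p : E n | ∀ i, |⟪p, v i⟫| ≤ M} ≤
      ENNReal.ofReal ((2 * M) ^ n / |b.toBasis.det v|) := by
  set S := {p : E n | ∀ i, |⟪p, v i⟫| ≤ M}
  set A : E n →ₗ[ℝ] E n := ∑ i, (innerₛₗ ℝ (v i)).smulRight (b i) with hA
  have hAa : ∀ p, A p = ∑ i, ⟪v i, p⟫ • b i := by intro p; simp [hA]
  have hdet : LinearMap.det A = b.toBasis.det v := by
    rw [← LinearMap.det_toMatrix b.toBasis, Module.Basis.det_apply, ← Matrix.det_transpose]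
    congr 1
    ext i j
    simp only [Matrix.transpose_apply, LinearMap.toMatrix_apply, Module.Basis.toMatrix_apply,
      OrthonormalBasis.coe_toBasis, OrthonormalBasis.coe_toBasis_repr_apply,
      OrthonormalBasis.repr_apply_apply, hAa, inner_sum, inner_smul_right]
    rw [Finset.sum_eq_single j]
    · simp [real_inner_comm]
    · intro k _ hk
      simp [b.inner_eq_zero hk.symm]
    · simp
  have hsub : A '' S ⊆ symBox 0 (fun i => b i) M := by
    rintro _ ⟨p, hp, rfl⟩
    refine ⟨fun i => ⟪v i, p⟫, fun i => ?_, by rw [hAa]; simp⟩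
    simpa only [real_inner_comm] using hp i
  have h1 := measure_mono (μ := volume) hsub
  rw [Measure.addHaar_image_linearMap, hdet, volume_symBox b _ _ hM] at h1
  have hb : b.toBasis.det (fun i => b i) = 1 := by
    have := b.toBasis.det_self
    simpa using this
  rw [hb, abs_one, mul_one] at h1
  have hpos : 0 < |b.toBasis.det v| := abs_pos.2 hv
  rw [ENNReal.ofReal_div_of_pos hpos, ENNReal.le_div_iff_mul_le]
  · rwa [mul_comm]
  · left; simpa using hv
  · left; simp

/-- Continuity of the determinant at the identity matrix, once the `i`-th vector is divided by `s
i`. This `K`, depending on `n` alone, becomes the constant in the smallness condition on `diam Z`.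
-/
theorem exists_det_perturbation (n : ℕ) : ∃ K : ℝ, 0 < K ∧
    ∀ (b : OrthonormalBasis (Fin n) ℝ (E n)) (p : Fin n → E n) (s : Fin n → ℝ), (∀ i, 0 < s i) →
      (∀ i, ‖p i - s i • b i‖ ≤ s i / K) → (∏ i, s i) / 2 ≤ |b.toBasis.det p| := by
  have hc : Continuous fun g : Fin n → Fin n → ℝ => (Matrix.of g).det := by
    refine Continuous.matrix_det ?_
    exact continuous_id
  obtain ⟨δ, hδ, h⟩ := Metric.continuousAt_iff.1 (hc.continuousAt (x := fun i j => if i = j then 1 else 0))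
    (1 / 2) (by norm_num)
  have hone : (Matrix.of fun i j : Fin n => if i = j then (1 : ℝ) else 0).det = 1 := by
    rw [← Matrix.det_one (n := Fin n)]
    congr 1
    ext i j
    simp [Matrix.one_apply]
  refine ⟨2 / δ, by positivity, fun b p s hs hp => ?_⟩
  have hfac : p = fun i => s i • ((s i)⁻¹ • p i) := by
    ext1 i; rw [smul_smul, mul_inv_cancel₀ (hs i).ne', one_smul]
  rw [hfac, b.toBasis.det.map_smul_univ, smul_eq_mul, abs_mul,
    abs_of_nonneg (Finset.prod_nonneg fun i _ => (hs i).le), div_eq_mul_one_div]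
  refine mul_le_mul_of_nonneg_left ?_ (Finset.prod_nonneg fun i _ => (hs i).le)
  set g : Fin n → Fin n → ℝ := fun i j => ⟪b i, (s j)⁻¹ • p j⟫ with hg
  have hdg : b.toBasis.det (fun i => (s i)⁻¹ • p i) = (Matrix.of g).det := by
    rw [Module.Basis.det_apply]
    congr 1
    ext i j
    simp [Module.Basis.toMatrix_apply, OrthonormalBasis.repr_apply_apply, hg, inner_smul_right]
  have hclose : dist g (fun i j => if i = j then 1 else 0) < δ := by
    refine lt_of_le_of_lt ((dist_pi_le_iff (by positivity : 0 ≤ δ / 2)).2 fun i =>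
      (dist_pi_le_iff (by positivity)).2 fun j => ?_) (by linarith : δ / 2 < δ)
    have e : g i j - (if i = j then 1 else 0) = (s j)⁻¹ * ⟪b i, p j - s j • b j⟫ := by
      simp only [hg, inner_smul_right, inner_sub_right, mul_sub]
      rw [← mul_assoc (s j)⁻¹, inv_mul_cancel₀ (hs j).ne', one_mul]
      rw [orthonormal_iff_ite.1 b.orthonormal]
    rw [Real.dist_eq, e, abs_mul, abs_of_pos (inv_pos.2 (hs j))]
    have h1 : |⟪b i, p j - s j • b j⟫| ≤ s j / (2 / δ) :=
      (abs_real_inner_le_norm _ _).trans (by rw [b.norm_eq_one, one_mul]; exact hp j)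
    calc (s j)⁻¹ * |⟪b i, p j - s j • b j⟫| ≤ (s j)⁻¹ * (s j / (2 / δ)) :=
          mul_le_mul_of_nonneg_left h1 (inv_pos.2 (hs j)).le
      _ = δ / 2 := by have := (hs j).ne'; field_simp
  have := h hclose
  rw [hone, Real.dist_eq] at this
  rw [hdg]
  have h2 := abs_lt.1 this
  exact le_trans (by linarith) (le_abs_self _)

/-- Among pairs of points of `Z`, one maximises the length of the projection of the difference onto
`Sᗮ`; `e` is the direction of that projection. The rest of the difference lies in `S`, and
maximality bounds the width of `Z` in direction `e`. -/
theorem exists_greedy_extension {Z : Set (E n)} (hZ : IsCompact Z) (hi : (interior Z).Nonempty)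
    (S : Submodule ℝ (E n)) (hS : Module.finrank ℝ S < n) :
    ∃ e z z' : E n, ‖e‖ = 1 ∧ e ∈ Sᗮ ∧ z ∈ Z ∧ z' ∈ Z ∧ 0 < ⟪e, z - z'⟫ ∧
      (z - z') - ⟪e, z - z'⟫ • e ∈ S ∧ ∀ q ∈ Z, ∀ q' ∈ Z, ⟪e, q - q'⟫ ≤ ⟪e, z - z'⟫ := by
  obtain ⟨q₀, hq₀⟩ := hi
  have hq₀Z := interior_subset hq₀
  have hne : Sᗮ ≠ ⊥ := by
    intro h
    rw [Submodule.orthogonal_eq_bot_iff] at h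
    rw [h, finrank_top] at hS
    simp at hS
  obtain ⟨u, hu, hu0⟩ := Submodule.exists_mem_ne_zero_of_ne_bot hne
  obtain ⟨T, hTid, hTmem, hTsub, hTsym⟩ : ∃ T : E n →L[ℝ] E n, (∀ w ∈ Sᗮ, T w = w) ∧
      (∀ w, T w ∈ Sᗮ) ∧ (∀ w, w - T w ∈ S) ∧ ∀ w w', ⟪T w, w'⟫ = ⟪w, T w'⟫ := by
    refine ⟨Sᗮ.starProjection, fun w hw => Submodule.starProjection_eq_self_iff.2 hw,
      fun w => Submodule.starProjection_apply_mem _ _, fun w => ?_,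
      fun w w' => Submodule.inner_starProjection_left_eq_right _ _ _⟩
    have := Submodule.sub_starProjection_mem_orthogonal (K := Sᗮ) w
    rwa [Submodule.orthogonal_orthogonal] at this
  have hcont : Continuous fun r : E n × E n => ‖T (r.1 - r.2)‖ := by fun_prop
  obtain ⟨⟨z, z'⟩, ⟨hz, hz'⟩, hmax⟩ := (hZ.prod hZ).exists_isMaxOn ⟨(q₀, q₀), hq₀Z, hq₀Z⟩
    hcont.continuousOn
  obtain ⟨P, hP⟩ : ∃ P, P = T (z - z') := ⟨_, rfl⟩
  have hmax' : ∀ q ∈ Z, ∀ q' ∈ Z, ‖T (q - q')‖ ≤ ‖P‖ := fun q hq q' hq' => by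
    rw [hP]; exact isMaxOn_iff.1 hmax (q, q') (mk_mem_prod hq hq')
  -- An interior point moves within `Z` along a nonzero vector of `Sᗮ`, so the maximum is positive.
  have hPpos : 0 < ‖P‖ := by
    have hev : ∀ᶠ t : ℝ in nhds 0, q₀ + t • u ∈ Z := by
      have hc : ContinuousAt (fun t : ℝ => q₀ + t • u) 0 := by fun_prop
      refine hc.eventually_mem ?_
      rw [zero_smul, add_zero]
      exact mem_interior_iff_mem_nhds.1 hq₀
    obtain ⟨t, ht, ht0⟩ : ∃ t : ℝ, q₀ + t • u ∈ Z ∧ t ≠ 0 := by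
      have h2 := (hev.filter_mono nhdsWithin_le_nhds).and
        (self_mem_nhdsWithin : ({0}ᶜ : Set ℝ) ∈ nhdsWithin 0 {0}ᶜ)
      obtain ⟨t, h⟩ := h2.exists
      exact ⟨t, h.1, h.2⟩
    have h3 := hmax' _ ht _ hq₀Z
    rw [add_sub_cancel_left, map_smul, hTid u hu, norm_smul] at h3
    exact lt_of_lt_of_le (mul_pos (norm_pos_iff.2 ht0) (norm_pos_iff.2 hu0)) h3
  have hPmem : P ∈ Sᗮ := hP ▸ hTmem _
  have hsym : ∀ w : E n, ⟪P, w⟫ = ⟪P, T w⟫ := by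
    intro w
    conv_lhs => rw [← hTid P hPmem]
    exact hTsym _ _
  have hin : ∀ w, ⟪‖P‖⁻¹ • P, w⟫ = ‖P‖⁻¹ * ⟪P, T w⟫ := fun w => by
    rw [real_inner_smul_left, hsym]
  have hval : ⟪‖P‖⁻¹ • P, z - z'⟫ = ‖P‖ := by
    rw [hin, ← hP, real_inner_self_eq_norm_sq]; field_simp
  refine ⟨‖P‖⁻¹ • P, z, z', ?_, Submodule.smul_mem _ _ hPmem, hz, hz', ?_, ?_, ?_⟩
  · rw [norm_smul, norm_inv, norm_norm, inv_mul_cancel₀ hPpos.ne']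
  · rw [hval]; exact hPpos
  · rw [hval, smul_smul, mul_inv_cancel₀ hPpos.ne', one_smul, hP]
    exact hTsub _
  · intro q hq q' hq'
    rw [hval, hin]
    calc ‖P‖⁻¹ * ⟪P, T (q - q')⟫ ≤ ‖P‖⁻¹ * (‖P‖ * ‖P‖) := by
          refine mul_le_mul_of_nonneg_left ?_ (by positivity)
          exact (real_inner_le_norm _ _).trans
            (mul_le_mul_of_nonneg_left (hmax' q hq q' hq') hPpos.le)
      _ = ‖P‖ := by field_simp

/-- A greedy Gram–Schmidt process: each new direction is orthogonal to the span of the previous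
ones, which contains all earlier difference vectors, whence triangularity. Index `0` is excluded
from the width bound because the prescribed segment need not realise the width of `Z` in its
direction. -/
theorem exists_adapted_frame (hn : 0 < n) {Z : Set (E n)} (hZ : IsCompact Z)
    (hi : (interior Z).Nonempty) {z z' e : E n} (hz : z ∈ Z) (hz' : z' ∈ Z) (he : ‖e‖ = 1)
    {r : ℝ} (hr : 0 < r) (hzz : z - z' = r • e) :
    ∃ (b : OrthonormalBasis (Fin n) ℝ (E n)) (x x' : Fin n → E n),
      (∀ i, x i ∈ Z) ∧ (∀ i, x' i ∈ Z) ∧ b ⟨0, hn⟩ = e ∧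
      x ⟨0, hn⟩ - x' ⟨0, hn⟩ = r • e ∧
      (∀ i j, i < j → ⟪b j, x i - x' i⟫ = 0) ∧
      (∀ i, 0 < ⟪b i, x i - x' i⟫) ∧
      ∀ i, i ≠ ⟨0, hn⟩ → ∀ q ∈ Z, ∀ q' ∈ Z, ⟪b i, q - q'⟫ ≤ ⟪b i, x i - x' i⟫ := by
  -- Sequences over `ℕ`, of which only the first `k` terms matter, let the induction proceed by
  -- `Function.update`. The span condition is an extra invariant that produces triangularity.
  have main : ∀ k : ℕ, 1 ≤ k → k ≤ n → ∃ b x x' : ℕ → E n,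
      (∀ i < k, x i ∈ Z) ∧ (∀ i < k, x' i ∈ Z) ∧ b 0 = e ∧ x 0 - x' 0 = r • e ∧
      (∀ i < k, ‖b i‖ = 1) ∧ (∀ i < k, ∀ j < k, i ≠ j → ⟪b i, b j⟫ = 0) ∧
      (∀ i < k, x i - x' i ∈ Submodule.span ℝ (b '' Iio k)) ∧
      (∀ j < k, ∀ i < j, ⟪b j, x i - x' i⟫ = 0) ∧
      (∀ i < k, 0 < ⟪b i, x i - x' i⟫) ∧
      ∀ i < k, i ≠ 0 → ∀ q ∈ Z, ∀ q' ∈ Z, ⟪b i, q - q'⟫ ≤ ⟪b i, x i - x' i⟫ := by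
    intro k hk
    induction k, hk using Nat.le_induction with
    | base =>
      intro _
      refine ⟨fun _ => e, fun _ => z, fun _ => z', fun _ _ => hz, fun _ _ => hz', rfl, hzz,
        fun _ _ => he, fun i hi j hj hij => by omega, fun i hi => ?_, fun j hj i hij => by omega,
        fun i hi => ?_, fun i hi h0 => by omega⟩
      · rw [hzz]
        exact Submodule.smul_mem _ _ (Submodule.subset_span ⟨0, by simp, rfl⟩)
      · rw [hzz, inner_smul_right, real_inner_self_eq_norm_sq, he]; simpa using hr
    | succ k hk ih =>
      intro hkn
      obtain ⟨b, x, x', hx, hx', hb0, hx0, hnorm, horth, hspan, htri, hpos, hwid⟩ := ih (by omega)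
      set S := Submodule.span ℝ (b '' Iio k) with hS
      have hfin : Module.finrank ℝ S < n := by
        have hc : b '' Iio k = ((Finset.range k).image b : Finset (E n)) := by
          ext; simp
        have h1 : Module.finrank ℝ S ≤ ((Finset.range k).image b).card := by
          rw [hS, hc]; exact finrank_span_finset_le_card _
        have h2 := Finset.card_image_le (s := Finset.range k) (f := b)
        rw [Finset.card_range] at h2
        omega
      obtain ⟨f, y, y', hf1, hfS, hy, hy', hfpos, hfmem, hfw⟩ := exists_greedy_extension hZ hi S hfin
      have hfb : ∀ i < k, ⟪b i, f⟫ = 0 := fun i hi =>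
        hfS _ (Submodule.subset_span ⟨i, hi, rfl⟩)
      have hle : S ≤ Submodule.span ℝ (Function.update b k f '' Iio (k + 1)) := by
        refine Submodule.span_mono ?_
        rintro _ ⟨i, hi, rfl⟩
        have hi' : i < k := hi
        refine ⟨i, mem_Iio.2 (by omega), Function.update_of_ne (by omega) _ _⟩
      have hfk : f ∈ Submodule.span ℝ (Function.update b k f '' Iio (k + 1)) :=
        Submodule.subset_span ⟨k, mem_Iio.2 (by omega), Function.update_self _ _ _⟩
      have cases : ∀ i < k + 1, i < k ∨ i = k := fun i hi => by omega
      have hk0 : (0 : ℕ) ≠ k := by omega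
      have up : ∀ (g : ℕ → E n) (w : E n) (i : ℕ), i < k → Function.update g k w i = g i :=
        fun g w i hi => Function.update_of_ne (by omega) _ _
      refine ⟨Function.update b k f, Function.update x k y, Function.update x' k y', ?_, ?_, ?_, ?_,
        ?_, ?_, ?_, ?_, ?_, ?_⟩
      · intro i hi
        rcases cases i hi with h | rfl
        · rw [up _ _ _ h]; exact hx i h
        · simpa using hy
      · intro i hi
        rcases cases i hi with h | rfl
        · rw [up _ _ _ h]; exact hx' i h
        · simpa using hy'
      · rw [up _ _ _ (by omega), hb0]
      · rw [up _ _ _ (by omega), up _ _ _ (by omega), hx0]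
      · intro i hi
        rcases cases i hi with h | rfl
        · rw [up _ _ _ h]; exact hnorm i h
        · simpa using hf1
      · intro i hi j hj hij
        rcases cases i hi with h | rfl <;> rcases cases j hj with h' | rfl
        · rw [up _ _ _ h, up _ _ _ h']; exact horth i h j h' hij
        · rw [up _ _ _ h, Function.update_self]; exact hfb i h
        · rw [up _ _ _ h', Function.update_self, real_inner_comm]; exact hfb j h'
        · exact absurd rfl hij
      · intro i hi
        rcases cases i hi with h | rfl
        · rw [up _ _ _ h, up _ _ _ h]; exact hle (hspan i h)
        · simp only [Function.update_self]
          have := Submodule.add_mem _ (hle hfmem) (Submodule.smul_mem _ ⟪f, y - y'⟫ hfk)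
          rwa [sub_add_cancel] at this
      · intro j hj i hij
        rcases cases j hj with h | rfl
        · rw [up _ _ _ h, up _ _ _ (by omega), up _ _ _ (by omega)]; exact htri j h i hij
        · rw [Function.update_self, up _ _ _ hij, up _ _ _ hij, real_inner_comm]
          exact hfS _ (hspan i hij)
      · intro i hi
        rcases cases i hi with h | rfl
        · rw [up _ _ _ h, up _ _ _ h, up _ _ _ h]; exact hpos i h
        · simpa using hfpos
      · intro i hi hi0
        rcases cases i hi with h | rfl
        · rw [up _ _ _ h, up _ _ _ h, up _ _ _ h]; exact hwid i h hi0
        · simpa using hfw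
  obtain ⟨b, x, x', hx, hx', hb0, hx0, hnorm, horth, -, htri, hpos, hwid⟩ := main n hn le_rfl
  have hon : Orthonormal ℝ fun i : Fin n => b i :=
    ⟨fun i => hnorm i i.2, fun i j hij => horth i i.2 j j.2 fun h => hij (Fin.ext h)⟩
  have hsp : (Submodule.span ℝ (range fun i : Fin n => b i))ᗮ = ⊥ := by
    rw [Submodule.orthogonal_eq_bot_iff]
    exact hon.linearIndependent.span_eq_top_of_card_eq_finrank' (by simp)
  refine ⟨OrthonormalBasis.mkOfOrthogonalEqBot hon hsp, fun i => x i, fun i => x' i,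
    fun i => hx i i.2, fun i => hx' i i.2, ?_, hx0, ?_, ?_, ?_⟩
  · simpa using hb0
  · intro i j hij
    simpa using htri j j.2 i hij
  · intro i
    simpa using hpos i i.2
  · intro i hi0
    simpa using hwid i i.2 fun h => hi0 (Fin.ext h)

/-! ### Convex costs: convexity, compactness and globality of supports -/

/-- `y` lies in the `c`-subdifferential of `u` at `q`: the function
`q' ↦ u q - c q' y + c q y` supports `u` from below at `q`. -/
def IsSupport (c : E n → E n → ℝ) (X Y : Set (E n)) (u : E n → ℝ) (q y : E n) : Prop :=
  y ∈ Y ∧ ∀ q' ∈ X, u q - c q' y + c q y ≤ u q'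

/-- A `c`-convex function `u` for a cost `c` whose negatives `-c(·, y)` are convex, with gradient
`p(·, y)`, and which interpolates convexly along the segments of the coordinate `p(q, ·)`. -/
structure ConvexCost (X Y : Set (E n)) (c : E n → E n → ℝ) (p : E n → E n → E n)
    (u : E n → ℝ) (y₀ : E n) : Prop where
  isCompact_X : IsCompact X
  convex_X : Convex ℝ X
  isCompact_Y : IsCompact Y
  base_mem : y₀ ∈ Y
  cont_c : ContinuousOn (fun r : E n × E n => c r.1 r.2) (X ×ˢ Y)
  cont_p : ContinuousOn (fun r : E n × E n => p r.1 r.2) (X ×ˢ Y)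
  subgrad : ∀ y ∈ Y, ∀ q ∈ X, ∀ q' ∈ X, ⟪p q y, q' - q⟫ ≤ c q y - c q' y
  inj : ∀ q ∈ X, InjOn (p q) Y
  interp : ∀ q ∈ X, ∀ y₁ ∈ Y, ∀ y₂ ∈ Y, ∀ a b : ℝ, 0 ≤ a → 0 ≤ b → a + b = 1 →
    ∃ y ∈ Y, p q y = a • p q y₁ + b • p q y₂ ∧
      ∀ q' ∈ X, c q y - c q' y ≤ a * (c q y₁ - c q' y₁) + b * (c q y₂ - c q' y₂)
  base_c : ∀ q ∈ X, c q y₀ = 0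
  base_p : ∀ q ∈ X, p q y₀ = 0
  supp : ∀ q ∈ X, ∃ y, IsSupport c X Y u q y

theorem exists_inner_lt_of_notMem {s : Set (E n)} (hs : Convex ℝ s) (hc : IsClosed s) {x : E n}
    (hx : x ∉ s) : ∃ v : E n, ∀ a ∈ s, ⟪a, v⟫ < ⟪x, v⟫ := by
  obtain ⟨f, r, h1, h2⟩ := geometric_hahn_banach_closed_point hs hc hx
  refine ⟨(InnerProductSpace.toDual ℝ (E n)).symm f, fun a ha => ?_⟩
  rw [real_inner_comm, real_inner_comm _ x, InnerProductSpace.toDual_symm_apply,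
    InnerProductSpace.toDual_symm_apply]
  exact (h1 a ha).trans h2

namespace ConvexCost

variable {X Y : Set (E n)} {c : E n → E n → ℝ} {p : E n → E n → E n} {u : E n → ℝ} {y₀ : E n}

/-- A function with a subgradient at every point of a convex set is convex. -/
theorem convexOn_neg_cost (S : ConvexCost X Y c p u y₀) {y : E n} (hy : y ∈ Y) :
    ConvexOn ℝ X fun q => -c q y := by
  refine ⟨S.convex_X, fun q₁ h₁ q₂ h₂ a b ha hb hab => ?_⟩
  have hq := S.convex_X h₁ h₂ ha hb hab
  have e1 := mul_le_mul_of_nonneg_left (S.subgrad y hy _ hq _ h₁) ha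
  have e2 := mul_le_mul_of_nonneg_left (S.subgrad y hy _ hq _ h₂) hb
  have e3 : a * ⟪p (a • q₁ + b • q₂) y, q₁ - (a • q₁ + b • q₂)⟫
      + b * ⟪p (a • q₁ + b • q₂) y, q₂ - (a • q₁ + b • q₂)⟫ = 0 := by
    rw [← real_inner_smul_right, ← real_inner_smul_right, ← inner_add_right]
    have : a • (q₁ - (a • q₁ + b • q₂)) + b • (q₂ - (a • q₁ + b • q₂)) = 0 := by
      obtain rfl : a = 1 - b := by linarith
      module
    rw [this, inner_zero_right]
  obtain rfl : a = 1 - b := by linarith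
  simp only [smul_eq_mul]
  linarith

/-- At a convex combination `u` coincides with its support there, a convex function lying below `u`.
-/
theorem convexOn (S : ConvexCost X Y c p u y₀) : ConvexOn ℝ X u := by
  refine ⟨S.convex_X, fun q₁ h₁ q₂ h₂ a b ha hb hab => ?_⟩
  have hq := S.convex_X h₁ h₂ ha hb hab
  obtain ⟨y, hy, hs⟩ := S.supp _ hq
  have e1 := mul_le_mul_of_nonneg_left (hs _ h₁) ha
  have e2 := mul_le_mul_of_nonneg_left (hs _ h₂) hb
  have e3 := (S.convexOn_neg_cost hy).2 h₁ h₂ ha hb hab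
  obtain rfl : a = 1 - b := by linarith
  simp only [smul_eq_mul] at e3 ⊢
  linarith

/-- All supports are vertical translates of the functions `-c(·, y)`, which share a modulus of
continuity by compactness; `u` inherits it. -/
theorem continuousOn (S : ConvexCost X Y c p u y₀) : ContinuousOn u X := by
  have huc := (S.isCompact_X.prod S.isCompact_Y).uniformContinuousOn_of_continuous S.cont_c
  rw [Metric.uniformContinuousOn_iff] at huc
  rw [Metric.continuousOn_iff]
  intro q hq ε hε
  obtain ⟨δ, hδ, h⟩ := huc ε hε
  have key : ∀ q₁ ∈ X, ∀ q₂ ∈ X, dist q₁ q₂ < δ → u q₁ - u q₂ < ε := by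
    intro q₁ h₁ q₂ h₂ hd
    obtain ⟨y, hy, hs⟩ := S.supp _ h₁
    have := h (q₁, y) ⟨h₁, hy⟩ (q₂, y) ⟨h₂, hy⟩ (by simpa [Prod.dist_eq] using hd)
    rw [Real.dist_eq] at this
    have h3 := abs_lt.1 this
    have := hs _ h₂
    simp only at h3
    linarith
  refine ⟨δ, hδ, fun q' hq' hd => ?_⟩
  rw [Real.dist_eq, abs_lt]
  have h1 := key q' hq' q hq hd
  have h2 := key q hq q' hq' (by rwa [dist_comm])
  constructor <;> linarith

theorem isCompact_sublevel (S : ConvexCost X Y c p u y₀) : IsCompact {q ∈ X | u q ≤ 0} := by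
  refine S.isCompact_X.of_isClosed_subset ?_ (fun q h => h.1)
  exact S.continuousOn.preimage_isClosed_of_isClosed S.isCompact_X.isClosed isClosed_Iic

theorem convex_sublevel (S : ConvexCost X Y c p u y₀) : Convex ℝ {q ∈ X | u q ≤ 0} :=
  S.convexOn.convex_le 0

theorem tendsto_cost (S : ConvexCost X Y c p u y₀) {z y : ℕ → E n} {q y' : E n}
    (hz : ∀ k, z k ∈ X) (hy : ∀ k, y k ∈ Y) (hq : q ∈ X) (hy' : y' ∈ Y)
    (h1 : Tendsto z atTop (𝓝 q)) (h2 : Tendsto y atTop (𝓝 y')) :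
    Tendsto (fun k => c (z k) (y k)) atTop (𝓝 (c q y')) ∧
    Tendsto (fun k => p (z k) (y k)) atTop (𝓝 (p q y')) := by
  have ht : Tendsto (fun k => (z k, y k)) atTop (𝓝[X ×ˢ Y] (q, y')) :=
    tendsto_nhdsWithin_iff.2 ⟨h1.prodMk_nhds h2, Eventually.of_forall fun k => ⟨hz k, hy k⟩⟩
  exact ⟨(S.cont_c (q, y') ⟨hq, hy'⟩).tendsto.comp ht,
    (S.cont_p (q, y') ⟨hq, hy'⟩).tendsto.comp ht⟩

/-- Supports at points converging to `q` subconverge to a support at `q`. -/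
theorem exists_limit_support (S : ConvexCost X Y c p u y₀) {z y : ℕ → E n} {q : E n}
    (hz : ∀ k, z k ∈ X) (hq : q ∈ X) (h1 : Tendsto z atTop (𝓝 q))
    (hy : ∀ k, IsSupport c X Y u (z k) (y k)) :
    ∃ (y' : E n) (φ : ℕ → ℕ), StrictMono φ ∧ Tendsto (y ∘ φ) atTop (𝓝 y') ∧
      IsSupport c X Y u q y' ∧
      Tendsto (fun k => p (z (φ k)) (y (φ k))) atTop (𝓝 (p q y')) := by
  obtain ⟨y', hy', φ, hφ, hlim⟩ := S.isCompact_Y.tendsto_subseq fun k => (hy k).1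
  have hzφ : Tendsto (fun k => z (φ k)) atTop (𝓝 q) := h1.comp hφ.tendsto_atTop
  obtain ⟨hc, hp⟩ := S.tendsto_cost (fun k => hz (φ k)) (fun k => (hy (φ k)).1) hq hy' hzφ hlim
  refine ⟨y', φ, hφ, hlim, ⟨hy', fun q' hq' => ?_⟩, hp⟩
  have hu : Tendsto (fun k => u (z (φ k))) atTop (𝓝 (u q)) :=
    (S.continuousOn q hq).tendsto.comp
      (tendsto_nhdsWithin_iff.2 ⟨hzφ, Eventually.of_forall fun k => hz (φ k)⟩)
  have hc' := (S.tendsto_cost (z := fun _ => q') (fun _ => hq') (fun k => (hy (φ k)).1) hq' hy'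
    tendsto_const_nhds hlim).1
  exact le_of_tendsto ((hu.sub hc').add hc) (Eventually.of_forall fun k => (hy (φ k)).2 q' hq')

/-- The `p(q, ·)`-image of a set of `y`s cut out by upper bounds on `c q y - c q' y` is convex
and compact. -/
theorem convex_image_bounded (S : ConvexCost X Y c p u y₀) {q : E n} (hq : q ∈ X)
    {A : Set (E n)} (hA : A ⊆ X) (g : E n → ℝ) :
    Convex ℝ (p q '' {y ∈ Y | ∀ q' ∈ A, c q y - c q' y ≤ g q'}) ∧
    IsCompact {y ∈ Y | ∀ q' ∈ A, c q y - c q' y ≤ g q'} ∧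
    IsCompact (p q '' {y ∈ Y | ∀ q' ∈ A, c q y - c q' y ≤ g q'}) := by
  have hcy : ∀ q ∈ X, ContinuousOn (fun y => c q y) Y := fun q hq =>
    S.cont_c.comp (by fun_prop : ContinuousOn (fun y => (q, y)) Y) fun y hy => ⟨hq, hy⟩
  have hpy : ContinuousOn (fun y => p q y) Y :=
    S.cont_p.comp (by fun_prop : ContinuousOn (fun y => (q, y)) Y) fun y hy => ⟨hq, hy⟩
  have hcomp : IsCompact {y ∈ Y | ∀ q' ∈ A, c q y - c q' y ≤ g q'} := by
    refine S.isCompact_Y.of_isClosed_subset ?_ (fun y h => h.1)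
    have : {y ∈ Y | ∀ q' ∈ A, c q y - c q' y ≤ g q'} =
        Y ∩ ⋂ q' ∈ A, {y ∈ Y | c q y - c q' y ≤ g q'} := by
      ext y
      simp only [mem_ofPred_eq, mem_inter_iff, mem_iInter]
      exact ⟨fun h => ⟨h.1, fun q' hq' => ⟨h.1, h.2 q' hq'⟩⟩,
        fun h => ⟨h.1, fun q' hq' => (h.2 q' hq').2⟩⟩
    rw [this]
    refine S.isCompact_Y.isClosed.inter (isClosed_biInter fun q' hq' => ?_)
    exact ((hcy q hq).sub (hcy q' (hA hq'))).preimage_isClosed_of_isClosed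
      S.isCompact_Y.isClosed isClosed_Iic
  refine ⟨?_, hcomp, hcomp.image_of_continuousOn (hpy.mono fun y h => h.1)⟩
  -- The `y` that `interp` places over the combined gradient has cost differences at most the
  -- average of the two given ones, so the bound `g` persists.
  rintro _ ⟨y₁, ⟨h₁, h₁'⟩, rfl⟩ _ ⟨y₂, ⟨h₂, h₂'⟩, rfl⟩ a b ha hb hab
  obtain ⟨y, hy, hpy, hle⟩ := S.interp q hq y₁ h₁ y₂ h₂ a b ha hb hab
  refine ⟨y, ⟨hy, fun q' hq' => ?_⟩, hpy⟩
  have e1 := mul_le_mul_of_nonneg_left (h₁' q' hq') ha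
  have e2 := mul_le_mul_of_nonneg_left (h₂' q' hq') hb
  have e3 := hle q' (hA hq')
  obtain rfl : a = 1 - b := by linarith
  linarith

/-- A local support at an interior point is a global one. -/
theorem isSupport_of_local (S : ConvexCost X Y c p u y₀) {q y : E n} (hq : q ∈ interior X)
    (hy : y ∈ Y) (h : ∀ᶠ q' in 𝓝 q, u q - c q' y + c q y ≤ u q') : IsSupport c X Y u q y := by
  have hqX := interior_subset hq
  -- `P` is the set of global supports at `q`, and its gradients form a compact convex set. If `p q
  -- y` were outside, some `v` would separate it strictly; supports at `q + s k • v` then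
  -- subconverge to a member of `P` on the wrong side.
  set P := {y' ∈ Y | ∀ q' ∈ X, c q y' - c q' y' ≤ u q' - u q} with hP
  have hPs : ∀ y' ∈ P, IsSupport c X Y u q y' := fun y' h' =>
    ⟨h'.1, fun q' hq' => by linarith [h'.2 q' hq']⟩
  obtain ⟨hconv, -, hcomp⟩ := S.convex_image_bounded hqX subset_rfl fun q' => u q' - u q
  by_cases hmem : p q y ∈ p q '' P
  · obtain ⟨y', hy', he⟩ := hmem
    rw [← S.inj q hqX hy'.1 hy he]
    exact hPs y' hy'
  exfalso
  obtain ⟨v, hv⟩ := exists_inner_lt_of_notMem hconv hcomp.isClosed hmem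
  have hev : ∀ᶠ t : ℝ in 𝓝 0, q + t • v ∈ X ∧ u q - c (q + t • v) y + c q y ≤ u (q + t • v) := by
    have hc : ContinuousAt (fun t : ℝ => q + t • v) 0 := by fun_prop
    have hX : ∀ᶠ q' in 𝓝 q, q' ∈ X := mem_interior_iff_mem_nhds.1 hq
    have := hX.and h
    have hq0 : q + (0 : ℝ) • v = q := by rw [zero_smul, add_zero]
    exact hc.eventually (p := fun q' => q' ∈ X ∧ u q - c q' y + c q y ≤ u q') (by beta_reduce; rwa [hq0])
  obtain ⟨r, hr, hball⟩ := Metric.eventually_nhds_iff.1 hev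
  set s : ℕ → ℝ := fun k => (r / 2) * (1 / ((k : ℝ) + 1)) with hs
  have hs0 : ∀ k, 0 < s k := fun k => by positivity
  have hsr : ∀ k, dist (s k) 0 < r := fun k => by
    rw [dist_zero_right, Real.norm_eq_abs, abs_of_pos (hs0 k)]
    have : 1 / ((k : ℝ) + 1) ≤ 1 := by
      rw [div_le_one (by positivity)]; linarith [(Nat.cast_nonneg k : (0 : ℝ) ≤ k)]
    calc s k ≤ (r / 2) * 1 := mul_le_mul_of_nonneg_left this (by positivity)
      _ < r := by linarith
  have hslim : Tendsto s atTop (𝓝 0) := by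
    simpa only [mul_zero] using (tendsto_one_div_add_atTop_nhds_zero_nat (𝕜 := ℝ)).const_mul (r / 2)
  have hzX : ∀ k, q + s k • v ∈ X := fun k => (hball (hsr k)).1
  choose w hw using fun k => S.supp _ (hzX k)
  have hlim : Tendsto (fun k => q + s k • v) atTop (𝓝 q) := by
    simpa using tendsto_const_nhds.add (hslim.smul_const v)
  obtain ⟨y', φ, hφ, -, hsup, hpl⟩ := S.exists_limit_support hzX hqX hlim hw
  -- Monotonicity of gradients along `v`: the support at `q + s k • v` is tested at `q`, and the
  -- local support at `q` is tested at `q + s k • v`.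
  have hge : ∀ k, ⟪p q y, v⟫ ≤ ⟪p (q + s k • v) (w k), v⟫ := by
    intro k
    have e1 := (hw k).2 q hqX
    have e2 := (hball (hsr k)).2
    have e3 := S.subgrad _ (hw k).1 _ (hzX k) _ hqX
    have e4 := S.subgrad _ hy _ hqX _ (hzX k)
    rw [add_sub_cancel_left, inner_smul_right] at e4
    rw [show q - (q + s k • v) = -(s k • v) by abel, inner_neg_right, inner_smul_right] at e3
    have : s k * ⟪p q y, v⟫ ≤ s k * ⟪p (q + s k • v) (w k), v⟫ := by linarith
    exact le_of_mul_le_mul_left this (hs0 k)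
  have hfin : ⟪p q y, v⟫ ≤ ⟪p q y', v⟫ :=
    ge_of_tendsto (hpl.inner tendsto_const_nhds) (Eventually.of_forall fun k => hge (φ k))
  exact absurd (hv _ ⟨y', ⟨hsup.1, fun q' hq' => by linarith [hsup.2 q' hq']⟩, rfl⟩) (not_lt.2 hfin)

variable {Z : Set (E n)}

/-- Sliding a supporting function of the cone over the section down to the graph. -/
theorem exists_isSupport_of_cone (S : ConvexCost X Y c p u y₀) (hZ : Z = {q ∈ X | u q ≤ 0})
    (hfr : ∀ q ∈ frontier Z, u q = 0) {q₀ y : E n} (hq₀ : q₀ ∈ interior Z) (hy : y ∈ Y)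
    (hle : ∀ q ∈ Z, c q₀ y - c q y ≤ -u q₀) : ∃ q ∈ Z, IsSupport c X Y u q y := by
  have hZc : IsCompact Z := hZ ▸ S.isCompact_sublevel
  have hZX : Z ⊆ X := hZ ▸ fun q h => h.1
  have hcont : ContinuousOn (fun q => u q + c q y) Z :=
    (S.continuousOn.mono hZX).add (S.cont_c.comp
      (by fun_prop : ContinuousOn (fun q => (q, y)) Z) fun q hq => ⟨hZX hq, hy⟩)
  have hq₀Z := interior_subset hq₀
  have loc : ∀ q ∈ interior Z, (∀ q' ∈ Z, u q + c q y ≤ u q' + c q' y) →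
      IsSupport c X Y u q y := by
    intro q hq hmin
    refine S.isSupport_of_local (interior_mono hZX hq) hy ?_
    filter_upwards [mem_interior_iff_mem_nhds.1 hq] with q' hq'
    linarith [hmin q' hq']
  -- Sliding a translate of `-c(·, y)` until it touches `u` from below on `Z` amounts to minimising
  -- `u + c(·, y)` there.
  obtain ⟨q₁, hq₁, hmin⟩ := hZc.exists_isMinOn ⟨q₀, hq₀Z⟩ hcont
  have hmin' := isMinOn_iff.1 hmin
  by_cases hint : q₁ ∈ interior Z
  · exact ⟨q₁, hq₁, loc q₁ hint hmin'⟩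
  -- On the frontier `u = 0`, and `hle` gives `u q₀ + c q₀ y ≤ c q₁ y`. Hence the interior point
  -- `q₀` is a minimiser too.
  · have h0 : u q₁ = 0 := hfr q₁ ⟨subset_closure hq₁, hint⟩
    refine ⟨q₀, hq₀Z, loc q₀ hq₀ fun q' hq' => ?_⟩
    have := hmin' q' hq'
    have h1 := hle q₁ hq₁
    linarith

end ConvexCost

/-! ### Cone gradients and the two Alexandrov estimates -/

theorem exists_add_smul_mem_of_mem_interior {Z : Set (E n)} {q : E n} (hq : q ∈ interior Z)
    (e : E n) : ∃ ε : ℝ, 0 < ε ∧ q + ε • e ∈ Z := by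
  have hc : ContinuousAt (fun t : ℝ => q + t • e) 0 := by fun_prop
  have h0 : q + (0 : ℝ) • e = q := by rw [zero_smul, add_zero]
  have hev : ∀ᶠ t : ℝ in 𝓝 0, q + t • e ∈ Z :=
    hc.eventually_mem (by beta_reduce; rw [h0]; exact mem_interior_iff_mem_nhds.1 hq)
  obtain ⟨t, ht, hpos⟩ := ((hev.filter_mono nhdsWithin_le_nhds).and
    (self_mem_nhdsWithin : Ioi (0 : ℝ) ∈ 𝓝[>] 0)).exists
  exact ⟨t, hpos, ht⟩

theorem inner_sub_pos_of_isMax {Z : Set (E n)} {q₀ q₁ e : E n} (hq₀ : q₀ ∈ interior Z)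
    (he : ‖e‖ = 1) (hmax : ∀ q ∈ Z, ⟪e, q⟫ ≤ ⟪e, q₁⟫) : 0 < ⟪e, q₁ - q₀⟫ := by
  obtain ⟨ε, hε, h⟩ := exists_add_smul_mem_of_mem_interior hq₀ e
  have := hmax _ h
  rw [inner_add_right, inner_smul_right, real_inner_self_eq_norm_sq, he] at this
  rw [inner_sub_right]
  linarith

namespace ConvexCost

variable {X Y : Set (E n)} {c : E n → E n → ℝ} {p : E n → E n → E n} {u : E n → ℝ} {y₀ : E n}
variable {Z : Set (E n)}

/-- At a point of the section which is extremal in direction `e`, the cone with vertex over `q₀`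
has a `c`-support whose gradient is the multiple of `e` given by the height of the cone. -/
theorem exists_cone_gradient (S : ConvexCost X Y c p u y₀) (hZ : Z = {q ∈ X | u q ≤ 0})
    (hfr : ∀ q ∈ frontier Z, u q = 0) {q₀ q₁ e : E n} (hq₀ : q₀ ∈ interior Z) (he : ‖e‖ = 1)
    (hq₁ : q₁ ∈ Z) (hmax : ∀ q ∈ Z, ⟪e, q⟫ ≤ ⟪e, q₁⟫) :
    ∃ y ∈ Y, p q₁ y = (-u q₀ / ⟪e, q₁ - q₀⟫) • e ∧ ∀ q ∈ Z, c q₀ y - c q y ≤ -u q₀ := by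
  have hZc : IsCompact Z := hZ ▸ S.isCompact_sublevel
  have hZconv : Convex ℝ Z := hZ ▸ S.convex_sublevel
  have hZX : Z ⊆ X := hZ ▸ fun q h => h.1
  have hZu : ∀ q ∈ Z, u q ≤ 0 := fun q h => by rw [hZ] at h; exact h.2
  have hd := inner_sub_pos_of_isMax hq₀ he hmax
  have hq₀Z := interior_subset hq₀
  have hH : 0 ≤ -u q₀ := by linarith [hZu _ hq₀Z]
  generalize hHdef : -u q₀ = H at hH ⊢
  generalize hddef : ⟪e, q₁ - q₀⟫ = d at hd ⊢
  have hq₁int : q₁ ∉ interior Z := fun h => by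
    have := inner_sub_pos_of_isMax h he hmax
    simp at this
  have hu₁ : u q₁ = 0 := hfr _ ⟨subset_closure hq₁, hq₁int⟩
  obtain ⟨hconv, -, hcomp⟩ := S.convex_image_bounded (hZX hq₁) hZX fun _ => 0
  -- If `c q₁ y - c · y` is nonpositive on `Z` and has this gradient at `q₁`, convexity limits its
  -- drop from `q₁` to `q₀` to `(H / d) * d = H`.
  suffices hmem : (H / d) • e ∈ p q₁ '' {y ∈ Y | ∀ q' ∈ Z, c q₁ y - c q' y ≤ 0} by
    obtain ⟨y, ⟨hy, hle⟩, hpy⟩ := hmem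
    refine ⟨y, hy, hpy, fun q hq => ?_⟩
    have h1 := hle q hq
    have h2 := S.subgrad y hy _ (hZX hq₁) _ (hZX hq₀Z)
    rw [hpy, real_inner_smul_left, ← neg_sub q₁ q₀, inner_neg_right, hddef] at h2
    have : H / d * -d = -H := by field_simp
    linarith
  by_contra hnot
  -- Testing the separation against the gradient `0` of `y₀` shows that `⟪e, v⟫` and `H` are
  -- positive.
  obtain ⟨v, hv⟩ := exists_inner_lt_of_notMem hconv hcomp.isClosed hnot
  have hv0 := hv 0 ⟨y₀, ⟨S.base_mem, fun q' hq' => by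
    rw [S.base_c _ (hZX hq₁), S.base_c _ (hZX hq')]; simp⟩, S.base_p _ (hZX hq₁)⟩
  rw [inner_zero_left, real_inner_smul_left] at hv0
  have hHd : 0 ≤ H / d := by positivity
  have hev : 0 < ⟪e, v⟫ := by
    by_contra h
    nlinarith
  have hHpos : 0 < H := by
    rcases hH.eq_or_lt with h | h
    · rw [← h] at hv0; simp at hv0
    · exact h
  generalize hevdef : ⟪e, v⟫ = ev at hev hv0
  set s : ℕ → ℝ := fun k => 1 / ((k : ℝ) + 1) with hs
  have hs0 : ∀ k, 0 < s k := fun k => by positivity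
  have hslim : Tendsto s atTop (𝓝 0) := tendsto_one_div_add_atTop_nhds_zero_nat
  -- A step from `q₁` along `v` leaves `Z`, since `⟪e, ·⟫` exceeds its maximum; the way back to the
  -- interior point `q₀` crosses the frontier, where `u = 0`.
  have hexz : ∀ k, ∃ τ : ℝ, 0 ≤ τ ∧ τ ≤ 1 ∧
      (q₁ + s k • v) + τ • (q₀ - (q₁ + s k • v)) ∈ frontier Z := by
    intro k
    have hw : q₁ + s k • v ∉ Z := fun h => by
      have := hmax _ h
      rw [inner_add_right, inner_smul_right, hevdef] at this
      have := mul_pos (hs0 k) hev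
      linarith
    obtain ⟨z, hz, hzf⟩ : ∃ z ∈ segment ℝ (q₁ + s k • v) q₀, z ∈ frontier Z := by
      by_contra! hno
      obtain ⟨x, -, hx, hx'⟩ := (convex_segment (𝕜 := ℝ) (q₁ + s k • v) q₀).isPreconnected
        (interior Z) Zᶜ isOpen_interior hZc.isClosed.isOpen_compl
        (fun x hx => by
          by_cases hxZ : x ∈ Z
          · exact Or.inl (by_contra fun h => hno x hx ⟨subset_closure hxZ, h⟩)
          · exact Or.inr hxZ)
        ⟨q₀, right_mem_segment _ _ _, hq₀⟩ ⟨_, left_mem_segment _ _ _, hw⟩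
      exact hx' (interior_subset hx)
    rw [segment_eq_image'] at hz
    obtain ⟨τ, hτ, rfl⟩ := hz
    exact ⟨τ, hτ.1, hτ.2, hzf⟩
  choose τ hτ0 hτ1 hzf using hexz
  obtain ⟨τ', hτ', φ, hφ, hτlim⟩ := isCompact_Icc.tendsto_subseq (x := τ) fun k => ⟨hτ0 k, hτ1 k⟩
  set z : ℕ → E n := fun k => (q₁ + s (φ k) • v) + τ (φ k) • (q₀ - (q₁ + s (φ k) • v)) with hz
  have hsφ : Tendsto (fun k => s (φ k)) atTop (𝓝 0) := hslim.comp hφ.tendsto_atTop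
  have hzlim : Tendsto z atTop (𝓝 (q₁ + τ' • (q₀ - q₁))) := by
    have h1 : Tendsto (fun k => q₁ + s (φ k) • v) atTop (𝓝 q₁) := by
      simpa using tendsto_const_nhds.add (hsφ.smul_const v)
    exact h1.add (hτlim.smul (tendsto_const_nhds.sub h1))
  -- For `τ' > 0` the limit would be interior to `Z`, but limits of frontier points are frontier
  -- points. So the crossing points tend to `q₁`.
  have hτ'0 : τ' = 0 := by
    by_contra hne
    have hpos : 0 < τ' := lt_of_le_of_ne hτ'.1 (Ne.symm hne)
    have h1 := hZconv.add_smul_sub_mem_interior hq₁ hq₀ ⟨hpos, hτ'.2⟩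
    have h2 := isClosed_frontier.mem_of_tendsto hzlim (Eventually.of_forall fun k => hzf (φ k))
    exact h2.2 h1
  rw [hτ'0, zero_smul, add_zero] at hzlim
  have hzZ : ∀ k, z k ∈ Z := fun k => hZc.isClosed.frontier_subset (hzf (φ k))
  choose y hy using fun k => S.supp _ (hZX (hzZ k))
  obtain ⟨y', ψ, hψ, -, hsup, hpl⟩ :=
    S.exists_limit_support (fun k => hZX (hzZ k)) (hZX hq₁) hzlim hy
  -- The support at `z k`, which vanishes there, is at most `-H` at `q₀` and at most `0` at `q₁`;
  -- convexity turns this into `f1` and `f2`. Maximality of `q₁` in direction `e` bounds the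
  -- crossing parameter `t` from below in `f5`. In the limit the slope along `v` is at least `H / d
  -- * ev`, against the separation.
  have hge : ∀ k, H * ev / (d + s (φ k) * ev) ≤ ⟪p (z k) (y k), v⟫ := by
    intro k
    have hsk := hs0 (φ k)
    have hτa := hτ0 (φ k)
    have hτb := hτ1 (φ k)
    have huz : u (z k) = 0 := hfr _ (hzf (φ k))
    have e1 := S.subgrad _ (hy k).1 _ (hZX (hzZ k)) _ (hZX hq₀Z)
    have e1' := (hy k).2 _ (hZX hq₀Z)
    have e2 := S.subgrad _ (hy k).1 _ (hZX (hzZ k)) _ (hZX hq₁)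
    have e2' := (hy k).2 _ (hZX hq₁)
    have e3 := hmax _ (hzZ k)
    rw [huz] at e1' e2'
    rw [hu₁] at e2'
    have f0 := e1.trans (show c (z k) (y k) - c q₀ (y k) ≤ u q₀ by linarith)
    have f0' := e2.trans (show c (z k) (y k) - c q₁ (y k) ≤ 0 by linarith)
    generalize hpk : p (z k) (y k) = P at f0 f0' ⊢
    simp only [hz] at f0 f0' e3
    generalize s (φ k) = σ at *
    generalize τ (φ k) = t at *
    set g := ⟪P, (q₁ + σ • v) - q₀⟫ with hg
    have r1 : q₀ - (q₁ + σ • v + t • (q₀ - (q₁ + σ • v))) = -((1 - t) • ((q₁ + σ • v) - q₀)) := by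
      module
    have r2 : q₁ - (q₁ + σ • v + t • (q₀ - (q₁ + σ • v))) = t • ((q₁ + σ • v) - q₀) - σ • v := by
      module
    have r3 : ⟪e, q₁ + σ • v + t • (q₀ - (q₁ + σ • v))⟫ = ⟪e, q₁⟫ + σ * ev - t * (d + σ * ev) := by
      rw [show q₁ + σ • v + t • (q₀ - (q₁ + σ • v)) = q₁ + σ • v - t • ((q₁ - q₀) + σ • v) by module]
      rw [inner_sub_right, inner_add_right, inner_smul_right, inner_smul_right, inner_add_right,
        inner_smul_right, hddef, hevdef]
    rw [r1, inner_neg_right, inner_smul_right, ← hg] at f0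
    rw [r2, inner_sub_right, inner_smul_right, inner_smul_right, ← hg] at f0'
    rw [r3] at e3
    have f1 : H ≤ (1 - t) * g := by linarith
    have f2 : t * g ≤ σ * ⟪P, v⟫ := by linarith
    have f3 : H ≤ g := by
      have : 0 < g := by
        by_contra h
        nlinarith
      nlinarith
    have hden : 0 < d + σ * ev := by positivity
    rw [div_le_iff₀ hden]
    have f4 : t * H ≤ σ * ⟪P, v⟫ := le_trans (mul_le_mul_of_nonneg_left f3 hτa) f2
    have f5 : σ * ev ≤ t * (d + σ * ev) := by linarith
    have f6 : σ * (H * ev) ≤ σ * (⟪P, v⟫ * (d + σ * ev)) := by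
      calc σ * (H * ev) = H * (σ * ev) := by ring
        _ ≤ H * (t * (d + σ * ev)) := mul_le_mul_of_nonneg_left f5 hHpos.le
        _ = (t * H) * (d + σ * ev) := by ring
        _ ≤ (σ * ⟪P, v⟫) * (d + σ * ev) := mul_le_mul_of_nonneg_right f4 hden.le
        _ = _ := by ring
    exact le_of_mul_le_mul_left f6 hsk
  have hlimL : Tendsto (fun k => H * ev / (d + s (φ (ψ k)) * ev)) atTop (𝓝 (H * ev / (d + 0 * ev))) :=
    tendsto_const_nhds.div (tendsto_const_nhds.add
      ((hsφ.comp hψ.tendsto_atTop).mul_const ev)) (by simpa using hd.ne')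
  have hfin := le_of_tendsto_of_tendsto hlimL (hpl.inner tendsto_const_nhds)
    (Eventually.of_forall fun k => hge (ψ k))
  have hlt := hv _ ⟨y', ⟨hsup.1, fun q' hq' => by
    have := hsup.2 q' (hZX hq'); linarith [hZu _ hq']⟩, rfl⟩
  rw [real_inner_smul_left, hevdef] at hlt
  have : H * ev / (d + 0 * ev) = H / d * ev := by rw [zero_mul, add_zero]; ring
  linarith

/-- Alexandrov type upper bound. -/
theorem pow_mul_le (S : ConvexCost X Y c p u y₀) (hn : 0 < n) {K : ℝ}
    (hK : ∀ (b : OrthonormalBasis (Fin n) ℝ (E n)) (p : Fin n → E n) (s : Fin n → ℝ),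
      (∀ i, 0 < s i) → (∀ i, ‖p i - s i • b i‖ ≤ s i / K) → (∏ i, s i) / 2 ≤ |b.toBasis.det p|)
    (hZ : Z = {q ∈ X | u q ≤ 0}) (hfr : ∀ q ∈ frontier Z, u q = 0) {q₀ : E n}
    (hq₀ : q₀ ∈ interior Z)
    (hsmall : ∀ q ∈ Z, ∀ q' ∈ Z, ∀ y ∈ Y, ‖p q y - p q' y‖ ≤ ‖p q' y‖ / K)
    {γ lam : ℝ} (hγ : 0 ≤ γ) (hlam : 0 < lam)
    (hvol : ∀ A ⊆ Y, IsCompact A → volume (p q₀ '' A) ≤ ENNReal.ofReal γ * volume A)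
    (hMA : volume {y | ∃ q ∈ Z, IsSupport c X Y u q y} ≤ ENNReal.ofReal (1 / lam) * volume Z)
    {z z' e q₁ : E n} {r : ℝ} (hz : z ∈ Z) (hz' : z' ∈ Z) (he : ‖e‖ = 1) (hr : 0 < r)
    (hzz : z - z' = r • e) (hmax : ∀ q ∈ Z, ⟪e, q⟫ ≤ ⟪e, q₁⟫) :
    (-u q₀) ^ n * r ≤
      2 * ((n : ℝ) ^ n) ^ 2 * (γ / lam) * (volume Z).toReal ^ 2 * ⟪e, q₁ - q₀⟫ := by
  have hZc : IsCompact Z := hZ ▸ S.isCompact_sublevel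
  have hZconv : Convex ℝ Z := hZ ▸ S.convex_sublevel
  have hZX : Z ⊆ X := hZ ▸ fun q h => h.1
  have hZu : ∀ q ∈ Z, u q ≤ 0 := fun q h => by rw [hZ] at h; exact h.2
  have hq₀Z := interior_subset hq₀
  have hdpos := inner_sub_pos_of_isMax hq₀ he hmax
  have hn' : (0 : ℝ) < n := by exact_mod_cast hn
  obtain ⟨V, hV0, hV⟩ : ∃ V : ℝ, 0 ≤ V ∧ volume Z = ENNReal.ofReal V :=
    ⟨(volume Z).toReal, ENNReal.toReal_nonneg, (ENNReal.ofReal_toReal hZc.measure_lt_top.ne).symm⟩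
  rw [hV, ENNReal.toReal_ofReal hV0]
  have hH : 0 ≤ -u q₀ := by linarith [hZu _ hq₀Z]
  rcases hH.eq_or_lt with h0 | hHpos
  · rw [← h0, zero_pow hn.ne', zero_mul]; positivity
  obtain ⟨b, x, x', hx, hx', hb0, hx0, htri, hpos, hwid⟩ :=
    exists_adapted_frame hn hZc ⟨q₀, hq₀⟩ hz hz' he hr hzz
  have hexm : ∀ i, ∃ m ∈ Z, ∀ q ∈ Z, ⟪b i, q⟫ ≤ ⟪b i, m⟫ := fun i => by
    obtain ⟨m, hm, h⟩ := hZc.exists_isMaxOn ⟨q₀, hq₀Z⟩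
      (by fun_prop : ContinuousOn (fun q => ⟪b i, q⟫) Z)
    exact ⟨m, hm, isMaxOn_iff.1 h⟩
  choose m hm hmmax using hexm
  have hd : ∀ i, 0 < ⟪b i, m i - q₀⟫ := fun i =>
    inner_sub_pos_of_isMax hq₀ (b.norm_eq_one i) (hmmax i)
  choose y hy hpy hyle using fun i =>
    S.exists_cone_gradient hZ hfr hq₀ (b.norm_eq_one i) (hm i) (hmmax i)
  have hs : ∀ i, 0 < -u q₀ / ⟪b i, m i - q₀⟫ := fun i => div_pos hHpos (hd i)
  -- `hsmall` carries the gradients from the extremal points `m i` to the common point `q₀` with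
  -- relative error `1 / K`, so they remain almost orthogonal.
  have hdet := hK b (fun i => p q₀ (y i)) (fun i => -u q₀ / ⟪b i, m i - q₀⟫) hs fun i => by
    have := hsmall q₀ hq₀Z (m i) (hm i) (y i) (hy i)
    rw [hpy, norm_smul, b.norm_eq_one, mul_one, Real.norm_eq_abs, abs_of_pos (hs i)] at this
    exact this
  obtain ⟨hPconv, hAcomp, -⟩ := S.convex_image_bounded (hZX hq₀Z) hZX fun _ => -u q₀
  -- `A` contains `y₀` and every `y i`, so its convex gradient image at `q₀` has volume bounded
  -- below by their determinant. On the other side `exists_isSupport_of_cone` puts `A` inside the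
  -- subdifferential image of `Z`.
  set A := {y ∈ Y | ∀ q' ∈ Z, c q₀ y - c q' y ≤ -u q₀} with hA
  have h0P : (0 : E n) ∈ p q₀ '' A := ⟨y₀, ⟨S.base_mem, fun q' hq' => by
    rw [S.base_c _ (hZX hq₀Z), S.base_c _ (hZX hq')]; linarith⟩, S.base_p _ (hZX hq₀Z)⟩
  have hlow := le_volume_of_convex_zero_mem hn b hPconv h0P (p := fun i => p q₀ (y i))
    fun i => ⟨y i, ⟨hy i, hyle i⟩, rfl⟩
  have hAsub : volume A ≤ volume {y | ∃ q ∈ Z, IsSupport c X Y u q y} :=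
    measure_mono fun y hy => S.exists_isSupport_of_cone hZ hfr hq₀ hy.1 hy.2
  have hchain : ENNReal.ofReal ((1 / n : ℝ) ^ n * |b.toBasis.det fun i => p q₀ (y i)|) ≤
      ENNReal.ofReal (γ * (1 / lam * V)) := by
    rw [ENNReal.ofReal_mul hγ, ENNReal.ofReal_mul (p := 1 / lam) (by positivity), ← hV]
    exact hlow.trans ((hvol A (fun y h => h.1) hAcomp).trans
      (mul_le_mul_right (hAsub.trans hMA) _))
  have hchain' := (ENNReal.ofReal_le_ofReal_iff (by positivity)).1 hchain
  have hZlow := le_volume_of_convex_segments hn b hZconv hx hx'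
  rw [det_eq_prod_of_triangular b _ htri, hV, ENNReal.ofReal_le_ofReal_iff hV0,
    abs_of_pos (Finset.prod_pos fun i _ => hpos i)] at hZlow
  rw [Finset.prod_div_distrib, Finset.prod_const, Finset.card_univ, Fintype.card_fin] at hdet
  set D := ∏ i, ⟪b i, m i - q₀⟫ with hD
  set W := ∏ i, ⟪b i, x i - x' i⟫ with hW
  have hDpos : 0 < D := Finset.prod_pos fun i _ => hd i
  -- For `i ≠ 0` the depth `⟪b i, m i - q₀⟫` is at most the width realised by the frame. The factor
  -- of index `0` is split off: its segment has length `r`, and its depth is compared with that of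
  -- `q₁`.
  have hDW : D * r ≤ ⟪e, q₁ - q₀⟫ * W := by
    rw [hD, hW, ← Finset.mul_prod_erase _ _ (Finset.mem_univ (⟨0, hn⟩ : Fin n)),
      ← Finset.mul_prod_erase Finset.univ (fun i => ⟪b i, x i - x' i⟫)
        (Finset.mem_univ (⟨0, hn⟩ : Fin n)), hx0, hb0, inner_smul_right,
      real_inner_self_eq_norm_sq, he]
    have h1 : ∏ i ∈ Finset.univ.erase ⟨0, hn⟩, ⟪b i, m i - q₀⟫ ≤
        ∏ i ∈ Finset.univ.erase ⟨0, hn⟩, ⟪b i, x i - x' i⟫ :=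
      Finset.prod_le_prod (fun i _ => (hd i).le) fun i hi =>
        hwid i (Finset.ne_of_mem_erase hi) _ (hm i) _ hq₀Z
    have h2 : ⟪e, m ⟨0, hn⟩ - q₀⟫ ≤ ⟪e, q₁ - q₀⟫ := by
      rw [inner_sub_right, inner_sub_right]
      linarith [hmax _ (hm ⟨0, hn⟩)]
    have h3 := mul_le_mul h2 h1 (Finset.prod_nonneg fun i _ => (hd i).le) hdpos.le
    calc _ ≤ _ * r := mul_le_mul_of_nonneg_right h3 hr.le
      _ = _ := by ring
  have hN : 0 < (n : ℝ) ^ n := by positivity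
  have hone : (1 / n : ℝ) ^ n = 1 / (n : ℝ) ^ n := by rw [div_pow, one_pow]
  rw [hone] at hchain' hZlow
  have k1 : (-u q₀) ^ n ≤ 2 * (n : ℝ) ^ n * (γ / lam) * V * D := by
    have : 1 / (n : ℝ) ^ n * ((-u q₀) ^ n / D / 2) ≤ γ * (1 / lam * V) :=
      (mul_le_mul_of_nonneg_left hdet (by positivity)).trans hchain'
    have h2 : 1 / (n : ℝ) ^ n * ((-u q₀) ^ n / D / 2) = (-u q₀) ^ n / (2 * (n : ℝ) ^ n * D) := by
      field_simp
    rw [h2, div_le_iff₀ (by positivity)] at this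
    calc _ ≤ _ := this
      _ = _ := by ring
  have k2 : W ≤ (n : ℝ) ^ n * V := by
    have h2 : 1 / (n : ℝ) ^ n * W = W / (n : ℝ) ^ n := by ring
    rw [h2, div_le_iff₀ hN] at hZlow
    linarith
  calc (-u q₀) ^ n * r ≤ 2 * (n : ℝ) ^ n * (γ / lam) * V * D * r :=
        mul_le_mul_of_nonneg_right k1 hr.le
    _ = 2 * (n : ℝ) ^ n * (γ / lam) * V * (D * r) := by ring
    _ ≤ 2 * (n : ℝ) ^ n * (γ / lam) * V * (⟪e, q₁ - q₀⟫ * ((n : ℝ) ^ n * V)) := by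
        refine mul_le_mul_of_nonneg_left (hDW.trans ?_) (by positivity)
        exact mul_le_mul_of_nonneg_left k2 hdpos.le
    _ = _ := by ring

/-- The `v i` span, so a small step from `a` away from an interior point `q` stays in the box; `a`
then lies strictly between a point of `Z` and `q`. -/
theorem symBox_center_mem_interior (b : OrthonormalBasis (Fin n) ℝ (E n))
    (hZconv : Convex ℝ Z) (hi : (interior Z).Nonempty) {a : E n} {v : Fin n → E n}
    (hv : b.toBasis.det v ≠ 0) {s : ℝ} (hs : 0 < s) (hsub : symBox a v s ⊆ Z) :
    a ∈ interior Z := by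
  obtain ⟨q, hq⟩ := hi
  have hbas := (Module.Basis.is_basis_iff_det (e := b.toBasis) (v := v)).2 (isUnit_iff_ne_zero.2 hv)
  have hmem : a - q ∈ Submodule.span ℝ (range v) := by rw [hbas.2]; trivial
  obtain ⟨t, ht⟩ := (Submodule.mem_span_range_iff_exists_fun ℝ).1 hmem
  have hsum : 0 ≤ ∑ i, |t i| := Finset.sum_nonneg fun i _ => abs_nonneg _
  set ε := s / (1 + ∑ i, |t i|) with hε
  have hεpos : 0 < ε := by positivity
  have h1 : a + ε • (a - q) ∈ Z := by
    refine hsub ⟨fun i => ε * t i, fun i => ?_, ?_⟩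
    · rw [abs_mul, abs_of_pos hεpos, hε, div_mul_eq_mul_div, div_le_iff₀ (by positivity)]
      refine mul_le_mul_of_nonneg_left ?_ hs.le
      have := Finset.single_le_sum (f := fun i => |t i|) (fun i _ => abs_nonneg _)
        (Finset.mem_univ i)
      linarith
    · rw [← ht, Finset.smul_sum]
      simp only [smul_smul]
  have h2 := hZconv.add_smul_sub_mem_interior h1 hq (t := ε / (1 + ε))
    ⟨by positivity, by rw [div_le_one (by positivity)]; linarith⟩
  convert h2 using 1
  have h3 : ε / (1 + ε) * (1 + ε) = ε := by field_simp
  have h4 : a + ε • (a - q) + (ε / (1 + ε)) • (q - (a + ε • (a - q))) =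
      a + ε • (a - q) - (ε / (1 + ε) * (1 + ε)) • (a - q) := by module
  rw [h4, h3]; abel

/-- Alexandrov type lower bound. -/
theorem mul_sq_volume_le (S : ConvexCost X Y c p u y₀) (hn : 0 < n)
    (hZ : Z = {q ∈ X | u q ≤ 0}) (hi : (interior Z).Nonempty) {h : ℝ} (hh : ∀ q ∈ Z, -h ≤ u q)
    {γ lam : ℝ} (hγ : 0 ≤ γ) (hlam : 0 < lam)
    (hvol : ∀ q₀ ∈ interior Z, ∀ A ⊆ Y, IsCompact A →
      volume A ≤ ENNReal.ofReal γ * volume (p q₀ '' A))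
    (hMA : ∀ Q ⊆ Z, IsCompact Q → ENNReal.ofReal lam * volume Q ≤
      volume {y | ∃ q ∈ Q, IsSupport c X Y u q y}) :
    lam * (volume Z).toReal ^ 2 ≤ (64 * (n : ℝ) ^ 2) ^ n * (γ * h ^ n) := by
  have hZc : IsCompact Z := hZ ▸ S.isCompact_sublevel
  have hZconv : Convex ℝ Z := hZ ▸ S.convex_sublevel
  have hZX : Z ⊆ X := hZ ▸ fun q h => h.1
  have hZu : ∀ q ∈ Z, u q ≤ 0 := fun q h => by rw [hZ] at h; exact h.2
  have hn' : (0 : ℝ) < n := by exact_mod_cast hn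
  obtain ⟨q₀, hq₀⟩ := hi
  have hq₀Z := interior_subset hq₀
  have hh0 : 0 ≤ h := by linarith [hh _ hq₀Z, hZu _ hq₀Z]
  -- Starting the frame with a diameter of `Z` makes the width bound hold for index `0` as well, so
  -- the parallelepiped of the frame segments controls the volume of `Z` from both sides.
  obtain ⟨⟨z, z'⟩, ⟨hz, hz'⟩, hmax⟩ := (hZc.prod hZc).exists_isMaxOn ⟨(q₀, q₀), hq₀Z, hq₀Z⟩
    (by fun_prop : ContinuousOn (fun r : E n × E n => ‖r.1 - r.2‖) (Z ×ˢ Z))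
  have hmax' : ∀ q ∈ Z, ∀ q' ∈ Z, ‖q - q'‖ ≤ ‖z - z'‖ := fun q hq q' hq' =>
    isMaxOn_iff.1 hmax (q, q') (mk_mem_prod hq hq')
  have hr : 0 < ‖z - z'‖ := by
    obtain ⟨ε, hε, hεZ⟩ := exists_add_smul_mem_of_mem_interior hq₀
      ((EuclideanSpace.basisFun (Fin n) ℝ) ⟨0, hn⟩)
    have := hmax' _ hεZ _ hq₀Z
    rw [add_sub_cancel_left, norm_smul, OrthonormalBasis.norm_eq_one, mul_one,
      Real.norm_eq_abs, abs_of_pos hε] at this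
    linarith
  have he : ‖‖z - z'‖⁻¹ • (z - z')‖ = 1 := by
    rw [norm_smul, norm_inv, norm_norm, inv_mul_cancel₀ hr.ne']
  obtain ⟨b, x, x', hx, hx', hb0, hx0, htri, hpos, hwid⟩ :=
    exists_adapted_frame hn hZc ⟨q₀, hq₀⟩ hz hz' he hr
      (by rw [smul_smul, mul_inv_cancel₀ hr.ne', one_smul])
  have hwid' : ∀ i, ∀ q ∈ Z, ∀ q' ∈ Z, ⟪b i, q - q'⟫ ≤ ⟪b i, x i - x' i⟫ := by
    intro i
    by_cases hi0 : i = ⟨0, hn⟩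
    · subst hi0
      intro q hq q' hq'
      have e1 : ⟪b ⟨0, hn⟩, x ⟨0, hn⟩ - x' ⟨0, hn⟩⟫ = ‖z - z'‖ := by
        rw [hx0, inner_smul_right, hb0, real_inner_self_eq_norm_sq, he, one_pow, mul_one]
      rw [e1]
      refine (real_inner_le_norm _ _).trans ?_
      rw [b.norm_eq_one, one_mul]
      exact hmax' q hq q' hq'
    · exact hwid i hi0
  set v : Fin n → E n := fun i => x i - x' i with hv
  have hdet := det_eq_prod_of_triangular b v htri
  have hWpos : 0 < ∏ i, ⟪b i, v i⟫ := Finset.prod_pos fun i _ => hpos i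
  have hvolZ := volume_le_prod_of_width b hz hwid'
  set W := ∏ i, ⟪b i, v i⟫ with hW
  have hdet0 : b.toBasis.det v ≠ 0 := by rw [hdet]; exact hWpos.ne'
  set a := ∑ i, (1 / (2 * n : ℝ)) • (x i + x' i) with ha
  have hbig : symBox a v (1 / (2 * n)) ⊆ Z := symBox_subset_of_convex hn hZconv hx hx'
  have haint : a ∈ interior Z :=
    symBox_center_mem_interior b hZconv ⟨q₀, hq₀⟩ hdet0 (by positivity) hbig
  have haZ := interior_subset haint
  -- Half the inscribed box leaves room to reflect the centre `a` through each of its points.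
  have hQZ : symBox a v (1 / (4 * n)) ⊆ Z := by
    refine Subset.trans ?_ hbig
    rintro q ⟨t, ht, rfl⟩
    refine ⟨t, fun i => (ht i).trans ?_, rfl⟩
    gcongr; norm_num
  set A := {y ∈ Y | ∀ i, |⟪p a y, v i⟫| ≤ 4 * n * h} with hA
  have hpy : ContinuousOn (fun y => p a y) Y :=
    S.cont_p.comp (by fun_prop : ContinuousOn (fun y => (a, y)) Y) fun y hy => ⟨hZX haZ, hy⟩
  have hAc : IsCompact A := by
    refine S.isCompact_Y.of_isClosed_subset ?_ (fun y h => h.1)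
    have : A = Y ∩ (fun y => p a y) ⁻¹' {p : E n | ∀ i, |⟪p, v i⟫| ≤ 4 * n * h} := rfl
    rw [this]
    refine hpy.preimage_isClosed_of_isClosed S.isCompact_Y.isClosed ?_
    rw [show {p : E n | ∀ i, |⟪p, v i⟫| ≤ 4 * n * h} = ⋂ i, {p : E n | |⟪p, v i⟫| ≤ 4 * n * h} by
      ext; simp]
    exact isClosed_iInter fun i => isClosed_le (by fun_prop) continuous_const
  -- The support touching at `q` is at least `-h` at `q` and at most `0` at the reflection `2q - a`,
  -- hence at least `-2h` at `a` by convexity. Being nonpositive on `Z`, it has a gradient at `a`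
  -- pairing to at most `2h` with each `±(1/(2n)) v i`, whence `4 n h`.
  have hsub : {y | ∃ q ∈ symBox a v (1 / (4 * n)), IsSupport c X Y u q y} ⊆ A := by
    rintro y ⟨q, hq, hy, hsup⟩
    have hqZ := hQZ hq
    obtain ⟨t, ht, rfl⟩ := hq
    set q := a + ∑ i, t i • v i with hqdef
    have hrefl : (2 : ℝ) • q - a ∈ Z := by
      refine hbig ⟨fun i => 2 * t i, fun i => ?_, ?_⟩
      · rw [abs_mul, abs_two]
        have := ht i
        have h2 : (1 : ℝ) / (2 * n) = 2 * (1 / (4 * n)) := by field_simp; norm_num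
        rw [h2]
        linarith
      · have : ∑ i, (2 * t i) • v i = (2 : ℝ) • ∑ i, t i • v i := by
          rw [Finset.smul_sum]; simp only [smul_smul]
        rw [this, hqdef]
        module
    have hmid : (1 / 2 : ℝ) • a + (1 / 2 : ℝ) • ((2 : ℝ) • q - a) = q := by module
    have hcv := (S.convexOn_neg_cost hy).2 (hZX haZ) (hZX hrefl)
      (by norm_num : (0 : ℝ) ≤ 1 / 2) (by norm_num : (0 : ℝ) ≤ 1 / 2) (by norm_num)
    rw [hmid] at hcv
    simp only [smul_eq_mul] at hcv
    have e1 := hsup _ (hZX hrefl)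
    have e2 := hZu _ hrefl
    have e3 := hh _ hqZ
    have hfa : -(2 * h) ≤ u q - c a y + c q y := by linarith
    have hdir : ∀ w : E n, a + w ∈ Z → ⟪p a y, w⟫ ≤ 2 * h := by
      intro w hw
      have f1 := S.subgrad y hy _ (hZX haZ) _ (hZX hw)
      rw [add_sub_cancel_left] at f1
      have f2 := hsup _ (hZX hw)
      have f3 := hZu _ hw
      linarith
    refine ⟨hy, fun i => ?_⟩
    have hpm : ∀ σ : ℝ, |σ| = 1 → σ * ⟪p a y, v i⟫ ≤ 4 * n * h := by
      intro σ hσ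
      have hmem : a + (σ * (1 / (2 * n))) • v i ∈ Z := by
        refine hbig ⟨Pi.single i (σ * (1 / (2 * n))), fun j => ?_, ?_⟩
        · by_cases hj : j = i
          · subst hj
            rw [Pi.single_eq_same, abs_mul, hσ, one_mul, abs_of_pos (by positivity)]
          · rw [Pi.single_eq_of_ne hj, abs_zero]; positivity
        · rw [Finset.sum_eq_single i]
          · rw [Pi.single_eq_same]
          · intro j _ hj
            rw [Pi.single_eq_of_ne hj, zero_smul]
          · simp
      have := hdir _ hmem
      rw [inner_smul_right] at this
      have h3 : σ * (1 / (2 * n)) * ⟪p a y, v i⟫ = σ * ⟪p a y, v i⟫ / (2 * n) := by ring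
      rw [h3, div_le_iff₀ (by positivity)] at this
      linarith
    rw [abs_le]
    have p1 := hpm 1 (by simp)
    have p2 := hpm (-1) (by simp)
    constructor <;> linarith
  have himg : volume (p a '' A) ≤ ENNReal.ofReal ((2 * (4 * n * h)) ^ n / W) := by
    have := volume_polar_le b v (M := 4 * n * h) (by positivity) hdet0
    rw [hdet, abs_of_pos hWpos] at this
    refine le_trans (measure_mono ?_) this
    rintro _ ⟨y, hy, rfl⟩
    exact hy.2
  -- The half box has volume `W / (2n) ^ n`, and the polar set at most `(8 n h) ^ n / W`. One factor
  -- `W` on each side produces `W ^ 2`, which dominates `|Z| ^ 2` up to `4 ^ n`.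
  have hchain : ENNReal.ofReal (lam * ((2 * (1 / (4 * n))) ^ n * W)) ≤
      ENNReal.ofReal (γ * ((2 * (4 * n * h)) ^ n / W)) := by
    have h1 := volume_symBox b a v (s := 1 / (4 * n)) (by positivity)
    rw [hdet, abs_of_pos hWpos] at h1
    rw [ENNReal.ofReal_mul hlam.le, ENNReal.ofReal_mul hγ, ← h1]
    exact (hMA _ hQZ (isCompact_symBox _ _ _)).trans ((measure_mono hsub).trans
      ((hvol a haint A (fun y h => h.1) hAc).trans (mul_le_mul_right himg _)))
  have hfin := (ENNReal.ofReal_le_ofReal_iff (by positivity)).1 hchain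
  have hV : (volume Z).toReal ≤ 2 ^ n * W := by
    refine ENNReal.toReal_le_of_le_ofReal (by positivity) hvolZ
  have hV0 : 0 ≤ (volume Z).toReal := ENNReal.toReal_nonneg
  have e1 : (2 * (1 / (4 * n)) : ℝ) ^ n = 1 / (2 * (n : ℝ)) ^ n := by
    rw [← one_div_pow]; congr 1; field_simp; norm_num
  have e2 : lam * W ^ 2 ≤ (16 * (n : ℝ) ^ 2) ^ n * (γ * h ^ n) := by
    rw [e1] at hfin
    have hN : 0 < (2 * (n : ℝ)) ^ n := by positivity
    have h1 : lam * (1 / (2 * (n : ℝ)) ^ n * W) = lam * W / (2 * (n : ℝ)) ^ n := by ring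
    have h2 : γ * ((2 * (4 * n * h)) ^ n / W) = γ * (2 * (4 * n * h)) ^ n / W := by ring
    rw [h1, h2, div_le_div_iff₀ hN hWpos] at hfin
    calc lam * W ^ 2 = lam * W * W := by ring
      _ ≤ γ * (2 * (4 * n * h)) ^ n * (2 * (n : ℝ)) ^ n := hfin
      _ = γ * ((2 * (4 * n * h)) * (2 * (n : ℝ))) ^ n := by rw [mul_assoc, ← mul_pow]
      _ = γ * (16 * (n : ℝ) ^ 2 * h) ^ n := by ring_nf
      _ = _ := by rw [mul_pow]; ring
  calc lam * (volume Z).toReal ^ 2 ≤ lam * (2 ^ n * W) ^ 2 := by gcongr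
    _ = 4 ^ n * (lam * W ^ 2) := by
        rw [mul_pow, ← pow_mul, mul_comm n 2, pow_mul]; norm_num; ring
    _ ≤ 4 ^ n * ((16 * (n : ℝ) ^ 2) ^ n * (γ * h ^ n)) := by gcongr
    _ = (64 * (n : ℝ) ^ 2) ^ n * (γ * h ^ n) := by
        rw [← mul_assoc, ← mul_pow]; ring_nf

end ConvexCost

/-! ### Second derivatives along curves, exchange of derivatives, smooth inverses -/

section Calculus

variable {P F : Type*} [NormedAddCommGroup P] [NormedSpace ℝ P] [NormedAddCommGroup F]
  [NormedSpace ℝ F]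

/-- The directional derivative of `G` in direction `w`. -/
noncomputable def dirDeriv (w : P) (G : P → F) (p : P) : F := fderiv ℝ G p w

theorem contDiffOn_dirDeriv {G : P → F} {O : Set P} (hO : IsOpen O) {k : ℕ}
    (hG : ContDiffOn ℝ (k + 1 : ℕ) G O) (w : P) : ContDiffOn ℝ k (dirDeriv w G) O :=
  (hG.fderiv_of_isOpen hO (m := k) (by norm_cast)).clm_apply contDiffOn_const

theorem dirDeriv_congr {G H : P → F} {O : Set P} (hO : IsOpen O) (h : EqOn G H O) (w : P) :
    EqOn (dirDeriv w G) (dirDeriv w H) O := fun p hp => by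
  have : G =ᶠ[𝓝 p] H := h.eventuallyEq_of_mem (hO.mem_nhds hp)
  simp only [dirDeriv, this.fderiv_eq]

theorem dirDeriv_comm {G : P → F} {O : Set P} (hO : IsOpen O) (hG : ContDiffOn ℝ 2 G O)
    (w w' : P) : EqOn (dirDeriv w (dirDeriv w' G)) (dirDeriv w' (dirDeriv w G)) O := fun p hp => by
  have hat : ContDiffAt ℝ 2 G p := hG.contDiffAt (hO.mem_nhds hp)
  have hsym := hat.isSymmSndFDerivAt (by simp)
  have hd : DifferentiableAt ℝ (fderiv ℝ G) p :=
    (hat.fderiv_right (m := 1) (by norm_num)).differentiableAt (by norm_num)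
  have key : ∀ v v' : P, dirDeriv v (dirDeriv v' G) p = fderiv ℝ (fderiv ℝ G) p v v' := by
    intro v v'
    have := (hd.hasFDerivAt.clm_apply (hasFDerivAt_const v' p)).fderiv
    unfold dirDeriv
    rw [this]
    simp
  rw [key, key]
  exact hsym w w'

theorem hasDerivAt_comp_line {G : P → F} {a w : P} {t : ℝ}
    (hG : DifferentiableAt ℝ G (a + t • w)) :
    HasDerivAt (fun t : ℝ => G (a + t • w)) (dirDeriv w G (a + t • w)) t := by
  have h1 : HasDerivAt (fun t : ℝ => a + t • w) w t := by
    simpa using ((hasDerivAt_id t).smul_const w).const_add a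
  exact hG.hasFDerivAt.comp_hasDerivAt t h1

theorem iteratedDeriv_two {f : ℝ → F} : iteratedDeriv 2 f = deriv (deriv f) := by
  rw [iteratedDeriv_succ, iteratedDeriv_one]

theorem iteratedDeriv_two_line {G : P → F} {O : Set P} (hO : IsOpen O) (hG : ContDiffOn ℝ 2 G O)
    {a w : P} {t : ℝ} (ht : a + t • w ∈ O) :
    iteratedDeriv 2 (fun t : ℝ => G (a + t • w)) t = dirDeriv w (dirDeriv w G) (a + t • w) := by
  rw [iteratedDeriv_two]
  have hc : Continuous fun t : ℝ => a + t • w := by fun_prop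
  have hev : deriv (fun t : ℝ => G (a + t • w)) =ᶠ[𝓝 t] fun t => dirDeriv w G (a + t • w) := by
    filter_upwards [(hO.preimage hc).mem_nhds ht] with s hs
    exact (hasDerivAt_comp_line
      ((hG.contDiffAt (hO.mem_nhds hs)).differentiableAt (by norm_num))).deriv
  rw [hev.deriv_eq]
  have h1 := contDiffOn_dirDeriv hO (k := 1) hG w
  exact (hasDerivAt_comp_line
    ((h1.contDiffAt (hO.mem_nhds ht)).differentiableAt (by norm_num))).deriv

/-- The second derivative along a curve in terms of the `2`-jet of the curve. -/
theorem iteratedDeriv_two_comp {B : P → F} {X : ℝ → P} {t : ℝ} (hB : ContDiffAt ℝ 2 B (X t))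
    (hX : ContDiffAt ℝ 2 X t) :
    iteratedDeriv 2 (fun s => B (X s)) t =
      fderiv ℝ (fderiv ℝ B) (X t) (deriv X t) (deriv X t) +
        fderiv ℝ B (X t) (iteratedDeriv 2 X t) := by
  rw [iteratedDeriv_two, iteratedDeriv_two]
  have hBev : ∀ᶠ s in 𝓝 t, DifferentiableAt ℝ B (X s) :=
    hX.continuousAt.eventually ((hB.eventually (by simp)).mono fun p hp =>
      hp.differentiableAt (by norm_num))
  have hXev : ∀ᶠ s in 𝓝 t, DifferentiableAt ℝ X s :=
    (hX.eventually (by simp)).mono fun p hp => hp.differentiableAt (by norm_num)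
  have hev : deriv (fun s => B (X s)) =ᶠ[𝓝 t] fun s => fderiv ℝ B (X s) (deriv X s) := by
    filter_upwards [hBev, hXev] with s h1 h2
    exact (h1.hasFDerivAt.comp_hasDerivAt s h2.hasDerivAt).deriv
  rw [hev.deriv_eq]
  have hdB : DifferentiableAt ℝ (fderiv ℝ B) (X t) :=
    (hB.fderiv_right (m := 1) (by norm_num)).differentiableAt (by norm_num)
  have hdX : DifferentiableAt ℝ (deriv X) t := by
    have : ContDiffAt ℝ 1 (fun s => fderiv ℝ X s 1) t :=
      (hX.fderiv_right (m := 1) (by norm_num)).clm_apply contDiffAt_const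
    exact this.differentiableAt (by norm_num)
  have h1 : HasDerivAt (fun s => fderiv ℝ B (X s)) (fderiv ℝ (fderiv ℝ B) (X t) (deriv X t)) t :=
    hdB.hasFDerivAt.comp_hasDerivAt t (hX.differentiableAt (by norm_num)).hasDerivAt
  exact (h1.clm_apply hdX.hasDerivAt).deriv

/-- The chain rule involves only the `2`-jet of the curve, so any curve may be exchanged for a
quadratic one. -/
theorem iteratedDeriv_two_comp_congr {B : P → F} {X X' : ℝ → P} {t t' : ℝ}
    (hB : ContDiffAt ℝ 2 B (X t)) (hX : ContDiffAt ℝ 2 X t) (hX' : ContDiffAt ℝ 2 X' t')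
    (h0 : X t = X' t') (h1 : deriv X t = deriv X' t')
    (h2 : iteratedDeriv 2 X t = iteratedDeriv 2 X' t') :
    iteratedDeriv 2 (fun s => B (X s)) t = iteratedDeriv 2 (fun s => B (X' s)) t' := by
  rw [iteratedDeriv_two_comp hB hX, iteratedDeriv_two_comp (h0 ▸ hB) hX', h0, h1, h2]

theorem iteratedDeriv_two_comp_mul {f : ℝ → F} (κ : ℝ) :
    iteratedDeriv 2 (fun s => f (κ * s)) 0 = κ ^ 2 • iteratedDeriv 2 f 0 := by
  rw [iteratedDeriv_two, iteratedDeriv_two]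
  have h1 : deriv (fun s => f (κ * s)) = fun s => κ • deriv f (κ * s) := by
    ext s; exact deriv_comp_mul_left κ f s
  rw [h1, deriv_fun_const_smul_field, deriv_comp_mul_left, mul_zero, smul_smul, pow_two]

/-- The quadratic curve with given `2`-jet at `0`. -/
noncomputable def quadCurve (x ξ ξ₂ : P) (s : ℝ) : P := x + s • ξ + (s ^ 2 / 2) • ξ₂

theorem contDiff_quadCurve (x ξ ξ₂ : P) {k : WithTop ℕ∞} : ContDiff ℝ k (quadCurve x ξ ξ₂) := by
  unfold quadCurve; fun_prop

theorem hasDerivAt_quadCurve (x ξ ξ₂ : P) (s : ℝ) :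
    HasDerivAt (quadCurve x ξ ξ₂) (ξ + s • ξ₂) s := by
  unfold quadCurve
  have h1 : HasDerivAt (fun s : ℝ => x + s • ξ) ξ s := by
    simpa using ((hasDerivAt_id s).smul_const ξ).const_add x
  have h2 : HasDerivAt (fun s : ℝ => (s ^ 2 / 2) • ξ₂) (s • ξ₂) s := by
    have h3 : HasDerivAt (fun s : ℝ => s ^ 2 / 2) s s := by
      have := ((hasDerivAt_id s).pow 2).div_const 2
      simpa using this
    exact h3.smul_const ξ₂
  exact h1.add h2

@[simp] theorem quadCurve_zero (x ξ ξ₂ : P) : quadCurve x ξ ξ₂ 0 = x := by simp [quadCurve]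

@[simp] theorem deriv_quadCurve_zero (x ξ ξ₂ : P) : deriv (quadCurve x ξ ξ₂) 0 = ξ := by
  simpa using (hasDerivAt_quadCurve x ξ ξ₂ 0).deriv

@[simp] theorem iteratedDeriv_quadCurve_zero (x ξ ξ₂ : P) :
    iteratedDeriv 2 (quadCurve x ξ ξ₂) 0 = ξ₂ := by
  rw [iteratedDeriv_two]
  have : deriv (quadCurve x ξ ξ₂) = fun s => ξ + s • ξ₂ := by
    ext s; exact (hasDerivAt_quadCurve x ξ ξ₂ s).deriv
  rw [this]
  have h1 : HasDerivAt (fun s : ℝ => ξ + s • ξ₂) ξ₂ 0 := by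
    simpa using ((hasDerivAt_id (0 : ℝ)).smul_const ξ₂).const_add ξ
  exact h1.deriv

/-- Second derivatives in `t` at `0` of a `C^{k+2}` function of `(x, t)` are `C^k` in `x`. -/
theorem contDiffAt_iteratedDeriv_two {G : P → ℝ → F} {x : P} {k : ℕ}
    (hG : ContDiffAt ℝ (k + 2 : ℕ) (fun r : P × ℝ => G r.1 r.2) (x, 0)) :
    ContDiffAt ℝ k (fun x' => iteratedDeriv 2 (G x') 0) x := by
  obtain ⟨O', hO', hG'⟩ := hG.contDiffOn le_rfl
    (fun h => absurd h (WithTop.coe_injective.ne (ENat.natCast_ne_top _)))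
  have hO := isOpen_interior (s := O')
  have hmem : (x, (0 : ℝ)) ∈ interior O' := mem_interior_iff_mem_nhds.2 hO'
  have hG2 : ContDiffOn ℝ (k + 1 + 1 : ℕ) (fun r : P × ℝ => G r.1 r.2) (interior O') :=
    hG'.mono interior_subset
  have h2 := contDiffOn_dirDeriv hO (contDiffOn_dirDeriv hO hG2 ((0 : P), (1 : ℝ)))
    ((0 : P), (1 : ℝ))
  have hev : (fun x' => iteratedDeriv 2 (G x') 0) =ᶠ[𝓝 x] fun x' =>
      dirDeriv ((0 : P), (1 : ℝ)) (dirDeriv ((0 : P), (1 : ℝ)) fun r : P × ℝ => G r.1 r.2)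
        (x', 0) := by
    have hc : Continuous fun x' : P => (x', (0 : ℝ)) := by fun_prop
    filter_upwards [(hO.preimage hc).mem_nhds hmem] with x' hx'
    have := iteratedDeriv_two_line hO (hG2.of_le (by norm_cast; omega)) (a := (x', (0 : ℝ)))
      (w := ((0 : P), (1 : ℝ))) (t := 0) (by simpa using hx')
    simpa using this
  refine ContDiffAt.congr_of_eventuallyEq ?_ hev
  exact (h2.contDiffAt (hO.mem_nhds hmem)).comp x (contDiffAt_id.prodMk contDiffAt_const)

/-- Four exchanges of adjacent directional derivatives. This makes the cross-curvature condition
symmetric in the two variables. -/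
theorem iteratedDeriv_two_comm {G : ℝ → ℝ → F}
    (hG : ContDiffAt ℝ 4 (fun r : ℝ × ℝ => G r.1 r.2) (0, 0)) :
    iteratedDeriv 2 (fun s => iteratedDeriv 2 (fun t => G s t) 0) 0 =
      iteratedDeriv 2 (fun t => iteratedDeriv 2 (fun s => G s t) 0) 0 := by
  obtain ⟨O', hO', hG'⟩ := hG.contDiffOn le_rfl (by simp)
  have hO := isOpen_interior (s := O')
  have hmem : ((0 : ℝ), (0 : ℝ)) ∈ interior O' := mem_interior_iff_mem_nhds.2 hO'
  set O := interior O'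
  set H : ℝ × ℝ → F := fun r => G r.1 r.2 with hH
  have hH4 : ContDiffOn ℝ (3 + 1 : ℕ) H O := hG'.mono interior_subset
  set e₁ : ℝ × ℝ := (1, 0)
  set e₂ : ℝ × ℝ := (0, 1)
  have d1 : ∀ w, ContDiffOn ℝ (2 + 1 : ℕ) (dirDeriv w H) O := contDiffOn_dirDeriv hO hH4
  have d2 : ∀ w w', ContDiffOn ℝ (1 + 1 : ℕ) (dirDeriv w' (dirDeriv w H)) O :=
    fun w => contDiffOn_dirDeriv hO (d1 w)
  have hH2 : ContDiffOn ℝ 2 H O := hH4.of_le (by norm_cast)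
  have d1' : ∀ w, ContDiffOn ℝ 2 (dirDeriv w H) O := fun w => (d1 w).of_le (by norm_cast)
  have L : iteratedDeriv 2 (fun s => iteratedDeriv 2 (fun t => G s t) 0) 0 =
      dirDeriv e₁ (dirDeriv e₁ (dirDeriv e₂ (dirDeriv e₂ H))) (0, 0) := by
    have hev : (fun s => iteratedDeriv 2 (fun t => G s t) 0) =ᶠ[𝓝 0] fun s =>
        dirDeriv e₂ (dirDeriv e₂ H) ((0 : ℝ × ℝ) + s • e₁) := by
      have hc : Continuous fun s : ℝ => (s, (0 : ℝ)) := by fun_prop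
      filter_upwards [(hO.preimage hc).mem_nhds hmem] with s hs
      have := iteratedDeriv_two_line hO hH2 (a := (s, (0 : ℝ))) (w := e₂) (t := 0)
        (by simpa using hs)
      simpa [e₁, e₂, hH] using this
    rw [iteratedDeriv_two, hev.deriv.deriv_eq, ← iteratedDeriv_two]
    have := iteratedDeriv_two_line hO (d2 e₂ e₂) (a := (0 : ℝ × ℝ)) (w := e₁) (t := 0)
      (by rw [zero_smul, add_zero]; exact hmem)
    rw [zero_smul, add_zero] at this
    exact this
  have R : iteratedDeriv 2 (fun t => iteratedDeriv 2 (fun s => G s t) 0) 0 =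
      dirDeriv e₂ (dirDeriv e₂ (dirDeriv e₁ (dirDeriv e₁ H))) (0, 0) := by
    have hev : (fun t => iteratedDeriv 2 (fun s => G s t) 0) =ᶠ[𝓝 0] fun t =>
        dirDeriv e₁ (dirDeriv e₁ H) ((0 : ℝ × ℝ) + t • e₂) := by
      have hc : Continuous fun t : ℝ => ((0 : ℝ), t) := by fun_prop
      filter_upwards [(hO.preimage hc).mem_nhds hmem] with t ht
      have := iteratedDeriv_two_line hO hH2 (a := ((0 : ℝ), t)) (w := e₁) (t := 0)
        (by simpa using ht)
      simpa [e₁, e₂, hH] using this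
    rw [iteratedDeriv_two, hev.deriv.deriv_eq, ← iteratedDeriv_two]
    have := iteratedDeriv_two_line hO (d2 e₁ e₁) (a := (0 : ℝ × ℝ)) (w := e₂) (t := 0)
      (by rw [zero_smul, add_zero]; exact hmem)
    rw [zero_smul, add_zero] at this
    exact this
  rw [L, R]
  have c1 : EqOn (dirDeriv e₁ (dirDeriv e₁ (dirDeriv e₂ H)))
      (dirDeriv e₂ (dirDeriv e₁ (dirDeriv e₁ H))) O := fun p hp => by
    rw [dirDeriv_congr hO (dirDeriv_comm hO hH2 e₁ e₂) e₁ hp, dirDeriv_comm hO (d1' e₁) e₁ e₂ hp]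
  rw [dirDeriv_congr hO (dirDeriv_comm hO (d1' e₂) e₁ e₂) e₁ hmem,
    dirDeriv_comm hO (d2 e₂ e₁) e₁ e₂ hmem, dirDeriv_congr hO c1 e₂ hmem]

/-- The third-order analogue, with two exchanges. It turns the `y`-derivative of a second derivative
of the cost into a second derivative of `Dy c`. -/
theorem deriv_iteratedDeriv_two_comm {G : ℝ → ℝ → F}
    (hG : ContDiffAt ℝ 3 (fun r : ℝ × ℝ => G r.1 r.2) (0, 0)) :
    deriv (fun t => iteratedDeriv 2 (fun s => G s t) 0) 0 =
      iteratedDeriv 2 (fun s => deriv (fun t => G s t) 0) 0 := by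
  obtain ⟨O', hO', hG'⟩ := hG.contDiffOn le_rfl (by simp)
  have hO := isOpen_interior (s := O')
  have hmem : ((0 : ℝ), (0 : ℝ)) ∈ interior O' := mem_interior_iff_mem_nhds.2 hO'
  set O := interior O'
  set H : ℝ × ℝ → F := fun r => G r.1 r.2 with hH
  have hH3 : ContDiffOn ℝ (2 + 1 : ℕ) H O := hG'.mono interior_subset
  set e₁ : ℝ × ℝ := (1, 0)
  set e₂ : ℝ × ℝ := (0, 1)
  have d1 : ∀ w, ContDiffOn ℝ (1 + 1 : ℕ) (dirDeriv w H) O := contDiffOn_dirDeriv hO hH3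
  have d2 : ∀ w w', ContDiffOn ℝ 1 (dirDeriv w' (dirDeriv w H)) O :=
    fun w => contDiffOn_dirDeriv hO (d1 w)
  have hH2 : ContDiffOn ℝ 2 H O := hH3.of_le (by norm_cast)
  have d1' : ∀ w, ContDiffOn ℝ 2 (dirDeriv w H) O := fun w => (d1 w).of_le (by norm_cast)
  have L : deriv (fun t => iteratedDeriv 2 (fun s => G s t) 0) 0 =
      dirDeriv e₂ (dirDeriv e₁ (dirDeriv e₁ H)) (0, 0) := by
    have hev : (fun t => iteratedDeriv 2 (fun s => G s t) 0) =ᶠ[𝓝 0] fun t =>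
        dirDeriv e₁ (dirDeriv e₁ H) ((0 : ℝ × ℝ) + t • e₂) := by
      have hc : Continuous fun t : ℝ => ((0 : ℝ), t) := by fun_prop
      filter_upwards [(hO.preimage hc).mem_nhds hmem] with t ht
      have := iteratedDeriv_two_line hO hH2 (a := ((0 : ℝ), t)) (w := e₁) (t := 0)
        (by simpa using ht)
      simpa [e₁, e₂, hH] using this
    rw [hev.deriv_eq]
    have hm : (0 : ℝ × ℝ) + (0 : ℝ) • e₂ ∈ O := by rw [zero_smul, add_zero]; exact hmem
    have := (hasDerivAt_comp_line (((d2 e₁ e₁).contDiffAt (hO.mem_nhds hm)).differentiableAt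
      (by norm_num))).deriv
    rw [zero_smul, add_zero] at this
    exact this
  have R : iteratedDeriv 2 (fun s => deriv (fun t => G s t) 0) 0 =
      dirDeriv e₁ (dirDeriv e₁ (dirDeriv e₂ H)) (0, 0) := by
    have hev : (fun s => deriv (fun t => G s t) 0) =ᶠ[𝓝 0] fun s =>
        dirDeriv e₂ H ((0 : ℝ × ℝ) + s • e₁) := by
      have hc : Continuous fun s : ℝ => (s, (0 : ℝ)) := by fun_prop
      filter_upwards [(hO.preimage hc).mem_nhds hmem] with s hs
      have hm : (s, (0 : ℝ)) + (0 : ℝ) • e₂ ∈ O := by simpa using hs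
      have := (hasDerivAt_comp_line ((hH2.contDiffAt (hO.mem_nhds hm)).differentiableAt
        (by norm_num))).deriv
      simpa [e₁, e₂, hH] using this
    rw [iteratedDeriv_two, hev.deriv.deriv_eq, ← iteratedDeriv_two]
    have := iteratedDeriv_two_line hO (d1' e₂) (a := (0 : ℝ × ℝ)) (w := e₁) (t := 0)
      (by rw [zero_smul, add_zero]; exact hmem)
    rw [zero_smul, add_zero] at this
    exact this
  rw [L, R, dirDeriv_congr hO (dirDeriv_comm hO hH2 e₁ e₂) e₁ hmem,
    dirDeriv_comm hO (d1' e₁) e₁ e₂ hmem]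

/-- The inverse of an injective `C^k` map with invertible differential on an open set. -/
theorem invFunOn_of_isInvertible [CompleteSpace P] {φ : P → P} {S : Set P} (hS : IsOpen S)
    (hinj : InjOn φ S) {k : ℕ} (hk : 1 ≤ k) (hφ : ContDiffOn ℝ k φ S)
    (hinv : ∀ x ∈ S, (fderiv ℝ φ x).IsInvertible) :
    IsOpen (φ '' S) ∧ ∀ q ∈ φ '' S, ContDiffAt ℝ k (Function.invFunOn φ S) q := by
  have hk0 : (k : WithTop ℕ∞) ≠ 0 := by norm_cast; omega
  have key : ∀ x ∈ S, φ '' S ∈ 𝓝 (φ x) ∧ ContDiffAt ℝ k (Function.invFunOn φ S) (φ x) := by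
    intro x hx
    obtain ⟨A, hA⟩ := hinv x hx
    have hat : ContDiffAt ℝ k φ x := hφ.contDiffAt (hS.mem_nhds hx)
    have hd : HasFDerivAt φ (A : P →L[ℝ] P) x := hA ▸ (hat.differentiableAt hk0).hasFDerivAt
    have hstrict := hat.hasStrictFDerivAt' hd hk0
    set g := hat.localInverse hd hk0
    have hg : ContDiffAt ℝ k g (φ x) := hat.to_localInverse hd hk0
    have hgx : g (φ x) = x := hat.localInverse_apply_image hd hk0
    have hright : ∀ᶠ q in 𝓝 (φ x), φ (g q) = q := hstrict.eventually_right_inverse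
    have hgS : ∀ᶠ q in 𝓝 (φ x), g q ∈ S :=
      hg.continuousAt.eventually_mem (by rw [hgx]; exact hS.mem_nhds hx)
    refine ⟨?_, hg.congr_of_eventuallyEq ?_⟩
    · filter_upwards [hright, hgS] with q h1 h2
      exact ⟨g q, h2, h1⟩
    · filter_upwards [hright, hgS] with q h1 h2
      have hq : ∃ a ∈ S, φ a = q := ⟨g q, h2, h1⟩
      exact hinj (Function.invFunOn_mem hq) h2 ((Function.invFunOn_eq hq).trans h1.symm)
  refine ⟨isOpen_iff_mem_nhds.2 ?_, ?_⟩
  · rintro _ ⟨x, hx, rfl⟩; exact (key x hx).1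
  · rintro _ ⟨x, hx, rfl⟩; exact (key x hx).2

end Calculus

theorem iteratedDeriv_two_clm {P F : Type*} [NormedAddCommGroup P] [NormedSpace ℝ P]
    [NormedAddCommGroup F] [NormedSpace ℝ F] (L : P →L[ℝ] F) {f : ℝ → P} {t : ℝ}
    (hf : ContDiffAt ℝ 2 f t) :
    iteratedDeriv 2 (fun s => L (f s)) t = L (iteratedDeriv 2 f t) := by
  have h := iteratedDeriv_two_comp (B := L) L.contDiff.contDiffAt hf
  have h1 : fderiv ℝ L = fun _ => L := by ext1 x; exact L.fderiv
  rw [h, h1]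
  simp

theorem iteratedDeriv_two_affine {F : Type*} [NormedAddCommGroup F] [NormedSpace ℝ F] {f : ℝ → F}
    {a v : F} {t : ℝ} (hf : ∀ᶠ s in 𝓝 t, f s = a + s • v) : iteratedDeriv 2 f t = 0 := by
  have h : f =ᶠ[𝓝 t] fun s => a + s • v := hf
  have h1 : deriv (fun s : ℝ => a + s • v) = fun _ => v := by
    ext1 s
    have : HasDerivAt (fun s : ℝ => a + s • v) v s := by
      simpa using ((hasDerivAt_id s).smul_const v).const_add a
    exact this.deriv
  rw [iteratedDeriv_two, h.deriv.deriv_eq, h1]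
  simp

/-! ### Gradients of the cost, and cross-curvature expressed through jets -/

theorem inner_Dy (c : E n → E n → ℝ) (x y v : E n) :
    ⟪Dy c x y, v⟫ = fderiv ℝ (fun y' => c x y') y v := by
  rw [Dy, gradient, InnerProductSpace.toDual_symm_apply]

theorem inner_Dx (c : E n → E n → ℝ) (x y v : E n) :
    ⟪Dx c x y, v⟫ = fderiv ℝ (fun x' => c x' y) x v :=
  inner_Dy (fun y x => c x y) y x v

theorem fderiv_snd_eq {c : E n → E n → ℝ} {x y : E n}
    (h : DifferentiableAt ℝ (fun p : E n × E n => c p.1 p.2) (x, y)) (v : E n) :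
    fderiv ℝ (fun y' => c x y') y v = dirDeriv (0, v) (fun p : E n × E n => c p.1 p.2) (x, y) := by
  have h1 : HasFDerivAt (fun y' : E n => (x, y')) (ContinuousLinearMap.inr ℝ (E n) (E n)) y :=
    hasFDerivAt_prodMk_right x y
  have := HasFDerivAt.comp y (g := fun p : E n × E n => c p.1 p.2) h.hasFDerivAt h1
  rw [show (fun y' => c x y') = (fun p : E n × E n => c p.1 p.2) ∘ fun y' => (x, y') from rfl,
    this.fderiv]
  simp [dirDeriv]

theorem contDiffAt_swap {c : E n → E n → ℝ} {x y : E n} {k : WithTop ℕ∞}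
    (h : ContDiffAt ℝ k (fun p : E n × E n => c p.1 p.2) (x, y)) :
    ContDiffAt ℝ k (fun p : E n × E n => c p.2 p.1) (y, x) :=
  ContDiffAt.comp (y, x) (g := fun p : E n × E n => c p.1 p.2) h
    (contDiffAt_snd.prodMk contDiffAt_fst)

theorem contDiffAt_Dy {c : E n → E n → ℝ} {x y : E n} {k : ℕ}
    (h : ContDiffAt ℝ (k + 1 : ℕ) (fun p : E n × E n => c p.1 p.2) (x, y)) :
    ContDiffAt ℝ k (fun p : E n × E n => Dy c p.1 p.2) (x, y) := by
  set b := EuclideanSpace.basisFun (Fin n) ℝ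
  have hev : (fun p : E n × E n => Dy c p.1 p.2) =ᶠ[𝓝 (x, y)] fun p =>
      ∑ i, (fderiv ℝ (fun p : E n × E n => c p.1 p.2) p (0, b i)) • b i := by
    filter_upwards [h.eventually
      (fun h => absurd h (WithTop.coe_injective.ne (ENat.natCast_ne_top _)))] with p hp
    have hd : DifferentiableAt ℝ (fun p : E n × E n => c p.1 p.2) (p.1, p.2) :=
      hp.differentiableAt (by norm_cast)
    rw [← b.sum_repr' (Dy c p.1 p.2)]
    refine Finset.sum_congr rfl fun i _ => ?_
    rw [real_inner_comm, inner_Dy, fderiv_snd_eq hd]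
    rfl
  refine ContDiffAt.congr_of_eventuallyEq ?_ hev
  have hf : ContDiffAt ℝ k (fderiv ℝ fun p : E n × E n => c p.1 p.2) (x, y) :=
    h.fderiv_right (by norm_cast)
  exact ContDiffAt.sum fun i _ => (hf.clm_apply contDiffAt_const).smul contDiffAt_const

theorem contDiffAt_Dx {c : E n → E n → ℝ} {x y : E n} {k : ℕ}
    (h : ContDiffAt ℝ (k + 1 : ℕ) (fun p : E n × E n => c p.1 p.2) (x, y)) :
    ContDiffAt ℝ k (fun p : E n × E n => Dx c p.1 p.2) (x, y) :=
  ContDiffAt.comp (x, y) (g := fun p : E n × E n => Dy (fun y x => c x y) p.1 p.2)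
    (f := fun p : E n × E n => (p.2, p.1)) (contDiffAt_Dy (contDiffAt_swap h))
    (contDiffAt_snd.prodMk contDiffAt_fst)

theorem contDiffAt_left {F : Type*} [NormedAddCommGroup F] [NormedSpace ℝ F]
    {g : E n → E n → F} {x y : E n} {k : WithTop ℕ∞}
    (h : ContDiffAt ℝ k (fun p : E n × E n => g p.1 p.2) (x, y)) :
    ContDiffAt ℝ k (fun x' => g x' y) x :=
  ContDiffAt.comp x (g := fun p : E n × E n => g p.1 p.2) h (contDiffAt_id.prodMk contDiffAt_const)

theorem contDiffAt_right {F : Type*} [NormedAddCommGroup F] [NormedSpace ℝ F]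
    {g : E n → E n → F} {x y : E n} {k : WithTop ℕ∞}
    (h : ContDiffAt ℝ k (fun p : E n × E n => g p.1 p.2) (x, y)) :
    ContDiffAt ℝ k (fun y' => g x y') y :=
  ContDiffAt.comp y (g := fun p : E n × E n => g p.1 p.2) h (contDiffAt_const.prodMk contDiffAt_id)

/-- A symmetric form of the standing hypotheses, with non-negative cross-curvature expressed
through `2`-jets of curves at interior points. -/
structure CrossCurvedCost (U V : Set (E n)) (c : E n → E n → ℝ) : Prop where
  isOpen_U : IsOpen U
  isOpen_V : IsOpen V
  isBounded_U : Bornology.IsBounded U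
  isBounded_V : Bornology.IsBounded V
  smoothAt : ∀ x ∈ closure U, ∀ y ∈ closure V,
    ContDiffAt ℝ 4 (fun p : E n × E n => c p.1 p.2) (x, y)
  twist_x : ∀ y ∈ closure V, IsDiffeoOntoRange (fun x => -Dy c x y) (closure U)
  twist_y : ∀ x ∈ closure U, IsDiffeoOntoRange (fun y => -Dx c x y) (closure V)
  convex_U : ∀ y ∈ closure V, Convex ℝ ((fun x => -Dy c x y) '' U)
  convex_V : ∀ x ∈ closure U, Convex ℝ ((fun y => -Dx c x y) '' V)
  cross : ∀ x ∈ U, ∀ y ∈ V, ∀ ξ ξ₂ ζ ζ₂ : E n,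
    iteratedDeriv 2 (fun s => Dy c (quadCurve x ξ ξ₂ s) y) 0 = 0 →
    iteratedDeriv 2 (fun t => Dx c x (quadCurve y ζ ζ₂ t)) 0 = 0 →
    iteratedDeriv 2 (fun s => iteratedDeriv 2
      (fun t => c (quadCurve x ξ ξ₂ s) (quadCurve y ζ ζ₂ t)) 0) 0 ≤ 0

/-- Results about `x` transfer to `y` through this symmetry; the only point at issue is the order of
differentiation in `cross`. -/
theorem CrossCurvedCost.swap {U V : Set (E n)} {c : E n → E n → ℝ} (h : CrossCurvedCost U V c) :
    CrossCurvedCost V U fun y x => c x y where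
  isOpen_U := h.isOpen_V
  isOpen_V := h.isOpen_U
  isBounded_U := h.isBounded_V
  isBounded_V := h.isBounded_U
  smoothAt y hy x hx := contDiffAt_swap (h.smoothAt x hx y hy)
  twist_x := h.twist_y
  twist_y := h.twist_x
  convex_U := h.convex_V
  convex_V := h.convex_U
  cross y hy x hx ζ ζ₂ ξ ξ₂ h1 h2 := by
    refine le_of_eq_of_le ?_ (h.cross x hx y hy ξ ξ₂ ζ ζ₂ h2 h1)
    refine (iteratedDeriv_two_comm
      (G := fun s t => c (quadCurve x ξ ξ₂ s) (quadCurve y ζ ζ₂ t)) ?_).symm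
    refine ContDiffAt.comp (0, 0) (g := fun p : E n × E n => c p.1 p.2)
      (f := fun r : ℝ × ℝ => (quadCurve x ξ ξ₂ r.1, quadCurve y ζ ζ₂ r.2)) ?_ ?_
    · simpa using h.smoothAt x (subset_closure hx) y (subset_closure hy)
    · exact (((contDiff_quadCurve x ξ ξ₂).comp contDiff_fst).prodMk
        ((contDiff_quadCurve y ζ ζ₂).comp contDiff_snd)).contDiffAt

/-- A curve with given admissible `2`-jet which is affine in the coordinate `φ`. -/
theorem exists_affine_curve {φ : E n → E n} {S : Set (E n)} (hS : IsOpen S) (hinj : InjOn φ S)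
    (hφ : ContDiffOn ℝ 3 φ S) (hinv : ∀ x ∈ S, (fderiv ℝ φ x).IsInvertible) {x : E n} (hx : x ∈ S)
    {ξ ξ₂ : E n} (h0 : iteratedDeriv 2 (fun s => φ (quadCurve x ξ ξ₂ s)) 0 = 0) :
    ∃ (X : ℝ → E n) (v : E n) (ε : ℝ), 0 < ε ∧ ContDiffAt ℝ 2 X 0 ∧ X 0 = x ∧ deriv X 0 = ξ ∧
      iteratedDeriv 2 X 0 = ξ₂ ∧ ∀ s, |s| < ε → X s ∈ S ∧ φ (X s) = φ x + s • v := by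
  obtain ⟨hop, hsm⟩ := invFunOn_of_isInvertible hS hinj (k := 3) (by norm_num) hφ hinv
  set v := fderiv ℝ φ x ξ with hv
  set g := Function.invFunOn φ S
  set X : ℝ → E n := fun s => g (φ x + s • v) with hX
  have hx0 : φ x + (0 : ℝ) • v = φ x := by simp
  have hgS : ∀ q ∈ φ '' S, g q ∈ S ∧ φ (g q) = q := fun q hq =>
    ⟨Function.invFunOn_mem hq, Function.invFunOn_eq hq⟩
  have hc : ContinuousAt (fun s : ℝ => φ x + s • v) 0 := by fun_prop
  have hev : ∀ᶠ s : ℝ in 𝓝 0, φ x + s • v ∈ φ '' S :=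
    hc.eventually_mem (by rw [hx0]; exact hop.mem_nhds ⟨x, hx, rfl⟩)
  obtain ⟨ε, hε, hball⟩ := Metric.eventually_nhds_iff.1 hev
  have hXS : ∀ s, |s| < ε → X s ∈ S ∧ φ (X s) = φ x + s • v := fun s hs =>
    hgS _ (hball (by simpa [Real.dist_eq] using hs))
  have hX0 : X 0 = x := by
    have := hXS 0 (by simpa using hε)
    exact hinj this.1 hx (by rw [this.2, hx0])
  have hXc : ContDiffAt ℝ 2 X 0 := by
    have h1 : ContDiffAt ℝ 2 g (φ x + (0 : ℝ) • v) := by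
      rw [hx0]; exact (hsm _ ⟨x, hx, rfl⟩).of_le (by norm_cast)
    exact ContDiffAt.comp (0 : ℝ) (g := g) (f := fun s : ℝ => φ x + s • v) h1 (by fun_prop)
  have hφx : ContDiffAt ℝ 2 φ x := (hφ.contDiffAt (hS.mem_nhds hx)).of_le (by norm_cast)
  have hinjf : Function.Injective (fderiv ℝ φ x) := by
    obtain ⟨A, hA⟩ := hinv x hx
    rw [← hA]; exact A.injective
  have heq : ∀ᶠ s in 𝓝 (0 : ℝ), φ (X s) = φ x + s • v :=
    Metric.eventually_nhds_iff.2 ⟨ε, hε, fun s hs => (hXS s (by simpa [Real.dist_eq] using hs)).2⟩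
  have hd1 : deriv X 0 = ξ := by
    have e1 : HasDerivAt (fun s => φ (X s)) (fderiv ℝ φ x (deriv X 0)) 0 := by
      have : DifferentiableAt ℝ φ (X 0) := by rw [hX0]; exact hφx.differentiableAt (by norm_num)
      have := this.hasFDerivAt.comp_hasDerivAt (0 : ℝ) (hXc.differentiableAt (by norm_num)).hasDerivAt
      rwa [hX0] at this
    have e2 : HasDerivAt (fun s : ℝ => φ x + s • v) v 0 := by
      simpa using ((hasDerivAt_id (0 : ℝ)).smul_const v).const_add (φ x)
    exact hinjf ((e1.congr_of_eventuallyEq (EventuallyEq.symm heq)).unique e2)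
  -- Under `φ` both curves have zero second derivative at `0`, and their velocities agree. The chain
  -- rule and injectivity of the differential then identify the accelerations.
  have hd2 : iteratedDeriv 2 X 0 = ξ₂ := by
    have e1 := iteratedDeriv_two_comp (B := φ) (X := X) (t := 0) (by rwa [hX0]) hXc
    rw [iteratedDeriv_two_affine heq, hX0, hd1] at e1
    have e2 := iteratedDeriv_two_comp (B := φ) (X := quadCurve x ξ ξ₂) (t := 0)
      (by rwa [quadCurve_zero]) (contDiff_quadCurve _ _ _).contDiffAt
    rw [h0, quadCurve_zero, deriv_quadCurve_zero, iteratedDeriv_quadCurve_zero] at e2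
    exact hinjf (add_left_cancel (e1.symm.trans e2))
  exact ⟨X, v, ε, hε, hXc, hX0, hd1, hd2, hXS⟩

/-- Jet invariance in the inner variable and then in the outer one; the latter is available because
the inner second derivative of a `C⁴` cost is `C²` in `x`. -/
theorem iteratedDeriv_two_curve_congr {c : E n → E n → ℝ} {x y : E n}
    (h : ContDiffAt ℝ 4 (fun p : E n × E n => c p.1 p.2) (x, y)) {X X' Y Y' : ℝ → E n}
    (hX : ContDiffAt ℝ 2 X 0) (hX' : ContDiff ℝ 4 X') (hY : ContDiffAt ℝ 2 Y 0)
    (hY' : ContDiff ℝ 4 Y') (hX0 : X 0 = x) (hY0 : Y 0 = y)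
    (hXX : X 0 = X' 0 ∧ deriv X 0 = deriv X' 0 ∧ iteratedDeriv 2 X 0 = iteratedDeriv 2 X' 0)
    (hYY : Y 0 = Y' 0 ∧ deriv Y 0 = deriv Y' 0 ∧ iteratedDeriv 2 Y 0 = iteratedDeriv 2 Y' 0) :
    iteratedDeriv 2 (fun s => iteratedDeriv 2 (fun t => c (X s) (Y t)) 0) 0 =
      iteratedDeriv 2 (fun s => iteratedDeriv 2 (fun t => c (X' s) (Y' t)) 0) 0 := by
  have hB : ContDiffAt ℝ 2 (fun x' => iteratedDeriv 2 (fun t => c x' (Y' t)) 0) x := by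
    refine contDiffAt_iteratedDeriv_two (k := 2) (G := fun x' t => c x' (Y' t)) ?_
    refine ContDiffAt.comp (x, (0 : ℝ)) (g := fun p : E n × E n => c p.1 p.2)
      (f := fun r : E n × ℝ => (r.1, Y' r.2)) ?_ ?_
    · have hy : Y' 0 = y := hYY.1 ▸ hY0
      simpa [hy] using h
    · exact (contDiff_fst.prodMk (hY'.comp contDiff_snd)).contDiffAt
  have hev : (fun s => iteratedDeriv 2 (fun t => c (X s) (Y t)) 0) =ᶠ[𝓝 0]
      fun s => iteratedDeriv 2 (fun t => c (X s) (Y' t)) 0 := by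
    have hc : ContinuousAt (fun s => (X s, y)) 0 := hX.continuousAt.prodMk continuousAt_const
    have := hc.eventually (p := fun p : E n × E n => ContDiffAt ℝ 4 (fun p => c p.1 p.2) p)
      (by beta_reduce; rw [hX0]; exact h.eventually (by norm_num))
    filter_upwards [this] with s hs
    refine iteratedDeriv_two_comp_congr (B := c (X s)) ?_ hY
      (hY'.contDiffAt.of_le (by norm_num)) hYY.1 hYY.2.1 hYY.2.2
    rw [hY0]
    exact (contDiffAt_right hs).of_le (by norm_num)
  rw [iteratedDeriv_two, hev.deriv.deriv_eq, ← iteratedDeriv_two]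
  exact iteratedDeriv_two_comp_congr (B := fun x' => iteratedDeriv 2 (fun t => c x' (Y' t)) 0)
    (by rwa [hX0]) hX (hX'.contDiffAt.of_le (by norm_num)) hXX.1 hXX.2.1 hXX.2.2

theorem IsNonnegCrossCurved.contDiffAt {U V : Set (E n)} {c : E n → E n → ℝ}
    (h : IsNonnegCrossCurved U V c) {x y : E n} (hx : x ∈ closure U) (hy : y ∈ closure V) :
    ContDiffAt ℝ 4 (fun p : E n × E n => c p.1 p.2) (x, y) := by
  obtain ⟨W, hW, hsub, hc⟩ := h.smooth
  exact hc.contDiffAt (hW.mem_nhds (hsub ⟨hx, hy⟩))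

/-- A jet that is affine to second order is realised by curves genuinely affine in the exponential
coordinates, to which the curve form of the hypothesis applies. -/
theorem IsNonnegCrossCurved.crossCurvedCost {U V : Set (E n)} {c : E n → E n → ℝ}
    (h : IsNonnegCrossCurved U V c) : CrossCurvedCost U V c where
  isOpen_U := h.isOpen_U
  isOpen_V := h.isOpen_V
  isBounded_U := h.isBounded_U
  isBounded_V := h.isBounded_V
  smoothAt x hx y hy := h.contDiffAt hx hy
  twist_x := h.twist_x
  twist_y := h.twist_y
  convex_U := h.convex_U
  convex_V := h.convex_V
  cross x hx y hy ξ ξ₂ ζ ζ₂ h1 h2 := by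
    have hx' := subset_closure hx
    have hy' := subset_closure hy
    have neg2 : ∀ f : ℝ → E n, iteratedDeriv 2 f 0 = 0 → iteratedDeriv 2 (fun s => -f s) 0 = 0 := by
      intro f hf
      rw [iteratedDeriv_fun_neg, hf, neg_zero]
    obtain ⟨X, v, ε, hε, hXc, hX0, hX1, hX2, hXS⟩ := exists_affine_curve h.isOpen_U
      ((h.twist_x y hy').1.mono subset_closure)
      (fun x hx => (contDiffAt_left (contDiffAt_Dy (k := 3)
        (h.contDiffAt (subset_closure hx) hy'))).neg.contDiffWithinAt)
      (fun x hx => (h.twist_x y hy').2 x (subset_closure hx)) hx (neg2 _ h1)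
    obtain ⟨Y, w, δ, hδ, hYc, hY0, hY1, hY2, hYS⟩ := exists_affine_curve h.isOpen_V
      ((h.twist_y x hx').1.mono subset_closure)
      (fun y hy => (contDiffAt_right (contDiffAt_Dx (k := 3)
        (h.contDiffAt hx' (subset_closure hy)))).neg.contDiffWithinAt)
      (fun y hy => (h.twist_y x hx').2 y (subset_closure hy)) hy (neg2 _ h2)
    -- The curves are admissible only near `0`. Reparametrising by `κ` makes them so on `[-1, 1]`
    -- and multiplies the fourth derivative by `κ ^ 4 > 0`.
    set κ := min ε δ / 2 with hκ
    have hmin : 0 < min ε δ := lt_min hε hδ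
    have hκ0 : 0 < κ := by positivity
    have hbd : ∀ t ∈ Icc (-1 : ℝ) 1, |κ * t| < min ε δ := by
      intro t ht
      rw [abs_mul, abs_of_pos hκ0]
      have := abs_le.2 ht
      nlinarith
    have hcr := h.cross (fun s => X (κ * s)) (fun t => Y (κ * t))
      (fun t ht => ⟨subset_closure (hXS _ ((hbd t ht).trans_le (min_le_left _ _))).1,
        subset_closure (hYS _ ((hbd t ht).trans_le (min_le_right _ _))).1⟩)
      ⟨Dy c x y, -(κ • v), Dx c x y, -(κ • w), fun t ht => by
        have e1 := (hXS _ ((hbd t ht).trans_le (min_le_left _ _))).2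
        have e2 := (hYS _ ((hbd t ht).trans_le (min_le_right _ _))).2
        simp only [mul_zero, hX0, hY0]
        constructor
        · rw [← neg_neg (Dy c (X (κ * t)) y), e1]; module
        · rw [← neg_neg (Dx c x (Y (κ * t))), e2]; module⟩
    have e1 : (fun s => iteratedDeriv 2 (fun t => c (X (κ * s)) (Y (κ * t))) 0) = fun s =>
        (fun s => κ ^ 2 • iteratedDeriv 2 (fun t => c (X s) (Y t)) 0) (κ * s) := by
      ext s
      exact iteratedDeriv_two_comp_mul (f := fun t => c (X (κ * s)) (Y t)) κ
    rw [e1, iteratedDeriv_two_comp_mul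
      (f := fun s => κ ^ 2 • iteratedDeriv 2 (fun t => c (X s) (Y t)) 0)] at hcr
    have e2 : iteratedDeriv 2 (fun s => κ ^ 2 • iteratedDeriv 2 (fun t => c (X s) (Y t)) 0) 0 =
        κ ^ 2 • iteratedDeriv 2 (fun s => iteratedDeriv 2 (fun t => c (X s) (Y t)) 0) 0 := by
      rw [iteratedDeriv_two, iteratedDeriv_two]
      have : deriv (fun s => κ ^ 2 • iteratedDeriv 2 (fun t => c (X s) (Y t)) 0) = fun s =>
          κ ^ 2 • deriv (fun s => iteratedDeriv 2 (fun t => c (X s) (Y t)) 0) s := by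
        ext s; exact deriv_fun_const_smul_field _ _
      rw [this]
      exact deriv_fun_const_smul_field _ _
    rw [e2, iteratedDeriv_two_curve_congr (h.contDiffAt hx' hy') hXc
      (contDiff_quadCurve x ξ ξ₂) hYc (contDiff_quadCurve y ζ ζ₂) hX0 hY0
      (by simp [hX0, hX1, hX2]) (by simp [hY0, hY1, hY2])] at hcr
    simp only [smul_eq_mul] at hcr
    have hk : 0 < κ ^ 2 := by positivity
    by_contra hpos
    push Not at hpos
    have := mul_pos hk (mul_pos hk hpos)
    linarith

/-! ### From cross-curvature to convexity in exponential coordinates -/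

theorem antitone_of_second_deriv_nonpos {m : ℝ → ℝ} (hm : ∀ t ∈ Icc (0 : ℝ) 1, ContDiffAt ℝ 2 m t)
    (h2 : ∀ t ∈ Icc (0 : ℝ) 1, iteratedDeriv 2 m t ≤ 0) (h1 : deriv m 0 = 0) : m 1 ≤ m 0 := by
  have hdm : ∀ t ∈ Icc (0 : ℝ) 1, DifferentiableAt ℝ (deriv m) t := fun t ht => by
    have : ContDiffAt ℝ 1 (fun s => fderiv ℝ m s 1) t :=
      ((hm t ht).fderiv_right (m := 1) (by norm_num)).clm_apply contDiffAt_const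
    exact this.differentiableAt (by norm_num)
  have ha : AntitoneOn (deriv m) (Icc 0 1) :=
    antitoneOn_of_deriv_nonpos (convex_Icc 0 1)
      (fun t ht => (hdm t ht).continuousAt.continuousWithinAt)
      (fun t ht => (hdm t (interior_subset ht)).differentiableWithinAt)
      (fun t ht => by
        have := h2 t (interior_subset ht)
        rwa [iteratedDeriv_two] at this)
  have hb : AntitoneOn m (Icc 0 1) :=
    antitoneOn_of_deriv_nonpos (convex_Icc 0 1)
      (fun t ht => (hm t ht).continuousAt.continuousWithinAt)
      (fun t ht => ((hm t (interior_subset ht)).differentiableAt (by norm_num)).differentiableWithinAt)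
      (fun t ht => by
        have ht' := interior_subset ht
        have := ha (left_mem_Icc.2 zero_le_one) ht' ht'.1
        rwa [h1] at this)
  exact hb (left_mem_Icc.2 zero_le_one) (right_mem_Icc.2 zero_le_one) zero_le_one

/-- The curve from `x₁` to `x₂` which is a segment in the coordinate `φ`. -/
theorem exists_segment_curve {φ : E n → E n} {S : Set (E n)} (hS : IsOpen S) (hinj : InjOn φ S)
    (hφ : ContDiffOn ℝ 3 φ S) (hinv : ∀ x ∈ S, (fderiv ℝ φ x).IsInvertible)
    (hconv : Convex ℝ (φ '' S)) {x₁ x₂ : E n} (hx₁ : x₁ ∈ S) (hx₂ : x₂ ∈ S) :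
    ∃ (X : ℝ → E n) (T : Set ℝ), IsOpen T ∧ Icc 0 1 ⊆ T ∧
      (∀ t ∈ T, X t ∈ S ∧ φ (X t) = φ x₁ + t • (φ x₂ - φ x₁) ∧ ContDiffAt ℝ 2 X t) ∧
      X 0 = x₁ ∧ X 1 = x₂ := by
  obtain ⟨hop, hsm⟩ := invFunOn_of_isInvertible hS hinj (k := 3) (by norm_num) hφ hinv
  set g := Function.invFunOn φ S
  have hgS : ∀ q ∈ φ '' S, g q ∈ S ∧ φ (g q) = q := fun q hq =>
    ⟨Function.invFunOn_mem hq, Function.invFunOn_eq hq⟩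
  set w := φ x₂ - φ x₁ with hw
  have hc : Continuous fun t : ℝ => φ x₁ + t • w := by fun_prop
  have hsub : Icc (0 : ℝ) 1 ⊆ (fun t : ℝ => φ x₁ + t • w) ⁻¹' (φ '' S) := fun t ht =>
    hconv.add_smul_sub_mem ⟨x₁, hx₁, rfl⟩ ⟨x₂, hx₂, rfl⟩ ht
  refine ⟨fun t => g (φ x₁ + t • w), _, hop.preimage hc, hsub, fun t ht => ⟨(hgS _ ht).1,
    (hgS _ ht).2, ?_⟩, ?_, ?_⟩
  · have h1 : ContDiffAt ℝ 2 g (φ x₁ + t • w) := (hsm _ ht).of_le (by norm_cast)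
    exact ContDiffAt.comp t (g := g) (f := fun s : ℝ => φ x₁ + s • w) h1 (by fun_prop)
  · have := hgS _ (hsub (left_mem_Icc.2 zero_le_one))
    exact hinj this.1 hx₁ (by rw [this.2]; simp)
  · have := hgS _ (hsub (right_mem_Icc.2 zero_le_one))
    exact hinj this.1 hx₂ (by rw [this.2]; simp [hw])

theorem iteratedDeriv_two_fderiv_eq {c : E n → E n → ℝ} {x y ξ ξ₂ : E n}
    (h : ContDiffAt ℝ 2 (fun x' => c x' y) x) :
    iteratedDeriv 2 (fun s => c (quadCurve x ξ ξ₂ s) y) 0 =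
      fderiv ℝ (fderiv ℝ fun x' => c x' y) x ξ ξ + ⟪Dx c x y, ξ₂⟫ := by
  have := iteratedDeriv_two_comp (B := fun x' => c x' y) (X := quadCurve x ξ ξ₂) (t := 0)
    (by rwa [quadCurve_zero]) (contDiff_quadCurve _ _ _).contDiffAt
  rwa [quadCurve_zero, deriv_quadCurve_zero, iteratedDeriv_quadCurve_zero, ← inner_Dx] at this

namespace CrossCurvedCost

variable {U V : Set (E n)} {c : E n → E n → ℝ}

theorem contDiffOn_Dy (h : CrossCurvedCost U V c) {y : E n} (hy : y ∈ closure V) :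
    ContDiffOn ℝ 3 (fun x => -Dy c x y) U := fun x hx =>
  (contDiffAt_left (contDiffAt_Dy (k := 3)
    (h.smoothAt x (subset_closure hx) y hy))).neg.contDiffWithinAt

theorem contDiffOn_Dx (h : CrossCurvedCost U V c) {x : E n} (hx : x ∈ closure U) :
    ContDiffOn ℝ 3 (fun y => -Dx c x y) V := h.swap.contDiffOn_Dy hx

/-- The acceleration enters the second derivative of `Dy c` linearly, through the mixed derivative,
which the twist condition makes invertible. -/
theorem exists_accel (h : CrossCurvedCost U V c) {x y : E n} (hx : x ∈ closure U)
    (hy : y ∈ closure V) (ξ : E n) :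
    ∃ ξ₂, iteratedDeriv 2 (fun s => Dy c (quadCurve x ξ ξ₂ s) y) 0 = 0 := by
  have hD : ContDiffAt ℝ 2 (fun x' => Dy c x' y) x :=
    (contDiffAt_left (contDiffAt_Dy (k := 3) (h.smoothAt x hx y hy))).of_le (by norm_cast)
  obtain ⟨A, hA⟩ := (h.twist_x y hy).2 x hx
  rw [fderiv_fun_neg] at hA
  refine ⟨A.symm (fderiv ℝ (fderiv ℝ fun x' => Dy c x' y) x ξ ξ), ?_⟩
  have := iteratedDeriv_two_comp (B := fun x' => Dy c x' y)
    (X := quadCurve x ξ (A.symm (fderiv ℝ (fderiv ℝ fun x' => Dy c x' y) x ξ ξ))) (t := 0)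
    (by rwa [quadCurve_zero]) (contDiff_quadCurve _ _ _).contDiffAt
  rw [quadCurve_zero, deriv_quadCurve_zero, iteratedDeriv_quadCurve_zero] at this
  rw [this]
  have e : fderiv ℝ (fun x' => Dy c x' y) x = -(A : E n →L[ℝ] E n) := by rw [hA, neg_neg]
  rw [e]
  simp

theorem contDiffAt_quad (h : CrossCurvedCost U V c) {x y : E n} (hx : x ∈ closure U)
    (hy : y ∈ closure V) (ξ ξ₂ ζ ζ₂ : E n) :
    ContDiffAt ℝ 4 (fun r : ℝ × ℝ => c (quadCurve x ξ ξ₂ r.1) (quadCurve y ζ ζ₂ r.2)) (0, 0) := by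
  refine ContDiffAt.comp (0, 0) (g := fun p : E n × E n => c p.1 p.2)
    (f := fun r : ℝ × ℝ => (quadCurve x ξ ξ₂ r.1, quadCurve y ζ ζ₂ r.2)) ?_ ?_
  · simpa using h.smoothAt x hx y hy
  · exact (((contDiff_quadCurve x ξ ξ₂).comp contDiff_fst).prodMk
      ((contDiff_quadCurve y ζ ζ₂).comp contDiff_snd)).contDiffAt

theorem contDiffAt_second (h : CrossCurvedCost U V c) {x y : E n} (hx : x ∈ closure U)
    (hy : y ∈ closure V) (ξ ξ₂ : E n) :
    ContDiffAt ℝ 2 (fun y' => iteratedDeriv 2 (fun s => c (quadCurve x ξ ξ₂ s) y') 0) y := by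
  refine contDiffAt_iteratedDeriv_two (k := 2) (G := fun y' s => c (quadCurve x ξ ξ₂ s) y') ?_
  refine ContDiffAt.comp (y, (0 : ℝ)) (g := fun p : E n × E n => c p.1 p.2)
    (f := fun r : E n × ℝ => (quadCurve x ξ ξ₂ r.2, r.1)) ?_ ?_
  · simpa using h.smoothAt x hx y hy
  · exact (((contDiff_quadCurve x ξ ξ₂).comp contDiff_snd).prodMk contDiff_fst).contDiffAt

/-- Along a `c`-segment of `y`s the second derivatives of the cost are concave. -/
theorem second_deriv_along_segment_nonpos (h : CrossCurvedCost U V c) {x : E n} (hx : x ∈ U)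
    {Y : ℝ → E n} {t₀ : ℝ} (hY : ContDiffAt ℝ 2 Y t₀) (hYV : Y t₀ ∈ V)
    {a w : E n} (haff : ∀ᶠ t in 𝓝 t₀, -Dx c x (Y t) = a + t • w) (ξ ξ₂ : E n) :
    iteratedDeriv 2 (fun t => iteratedDeriv 2 (fun s => c (quadCurve x ξ ξ₂ s) (Y t)) 0) t₀ ≤ 0 := by
  have hx' := subset_closure hx
  have hy' := subset_closure hYV
  -- Cross-curvature at `(x, Y t₀)` needs an acceleration adapted to `Y t₀`, while `ξ₂` is
  -- arbitrary. Replacing it changes the function by `⟪Dx c x (Y t), ξ₂ - ξ₃⟫`, which is affine in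
  -- `t` along the segment and has no second derivative.
  obtain ⟨ξ₃, hξ₃⟩ := h.exists_accel hx' hy' ξ
  set ζ := deriv Y t₀ with hζ
  set ζ₂ := iteratedDeriv 2 Y t₀ with hζ₂
  have hYcl : ∀ᶠ t in 𝓝 t₀, Y t ∈ closure V :=
    hY.continuousAt.eventually_mem (mem_of_superset (h.isOpen_V.mem_nhds hYV) subset_closure)
  have hev : (fun t => iteratedDeriv 2 (fun s => c (quadCurve x ξ ξ₂ s) (Y t)) 0) =ᶠ[𝓝 t₀]
      fun t => iteratedDeriv 2 (fun s => c (quadCurve x ξ ξ₃ s) (Y t)) 0 +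
        (-⟪a, ξ₂ - ξ₃⟫ + t • (-⟪w, ξ₂ - ξ₃⟫)) := by
    filter_upwards [haff, hYcl] with t ht htV
    have hcx : ContDiffAt ℝ 2 (fun x' => c x' (Y t)) x :=
      (contDiffAt_left (h.smoothAt x hx' _ htV)).of_le (by norm_num)
    rw [iteratedDeriv_two_fderiv_eq hcx, iteratedDeriv_two_fderiv_eq hcx]
    have e : Dx c x (Y t) = -(a + t • w) := by rw [← ht, neg_neg]
    rw [e]
    simp only [inner_neg_left, inner_add_left, inner_sub_right, real_inner_smul_left, smul_eq_mul]
    ring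
  have hM : ContDiffAt ℝ 2 (fun y' => iteratedDeriv 2 (fun s => c (quadCurve x ξ ξ₃ s) y') 0)
    (Y t₀) := h.contDiffAt_second hx' hy' ξ ξ₃
  have hMY : ContDiffAt ℝ 2
      (fun t => iteratedDeriv 2 (fun s => c (quadCurve x ξ ξ₃ s) (Y t)) 0) t₀ :=
    ContDiffAt.comp t₀ (g := fun y' => iteratedDeriv 2 (fun s => c (quadCurve x ξ ξ₃ s) y') 0) hM hY
  have hYq : ContDiffAt ℝ 2 (quadCurve (Y t₀) ζ ζ₂) 0 := (contDiff_quadCurve _ _ _).contDiffAt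
  rw [iteratedDeriv_two, hev.deriv.deriv_eq, ← iteratedDeriv_two,
    iteratedDeriv_fun_add hMY (by fun_prop),
    iteratedDeriv_two_affine (Eventually.of_forall fun _ => rfl), add_zero,
    iteratedDeriv_two_comp_congr (X := Y) (X' := quadCurve (Y t₀) ζ ζ₂) (t' := 0)
      (B := fun y' => iteratedDeriv 2 (fun s => c (quadCurve x ξ ξ₃ s) y') 0) hM hY hYq
      (by simp) (by simp [hζ]) (by simp [hζ₂]),
    ← iteratedDeriv_two_comm (G := fun s t => c (quadCurve x ξ ξ₃ s) (quadCurve (Y t₀) ζ ζ₂ t))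
      (h.contDiffAt_quad hx' hy' ξ ξ₃ ζ ζ₂)]
  refine h.cross x hx _ hYV ξ ξ₃ ζ ζ₂ hξ₃ ?_
  have hDx : ContDiffAt ℝ 2 (fun y' => Dx c x y') (Y t₀) :=
    (contDiffAt_right (contDiffAt_Dx (k := 3) (h.smoothAt x hx' _ hy'))).of_le (by norm_cast)
  rw [← iteratedDeriv_two_comp_congr (X := Y) (t := t₀) (B := fun y' => Dx c x y') hDx hY hYq
    (by simp) (by simp [hζ]) (by simp [hζ₂])]
  refine iteratedDeriv_two_affine (a := -a) (v := -w) ?_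
  filter_upwards [haff] with t ht
  rw [← neg_neg (Dx c x (Y t)), ht]
  module

/-- Along the segment from `ya` to `yb` in the coordinate `-Dx c x ·`, the second derivative of the
cost in `s` is concave in `t`. Its slope at `t = 0` is the second derivative of `⟪ζ, Dy c · ya⟫`,
zero by `h0`, so it does not increase. -/
theorem second_deriv_le (h : CrossCurvedCost U V c) {x ya yb : E n} (hx : x ∈ U) (hya : ya ∈ V)
    (hyb : yb ∈ V) {ξ ξ₂ : E n}
    (h0 : iteratedDeriv 2 (fun s => Dy c (quadCurve x ξ ξ₂ s) ya) 0 = 0) :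
    iteratedDeriv 2 (fun s => c (quadCurve x ξ ξ₂ s) yb) 0 ≤
      iteratedDeriv 2 (fun s => c (quadCurve x ξ ξ₂ s) ya) 0 := by
  have hx' := subset_closure hx
  have hya' := subset_closure hya
  obtain ⟨Y, T, hT, hIT, hYT, hY0, hY1⟩ := exists_segment_curve h.isOpen_V
    ((h.twist_y x hx').1.mono subset_closure) (h.contDiffOn_Dx hx')
    (fun y hy => (h.twist_y x hx').2 y (subset_closure hy)) (h.convex_V x hx') hya hyb
  have hM : ∀ y ∈ V, ContDiffAt ℝ 2
      (fun y' => iteratedDeriv 2 (fun s => c (quadCurve x ξ ξ₂ s) y') 0) y := fun y hy =>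
    h.contDiffAt_second hx' (subset_closure hy) ξ ξ₂
  have key := antitone_of_second_deriv_nonpos
    (m := fun t => iteratedDeriv 2 (fun s => c (quadCurve x ξ ξ₂ s) (Y t)) 0)
    (fun t ht => ContDiffAt.comp t
      (g := fun y' => iteratedDeriv 2 (fun s => c (quadCurve x ξ ξ₂ s) y') 0)
      (hM _ (hYT t (hIT ht)).1) (hYT t (hIT ht)).2.2)
    (fun t ht => h.second_deriv_along_segment_nonpos hx (hYT t (hIT ht)).2.2 (hYT t (hIT ht)).1
      (by filter_upwards [hT.mem_nhds (hIT ht)] with s hs using (hYT s hs).2.1) ξ ξ₂) ?_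
  · simpa only [hY0, hY1] using key
  have hYd : DifferentiableAt ℝ Y 0 :=
    (hYT 0 (hIT (left_mem_Icc.2 zero_le_one))).2.2.differentiableAt (by norm_num)
  set ζ := deriv Y 0 with hζ
  have hMd : DifferentiableAt ℝ
      (fun y' => iteratedDeriv 2 (fun s => c (quadCurve x ξ ξ₂ s) y') 0) ya :=
    (hM _ hya).differentiableAt (by norm_num)
  have e1 : deriv (fun t => iteratedDeriv 2 (fun s => c (quadCurve x ξ ξ₂ s) (Y t)) 0) 0 =
      fderiv ℝ (fun y' => iteratedDeriv 2 (fun s => c (quadCurve x ξ ξ₂ s) y') 0) ya ζ := by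
    rw [← hY0] at hMd ⊢
    exact (hMd.hasFDerivAt.comp_hasDerivAt (0 : ℝ) hYd.hasDerivAt).deriv
  have hq0 : quadCurve ya ζ 0 0 = ya := quadCurve_zero _ _ _
  have e2 : deriv (fun t => iteratedDeriv 2
      (fun s => c (quadCurve x ξ ξ₂ s) (quadCurve ya ζ 0 t)) 0) 0 =
      fderiv ℝ (fun y' => iteratedDeriv 2 (fun s => c (quadCurve x ξ ξ₂ s) y') 0) ya ζ := by
    have hd := hasDerivAt_quadCurve ya ζ 0 0
    rw [smul_zero, add_zero] at hd
    rw [← hq0] at hMd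
    have := (hMd.hasFDerivAt.comp_hasDerivAt (0 : ℝ) hd).deriv
    rw [hq0] at this
    exact this
  rw [e1, ← e2, deriv_iteratedDeriv_two_comm
    (G := fun s t => c (quadCurve x ξ ξ₂ s) (quadCurve ya ζ 0 t))
    ((h.contDiffAt_quad hx' hya' ξ ξ₂ ζ 0).of_le (by norm_num))]
  have hev : (fun s => deriv (fun t => c (quadCurve x ξ ξ₂ s) (quadCurve ya ζ 0 t)) 0) =ᶠ[𝓝 0]
      fun s => innerSL ℝ ζ (Dy c (quadCurve x ξ ξ₂ s) ya) := by
    have hc : ContinuousAt (fun s => (quadCurve x ξ ξ₂ s, ya)) 0 :=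
      (contDiff_quadCurve x ξ ξ₂ (k := 0)).continuous.continuousAt.prodMk continuousAt_const
    have := hc.eventually (p := fun p : E n × E n => ContDiffAt ℝ 4 (fun p => c p.1 p.2) p)
      (by beta_reduce; rw [quadCurve_zero]; exact (h.smoothAt x hx' ya hya').eventually (by norm_num))
    filter_upwards [this] with s hs
    have hd := hasDerivAt_quadCurve ya ζ 0 0
    rw [smul_zero, add_zero] at hd
    have hcd : DifferentiableAt ℝ (c (quadCurve x ξ ξ₂ s)) (quadCurve ya ζ 0 0) := by
      rw [hq0]; exact (contDiffAt_right hs).differentiableAt (by norm_num)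
    have := (hcd.hasFDerivAt.comp_hasDerivAt (0 : ℝ) hd).deriv
    rw [hq0] at this
    rw [innerSL_apply_apply, real_inner_comm, inner_Dy]
    exact this
  have hDy : ContDiffAt ℝ 2 (fun s => Dy c (quadCurve x ξ ξ₂ s) ya) 0 := by
    have : ContDiffAt ℝ 2 (fun x' => Dy c x' ya) (quadCurve x ξ ξ₂ 0) := by
      rw [quadCurve_zero]
      exact (contDiffAt_left (contDiffAt_Dy (k := 3) (h.smoothAt x hx' ya hya'))).of_le
        (by norm_cast)
    exact ContDiffAt.comp (0 : ℝ) (g := fun x' => Dy c x' ya) this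
      (contDiff_quadCurve _ _ _).contDiffAt
  rw [iteratedDeriv_two, hev.deriv.deriv_eq, ← iteratedDeriv_two, iteratedDeriv_two_clm _ hDy, h0,
    map_zero]

/-- Convexity of `-c(·, yb) + c(·, ya)` in the cost exponential coordinate from `ya`, at interior
points. -/
theorem neg_sub_le_of_mem (h : CrossCurvedCost U V c) {ya yb x₁ x₂ x₃ : E n} (hya : ya ∈ V)
    (hyb : yb ∈ V) (hx₁ : x₁ ∈ U) (hx₂ : x₂ ∈ U) (hx₃ : x₃ ∈ U) {a b : ℝ} (ha : 0 ≤ a)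
    (hb : 0 ≤ b) (hab : a + b = 1) (hx : Dy c x₃ ya = a • Dy c x₁ ya + b • Dy c x₂ ya) :
    c x₃ ya - c x₃ yb ≤ a * (c x₁ ya - c x₁ yb) + b * (c x₂ ya - c x₂ yb) := by
  have hya' := subset_closure hya
  have hyb' := subset_closure hyb
  have hinj := (h.twist_x ya hya').1.mono (subset_closure (s := U))
  obtain ⟨X, T, hT, hIT, hXT, hX0, hX1⟩ := exists_segment_curve h.isOpen_U hinj
    (h.contDiffOn_Dy hya') (fun x hx => (h.twist_x ya hya').2 x (subset_closure hx))
    (h.convex_U ya hya') hx₁ hx₂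
  have hcX : ∀ y ∈ closure V, ∀ t ∈ T, ContDiffAt ℝ 2 (fun x' => c x' y) (X t) := fun y hy t ht =>
    (contDiffAt_left (h.smoothAt _ (subset_closure (hXT t ht).1) y hy)).of_le (by norm_num)
  have hcXt : ∀ y ∈ closure V, ∀ t ∈ T, ContDiffAt ℝ 2 (fun t => c (X t) y) t := fun y hy t ht =>
    ContDiffAt.comp t (g := fun x' => c x' y) (hcX y hy t ht) (hXT t ht).2.2
  set f : ℝ → ℝ := fun t => c (X t) ya - c (X t) yb with hf
  have hfc : ∀ t ∈ Icc (0 : ℝ) 1, ContDiffAt ℝ 2 f t := fun t ht =>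
    (hcXt ya hya' t (hIT ht)).sub (hcXt yb hyb' t (hIT ht))
  have hdf : ∀ t ∈ Icc (0 : ℝ) 1, DifferentiableAt ℝ (deriv f) t := fun t ht => by
    have : ContDiffAt ℝ 1 (fun s => fderiv ℝ f s 1) t :=
      ((hfc t ht).fderiv_right (m := 1) (by norm_num)).clm_apply contDiffAt_const
    exact this.differentiableAt (by norm_num)
  -- The curve is affine in the coordinate from `ya`, so its jet satisfies the hypothesis of
  -- `second_deriv_le` at every time.
  have hf2 : ∀ t ∈ Icc (0 : ℝ) 1, 0 ≤ iteratedDeriv 2 f t := by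
    intro t ht
    have htT := hIT ht
    have hXc := (hXT t htT).2.2
    have hq : ContDiffAt ℝ 2 (quadCurve (X t) (deriv X t) (iteratedDeriv 2 X t)) 0 :=
      (contDiff_quadCurve _ _ _).contDiffAt
    rw [hf, iteratedDeriv_fun_sub (hcXt ya hya' t htT) (hcXt yb hyb' t htT), sub_nonneg,
      iteratedDeriv_two_comp_congr (B := fun x' => c x' yb) (hcX yb hyb' t htT) hXc hq
        (by simp) (by simp) (by simp),
      iteratedDeriv_two_comp_congr (B := fun x' => c x' ya) (hcX ya hya' t htT) hXc hq
        (by simp) (by simp) (by simp)]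
    refine h.second_deriv_le (hXT t htT).1 hya hyb ?_
    have hDy : ContDiffAt ℝ 2 (fun x' => Dy c x' ya) (X t) :=
      (contDiffAt_left (contDiffAt_Dy (k := 3) (h.smoothAt _ (subset_closure (hXT t htT).1)
        ya hya'))).of_le (by norm_cast)
    rw [← iteratedDeriv_two_comp_congr (B := fun x' => Dy c x' ya) hDy hXc hq
      (by simp) (by simp) (by simp)]
    refine iteratedDeriv_two_affine (a := Dy c x₁ ya) (v := Dy c x₂ ya - Dy c x₁ ya) ?_
    filter_upwards [hT.mem_nhds htT] with s hs
    rw [← neg_neg (Dy c (X s) ya), (hXT s hs).2.1]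
    module
  have hconv : ConvexOn ℝ (Icc 0 1) f :=
    convexOn_of_deriv2_nonneg (convex_Icc 0 1)
      (fun t ht => (hfc t ht).continuousAt.continuousWithinAt)
      (fun t ht => ((hfc t (interior_subset ht)).differentiableAt
        (by norm_num)).differentiableWithinAt)
      (fun t ht => (hdf t (interior_subset ht)).differentiableWithinAt)
      (fun t ht => by
        have := hf2 t (interior_subset ht)
        rwa [iteratedDeriv_two] at this)
  have hle := hconv.2 (left_mem_Icc.2 zero_le_one) (right_mem_Icc.2 zero_le_one) ha hb hab
  have hbI : b ∈ Icc (0 : ℝ) 1 := ⟨hb, by linarith⟩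
  have hXb : X b = x₃ := by
    refine hinj (hXT b (hIT hbI)).1 hx₃ ?_
    beta_reduce
    rw [(hXT b (hIT hbI)).2.1, hx]
    obtain rfl : a = 1 - b := by linarith
    module
  simpa [hf, hX0, hX1, hXb] using hle

end CrossCurvedCost

/-! ### Passage to the closures and the modified cost -/

/-- Properties of the inverse of a diffeomorphism of a compact set onto its range. -/
theorem IsDiffeoOntoRange.invFunOn_props {φ : E n → E n} {K : Set (E n)} (hK : IsCompact K)
    (hφ : IsDiffeoOntoRange φ K) (hc : ∀ x ∈ K, DifferentiableAt ℝ φ x) :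
    (∀ x ∈ K, Function.invFunOn φ K (φ x) = x) ∧
    (∀ q ∈ φ '' K, Function.invFunOn φ K q ∈ K ∧ φ (Function.invFunOn φ K q) = q) ∧
    ContinuousOn (Function.invFunOn φ K) (φ '' K) ∧
    ∀ q ∈ φ '' K, HasFDerivWithinAt (Function.invFunOn φ K)
      (fderiv ℝ φ (Function.invFunOn φ K q)).inverse (φ '' K) q := by
  set g := Function.invFunOn φ K
  have hleft : ∀ x ∈ K, g (φ x) = x := hφ.1.leftInvOn_invFunOn
  have hright : ∀ q ∈ φ '' K, g q ∈ K ∧ φ (g q) = q := fun q hq =>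
    ⟨Function.invFunOn_mem hq, Function.invFunOn_eq hq⟩
  have hcont : ContinuousOn g (φ '' K) := by
    rw [continuousOn_iff_isClosed]
    intro t ht
    refine ⟨φ '' (K ∩ t), ((hK.inter_right ht).image_of_continuousOn fun x hx =>
      (hc x hx.1).continuousAt.continuousWithinAt).isClosed, ?_⟩
    ext q
    constructor
    · rintro ⟨h1, h2⟩
      exact ⟨⟨g q, ⟨(hright q h2).1, h1⟩, (hright q h2).2⟩, h2⟩
    · rintro ⟨⟨x, hx, rfl⟩, h2⟩
      refine ⟨?_, h2⟩
      rw [mem_preimage, hleft x hx.1]; exact hx.2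
  refine ⟨hleft, hright, hcont, fun q hq => ?_⟩
  obtain ⟨A, hA⟩ := hφ.2 _ (hright q hq).1
  rw [← hA, ContinuousLinearMap.inverse_equiv]
  refine HasFDerivWithinAt.of_local_left_inverse (f := φ) (t := univ) ?_ ?_ hq ?_
  · rw [nhdsWithin_univ]; exact hcont q hq
  · rw [hasFDerivWithinAt_univ, hA]; exact (hc _ (hright q hq).1).hasFDerivAt
  · filter_upwards [self_mem_nhdsWithin] with q' hq' using (hright q' hq').2

theorem contDiffAt_fderiv_left {F : Type*} [NormedAddCommGroup F] [NormedSpace ℝ F]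
    {g : E n → E n → F} {x y : E n} {k : ℕ}
    (h : ContDiffAt ℝ (k + 1 : ℕ) (fun p : E n × E n => g p.1 p.2) (x, y)) :
    ContDiffAt ℝ k (fun p : E n × E n => fderiv ℝ (fun x' => g x' p.2) p.1) (x, y) := by
  have hev : (fun p : E n × E n => fderiv ℝ (fun x' => g x' p.2) p.1) =ᶠ[𝓝 (x, y)] fun p =>
      (fderiv ℝ (fun p : E n × E n => g p.1 p.2) p).comp
        (ContinuousLinearMap.inl ℝ (E n) (E n)) := by
    filter_upwards [h.eventually
      (fun h => absurd h (WithTop.coe_injective.ne (ENat.natCast_ne_top _)))] with p hp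
    have hd : DifferentiableAt ℝ (fun p : E n × E n => g p.1 p.2) (p.1, p.2) :=
      hp.differentiableAt (by norm_cast)
    exact (HasFDerivAt.comp p.1 (g := fun p : E n × E n => g p.1 p.2)
      (f := fun e => (e, p.2)) hd.hasFDerivAt
      (hasFDerivAt_prodMk_left p.1 p.2)).fderiv
  refine ContDiffAt.congr_of_eventuallyEq ?_ hev
  exact ContDiffAt.clm_comp (h.fderiv_right (by norm_cast)) contDiffAt_const

/-- The derivative is one-sided because a segment may start on the boundary of the coordinate
domain. -/
theorem le_of_hasDerivWithinAt_of_le {f : ℝ → ℝ} {f' m : ℝ}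
    (hf : HasDerivWithinAt f f' (Icc 0 1) 0) (h : ∀ t ∈ Icc (0 : ℝ) 1, f t ≤ f 0 + t * m) :
    f' ≤ m := by
  have hf' : HasDerivWithinAt f f' (Ioc 0 1) 0 := hf.mono Ioc_subset_Icc_self
  rw [hasDerivWithinAt_iff_tendsto_slope' (by simp)] at hf'
  have hne : (𝓝[Ioc (0 : ℝ) 1] 0).NeBot := by
    rw [nhdsWithin_Ioc_eq_nhdsGT zero_lt_one]; infer_instance
  refine le_of_tendsto hf' ?_
  filter_upwards [self_mem_nhdsWithin] with t ht
  rw [slope_def_field, sub_zero, div_le_iff₀ ht.1]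
  linarith [h t ⟨ht.1.le, ht.2⟩]

namespace CrossCurvedCost

variable {U V : Set (E n)} {c : E n → E n → ℝ}

theorem isCompact_U (h : CrossCurvedCost U V c) : IsCompact (closure U) :=
  h.isBounded_U.isCompact_closure

theorem isCompact_V (h : CrossCurvedCost U V c) : IsCompact (closure V) :=
  h.isBounded_V.isCompact_closure

theorem contDiffAt_Dy' (h : CrossCurvedCost U V c) {x y : E n} (hx : x ∈ closure U)
    (hy : y ∈ closure V) : ContDiffAt ℝ 3 (fun p : E n × E n => Dy c p.1 p.2) (x, y) :=
  contDiffAt_Dy (k := 3) (h.smoothAt x hx y hy)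

theorem contDiffAt_Dx' (h : CrossCurvedCost U V c) {x y : E n} (hx : x ∈ closure U)
    (hy : y ∈ closure V) : ContDiffAt ℝ 3 (fun p : E n × E n => Dx c p.1 p.2) (x, y) :=
  contDiffAt_Dx (k := 3) (h.smoothAt x hx y hy)

theorem contDiffAt_Dxy (h : CrossCurvedCost U V c) {x y : E n} (hx : x ∈ closure U)
    (hy : y ∈ closure V) : ContDiffAt ℝ 2 (fun p : E n × E n => Dxy c p.1 p.2) (x, y) :=
  contDiffAt_fderiv_left (k := 2) (h.contDiffAt_Dy' hx hy)

theorem contDiffAt_Dxxy (h : CrossCurvedCost U V c) {x y : E n} (hx : x ∈ closure U)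
    (hy : y ∈ closure V) : ContDiffAt ℝ 1 (fun p : E n × E n => Dxxy c p.1 p.2) (x, y) :=
  contDiffAt_fderiv_left (k := 1) (h.contDiffAt_Dxy hx hy)

theorem isInvertible_Dxy (h : CrossCurvedCost U V c) {x y : E n} (hx : x ∈ closure U)
    (hy : y ∈ closure V) : (Dxy c x y).IsInvertible := by
  obtain ⟨A, hA⟩ := (h.twist_x y hy).2 x hx
  rw [fderiv_fun_neg] at hA
  refine ⟨(ContinuousLinearEquiv.neg ℝ).trans A, ?_⟩
  ext1 v
  have := congrArg (fun L : E n →L[ℝ] E n => L v) hA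
  simp only [ContinuousLinearEquiv.coe_coe, neg_apply] at this
  simp [this, Dxy]

/-- Convexity of `-c(·, yb) + c(·, ya)` in the cost exponential coordinate from `ya`. -/
theorem neg_sub_le (h : CrossCurvedCost U V c) {ya yb x₁ x₂ x₃ : E n} (hya : ya ∈ closure V)
    (hyb : yb ∈ closure V) (hx₁ : x₁ ∈ closure U) (hx₂ : x₂ ∈ closure U) (hx₃ : x₃ ∈ closure U)
    {a b : ℝ} (ha : 0 ≤ a) (hb : 0 ≤ b) (hab : a + b = 1)
    (hx : Dy c x₃ ya = a • Dy c x₁ ya + b • Dy c x₂ ya) :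
    c x₃ ya - c x₃ yb ≤ a * (c x₁ ya - c x₁ yb) + b * (c x₂ ya - c x₂ yb) := by
  -- Everything is approximated from the open sets. Convexity of the image of `U` supplies
  -- intermediate points, and injectivity of the twist map identifies their limit as `x₃`.
  obtain ⟨ya', hya', hyal⟩ := mem_closure_iff_seq_limit.1 hya
  obtain ⟨yb', hyb', hybl⟩ := mem_closure_iff_seq_limit.1 hyb
  obtain ⟨x₁', hx₁', hx₁l⟩ := mem_closure_iff_seq_limit.1 hx₁
  obtain ⟨x₂', hx₂', hx₂l⟩ := mem_closure_iff_seq_limit.1 hx₂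
  have hex : ∀ k, ∃ x ∈ U, Dy c x (ya' k) = a • Dy c (x₁' k) (ya' k) + b • Dy c (x₂' k) (ya' k) := by
    intro k
    obtain ⟨x, hx, he⟩ := h.convex_U (ya' k) (subset_closure (hya' k)) ⟨_, hx₁' k, rfl⟩
      ⟨_, hx₂' k, rfl⟩ ha hb hab
    refine ⟨x, hx, ?_⟩
    change -Dy c x (ya' k) = a • -Dy c (x₁' k) (ya' k) + b • -Dy c (x₂' k) (ya' k) at he
    rw [← neg_neg (Dy c x (ya' k)), he]
    simp only [smul_neg, neg_add, neg_neg]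
  choose x₃' hx₃' hx₃e using hex
  obtain ⟨z, hz, φ, hφ, hzl⟩ := h.isCompact_U.tendsto_subseq fun k => subset_closure (hx₃' k)
  have sub : ∀ {w : ℕ → E n} {w' : E n}, Tendsto w atTop (𝓝 w') →
      Tendsto (fun k => w (φ k)) atTop (𝓝 w') := fun hw => hw.comp hφ.tendsto_atTop
  have limD : ∀ {w v : ℕ → E n} {w' v' : E n}, w' ∈ closure U → v' ∈ closure V →
      Tendsto w atTop (𝓝 w') → Tendsto v atTop (𝓝 v') →
      Tendsto (fun k => Dy c (w k) (v k)) atTop (𝓝 (Dy c w' v')) := fun hw hv h1 h2 =>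
    (h.contDiffAt_Dy' hw hv).continuousAt.tendsto.comp (h1.prodMk_nhds h2)
  have limc : ∀ {w v : ℕ → E n} {w' v' : E n}, w' ∈ closure U → v' ∈ closure V →
      Tendsto w atTop (𝓝 w') → Tendsto v atTop (𝓝 v') →
      Tendsto (fun k => c (w k) (v k)) atTop (𝓝 (c w' v')) := fun hw hv h1 h2 =>
    (h.smoothAt _ hw _ hv).continuousAt.tendsto.comp (h1.prodMk_nhds h2)
  have hzx : z = x₃ := by
    refine (h.twist_x ya hya).1 hz hx₃ ?_
    beta_reduce
    rw [hx]
    congr 1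
    have e1 := limD hz hya hzl (sub hyal)
    have e2 := ((limD hx₁ hya (sub hx₁l) (sub hyal)).const_smul a).add
      ((limD hx₂ hya (sub hx₂l) (sub hyal)).const_smul b)
    exact tendsto_nhds_unique (e1.congr fun k => hx₃e (φ k)) e2
  rw [hzx] at hzl
  refine le_of_tendsto_of_tendsto
    ((limc hx₃ hya hzl (sub hyal)).sub (limc hx₃ hyb hzl (sub hybl)))
    ((((limc hx₁ hya (sub hx₁l) (sub hyal)).sub (limc hx₁ hyb (sub hx₁l) (sub hybl))).const_mul a).add
      (((limc hx₂ hya (sub hx₂l) (sub hyal)).sub (limc hx₂ hyb (sub hx₂l) (sub hybl))).const_mul b))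
    (Eventually.of_forall fun k => h.neg_sub_le_of_mem (hya' (φ k)) (hyb' (φ k)) (hx₁' (φ k))
      (hx₂' (φ k)) (hx₃' (φ k)) ha hb hab (hx₃e (φ k)))

theorem convex_image_closure (h : CrossCurvedCost U V c) {y : E n} (hy : y ∈ closure V) :
    (fun x => -Dy c x y) '' closure U = closure ((fun x => -Dy c x y) '' U) ∧
    Convex ℝ ((fun x => -Dy c x y) '' closure U) := by
  have hc : ContinuousOn (fun x => -Dy c x y) (closure U) := fun x hx =>
    (contDiffAt_left (h.contDiffAt_Dy' hx hy)).continuousAt.neg.continuousWithinAt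
  have := image_closure_of_isCompact h.isCompact_U hc
  exact ⟨this, by rw [this]; exact (h.convex_U y hy).closure⟩

end CrossCurvedCost

/-- The derivative of `expCoordInv`. -/
noncomputable def coordDeriv (c : E n → E n → ℝ) (U : Set (E n)) (y₀ q : E n) : E n →L[ℝ] E n :=
  (fderiv ℝ (expCoord c y₀) (expCoordInv c U y₀ q)).inverse

/-- The gradient of `-modCost`. -/
noncomputable def modGrad (c : E n → E n → ℝ) (U : Set (E n)) (y₀ q y : E n) : E n :=
  ContinuousLinearMap.adjoint (coordDeriv c U y₀ q)
    (Dx c (expCoordInv c U y₀ q) y₀ - Dx c (expCoordInv c U y₀ q) y)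

/-- The mixed second derivative of `modCost`; the derivative of `modGrad` in the target variable
is `-(mixedDeriv)†`. -/
noncomputable def mixedDeriv (c : E n → E n → ℝ) (U : Set (E n)) (y₀ q y : E n) :
    E n →L[ℝ] E n :=
  (Dxy c (expCoordInv c U y₀ q) y).comp (coordDeriv c U y₀ q)

namespace CrossCurvedCost

variable {U V : Set (E n)} {c : E n → E n → ℝ} {y₀ : E n}

theorem expCoordInv_props (h : CrossCurvedCost U V c) (hy₀ : y₀ ∈ closure V) :
    (∀ x ∈ closure U, expCoordInv c U y₀ (expCoord c y₀ x) = x) ∧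
    (∀ q ∈ coordDomain c U y₀, expCoordInv c U y₀ q ∈ closure U ∧
      expCoord c y₀ (expCoordInv c U y₀ q) = q) ∧
    ContinuousOn (expCoordInv c U y₀) (coordDomain c U y₀) ∧
    ∀ q ∈ coordDomain c U y₀,
      HasFDerivWithinAt (expCoordInv c U y₀) (coordDeriv c U y₀ q) (coordDomain c U y₀) q :=
  IsDiffeoOntoRange.invFunOn_props h.isCompact_U (h.twist_x y₀ hy₀) fun x hx =>
    ((contDiffAt_left (h.contDiffAt_Dy' hx hy₀)).differentiableAt (by norm_num)).neg

theorem isCompact_coordDomain (h : CrossCurvedCost U V c) (hy₀ : y₀ ∈ closure V) :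
    IsCompact (coordDomain c U y₀) :=
  h.isCompact_U.image_of_continuousOn fun _ hx =>
    (contDiffAt_left (h.contDiffAt_Dy' hx hy₀)).continuousAt.neg.continuousWithinAt

theorem convex_coordDomain (h : CrossCurvedCost U V c) (hy₀ : y₀ ∈ closure V) :
    Convex ℝ (coordDomain c U y₀) := (h.convex_image_closure hy₀).2

theorem coordDeriv_eq (c : E n → E n → ℝ) (U : Set (E n)) (y₀ q : E n) :
    coordDeriv c U y₀ q = (-Dxy c (expCoordInv c U y₀ q) y₀).inverse := by
  unfold coordDeriv expCoord Dxy
  rw [fderiv_fun_neg]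

theorem isInvertible_coordDeriv (h : CrossCurvedCost U V c) (hy₀ : y₀ ∈ closure V) {q : E n}
    (hq : q ∈ coordDomain c U y₀) : (coordDeriv c U y₀ q).IsInvertible :=
  ((h.twist_x y₀ hy₀).2 _ ((h.expCoordInv_props hy₀).2.1 q hq).1).inverse

theorem continuousOn_coordDeriv (h : CrossCurvedCost U V c) (hy₀ : y₀ ∈ closure V) :
    ContinuousOn (coordDeriv c U y₀) (coordDomain c U y₀) := by
  obtain ⟨-, hmem, hcont, -⟩ := h.expCoordInv_props hy₀
  intro q hq
  have hx := (hmem q hq).1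
  have h1 : ContinuousAt (fun x => fderiv ℝ (expCoord c y₀) x) (expCoordInv c U y₀ q) := by
    have : ContDiffAt ℝ 3 (expCoord c y₀) (expCoordInv c U y₀ q) :=
      (contDiffAt_left (h.contDiffAt_Dy' hx hy₀)).neg
    exact (this.fderiv_right (m := 2) (by norm_num)).continuousAt
  have h2 : ContinuousAt ContinuousLinearMap.inverse
      (fderiv ℝ (expCoord c y₀) (expCoordInv c U y₀ q)) :=
    (((h.twist_x y₀ hy₀).2 _ hx).contDiffAt_map_inverse (n := 0)).continuousAt
  exact (h2.comp h1).comp_continuousWithinAt (hcont q hq)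

theorem continuousOn_comp_coord {F : Type*} [TopologicalSpace F] (h : CrossCurvedCost U V c)
    (hy₀ : y₀ ∈ closure V) {g : E n → E n → F}
    (hg : ∀ x ∈ closure U, ∀ y ∈ closure V, ContinuousAt (fun p : E n × E n => g p.1 p.2) (x, y)) :
    ContinuousOn (fun r : E n × E n => g (expCoordInv c U y₀ r.1) r.2)
      (coordDomain c U y₀ ×ˢ closure V) := by
  obtain ⟨-, hmem, hcont, -⟩ := h.expCoordInv_props hy₀
  rintro ⟨q, y⟩ ⟨hq, hy⟩
  have h1 : ContinuousWithinAt (fun r : E n × E n => (expCoordInv c U y₀ r.1, r.2))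
      (coordDomain c U y₀ ×ˢ closure V) (q, y) :=
    ((hcont q hq).comp continuousWithinAt_fst fun r hr => hr.1).prodMk continuousWithinAt_snd
  exact ContinuousAt.comp_continuousWithinAt (x := (q, y)) (g := fun p : E n × E n => g p.1 p.2)
    (f := fun r : E n × E n => (expCoordInv c U y₀ r.1, r.2))
    (hg _ (hmem q hq).1 y hy) h1

theorem hasFDerivWithinAt_modCost (h : CrossCurvedCost U V c) (hy₀ : y₀ ∈ closure V) {q y : E n}
    (hq : q ∈ coordDomain c U y₀) (hy : y ∈ closure V) :
    HasFDerivWithinAt (fun q => modCost c U y₀ q y) (-innerSL ℝ (modGrad c U y₀ q y))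
      (coordDomain c U y₀) q := by
  obtain ⟨-, hmem, -, hder⟩ := h.expCoordInv_props hy₀
  have hx := (hmem q hq).1
  have hd : ∀ y ∈ closure V, HasFDerivWithinAt (fun q => c (expCoordInv c U y₀ q) y)
      ((fderiv ℝ (fun x => c x y) (expCoordInv c U y₀ q)).comp (coordDeriv c U y₀ q))
      (coordDomain c U y₀) q := fun y hy =>
    HasFDerivAt.comp_hasFDerivWithinAt q (g := fun x => c x y)
      ((contDiffAt_left (h.smoothAt _ hx y hy)).differentiableAt (by norm_num)).hasFDerivAt
      (hder q hq)
  have := (hd y hy).sub (hd y₀ hy₀)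
  refine HasFDerivWithinAt.congr_fderiv this (ContinuousLinearMap.ext fun v => ?_)
  simp only [neg_apply, innerSL_apply_apply, sub_apply,
    ContinuousLinearMap.comp_apply, modGrad, ContinuousLinearMap.adjoint_inner_left,
    inner_sub_left, inner_Dx]
  ring

/-- `neg_sub_le` with `ya = y₀` is convexity of `-modCost` in `q`; the chord inequality yields the
gradient inequality as the parameter tends to `0`. -/
theorem inner_modGrad_le (h : CrossCurvedCost U V c) (hy₀ : y₀ ∈ closure V) {q q' y : E n}
    (hq : q ∈ coordDomain c U y₀) (hq' : q' ∈ coordDomain c U y₀) (hy : y ∈ closure V) :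
    ⟪modGrad c U y₀ q y, q' - q⟫ ≤ modCost c U y₀ q y - modCost c U y₀ q' y := by
  obtain ⟨-, hmem, -, -⟩ := h.expCoordInv_props hy₀
  have hconv := h.convex_coordDomain hy₀
  have hseg : ∀ t ∈ Icc (0 : ℝ) 1, q + t • (q' - q) ∈ coordDomain c U y₀ := fun t ht =>
    hconv.add_smul_sub_mem hq hq' ht
  have hq0 : q + (0 : ℝ) • (q' - q) = q := by simp
  have hder : HasDerivWithinAt (fun t : ℝ => -modCost c U y₀ (q + t • (q' - q)) y)
      ⟪modGrad c U y₀ q y, q' - q⟫ (Icc 0 1) 0 := by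
    have h1 : HasDerivWithinAt (fun t : ℝ => q + t • (q' - q)) (q' - q) (Icc 0 1) 0 := by
      simpa using (((hasDerivAt_id (0 : ℝ)).smul_const (q' - q)).const_add q).hasDerivWithinAt
    have h2 := h.hasFDerivWithinAt_modCost hy₀ hq hy
    rw [← hq0] at h2
    have h3 := (h2.comp_hasDerivWithinAt (0 : ℝ) h1 hseg).neg
    rw [hq0] at h3
    exact HasDerivWithinAt.congr_deriv h3 (by simp)
  refine le_of_hasDerivWithinAt_of_le hder fun t ht => ?_
  rw [hq0]
  have e1 := (hmem _ (hseg t ht))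
  have e2 := hmem q hq
  have e3 := hmem q' hq'
  have := h.neg_sub_le hy₀ hy e2.1 e3.1 e1.1 (a := 1 - t) (b := t) (by linarith [ht.2]) ht.1
    (by ring) (by
      have k1 : ∀ x, Dy c x y₀ = -expCoord c y₀ x := fun x => (neg_neg _).symm
      rw [k1, k1, k1, e1.2, e2.2, e3.2]
      module)
  simp only [modCost]
  linarith

/-- `interp` is `neg_sub_le` for the swapped cost, based at the point `x(q)`; the adjoint of
`coordDeriv` is linear and injective, so it carries interpolation and the twist condition over to
`modGrad`. -/
theorem convexCost (h : CrossCurvedCost U V c) (hy₀ : y₀ ∈ closure V) {u : E n → ℝ}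
    (hu : IsCConvex c (closure U) (closure V) u) :
    ConvexCost (coordDomain c U y₀) (closure V) (modCost c U y₀) (modGrad c U y₀)
      (modPot c U y₀ u) y₀ := by
  obtain ⟨hleft, hmem, hcont, hder⟩ := h.expCoordInv_props hy₀
  have hLinj : ∀ q ∈ coordDomain c U y₀,
      Function.Injective (ContinuousLinearMap.adjoint (coordDeriv c U y₀ q)) := by
    intro q hq v w hvw
    refine ext_inner_right ℝ fun z => ?_
    obtain ⟨z', rfl⟩ := (h.isInvertible_coordDeriv hy₀ hq).surjective z
    rw [← ContinuousLinearMap.adjoint_inner_left, ← ContinuousLinearMap.adjoint_inner_left, hvw]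
  refine ⟨h.isCompact_coordDomain hy₀, h.convex_coordDomain hy₀, h.isCompact_V, hy₀, ?_, ?_,
    fun y hy q hq q' hq' => h.inner_modGrad_le hy₀ hq hq' hy, ?_, ?_, ?_, ?_, ?_⟩
  · refine ContinuousOn.sub (h.continuousOn_comp_coord hy₀ fun x hx y hy =>
      (h.smoothAt x hx y hy).continuousAt) ?_
    exact h.continuousOn_comp_coord hy₀ (g := fun x _ => c x y₀) fun x hx y hy =>
      ContinuousAt.comp (g := fun x => c x y₀) (f := fun p : E n × E n => p.1)
        (contDiffAt_left (h.smoothAt x hx y₀ hy₀)).continuousAt continuousAt_fst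
  · have h1 : ContinuousOn (fun r : E n × E n => ContinuousLinearMap.adjoint (coordDeriv c U y₀ r.1))
        (coordDomain c U y₀ ×ˢ closure V) :=
      (ContinuousLinearMap.adjoint (𝕜 := ℝ) (E := E n) (F := E n)).continuous.comp_continuousOn
        ((h.continuousOn_coordDeriv hy₀).comp continuousOn_fst fun r hr => hr.1)
    refine h1.clm_apply (ContinuousOn.sub ?_ (h.continuousOn_comp_coord hy₀ fun x hx y hy =>
      (h.contDiffAt_Dx' hx hy).continuousAt))
    exact h.continuousOn_comp_coord hy₀ (g := fun x _ => Dx c x y₀) fun x hx y hy =>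
      ContinuousAt.comp (g := fun x => Dx c x y₀) (f := fun p : E n × E n => p.1)
        (contDiffAt_left (h.contDiffAt_Dx' hx hy₀)).continuousAt continuousAt_fst
  · intro q hq y hy y' hy' he
    have := sub_right_injective (hLinj q hq he)
    exact (h.twist_y _ (hmem q hq).1).1 hy hy' (congrArg Neg.neg this)
  · intro q hq y₁ hy₁ y₂ hy₂ a b ha hb hab
    have hxq := (hmem q hq).1
    obtain ⟨y, hy, he⟩ := (h.swap.convex_image_closure hxq).2 ⟨y₁, hy₁, rfl⟩ ⟨y₂, hy₂, rfl⟩ ha hb hab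
    have he' : Dx c (expCoordInv c U y₀ q) y =
        a • Dx c (expCoordInv c U y₀ q) y₁ + b • Dx c (expCoordInv c U y₀ q) y₂ := by
      change -Dx c (expCoordInv c U y₀ q) y = a • -Dx c (expCoordInv c U y₀ q) y₁ +
        b • -Dx c (expCoordInv c U y₀ q) y₂ at he
      rw [← neg_neg (Dx c (expCoordInv c U y₀ q) y), he]
      module
    refine ⟨y, hy, ?_, fun q' hq' => ?_⟩
    · unfold modGrad
      rw [← map_smul, ← map_smul, ← map_add, he']
      congr 1
      obtain rfl : a = 1 - b := by linarith
      module
    · have := h.swap.neg_sub_le hxq (hmem q' hq').1 hy₁ hy₂ hy ha hb hab he'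
      simp only [modCost]
      obtain rfl : a = 1 - b := by linarith
      linarith
  · intro q _; simp [modCost]
  · intro q _; simp [modGrad]
  · intro q hq
    have hx := (hmem q hq).1
    set x := expCoordInv c U y₀ q with hxdef
    obtain ⟨hb1, hb2, hu3⟩ := hu
    -- A maximising sequence in `u = u^{c* c}` subconverges, and the support inequality passes to
    -- the limit. This avoids any continuity of `u^{c*}`.
    obtain ⟨w, -, hwl, hwm⟩ := exists_seq_tendsto_sSup
      (S := (fun y => -c x y - cStarTransform c (closure U) u y) '' closure V)
      ⟨_, y₀, hy₀, rfl⟩ (hb2 x hx)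
    choose y hyV hyw using hwm
    obtain ⟨y', hy', φ, hφ, hyl⟩ := h.isCompact_V.tendsto_subseq hyV
    refine ⟨y', hy', fun q' hq' => ?_⟩
    have hx' := (hmem q' hq').1
    have hlimc : ∀ x ∈ closure U, Tendsto (fun k => c x (y (φ k))) atTop (𝓝 (c x y')) := fun x hx =>
      (contDiffAt_right (h.smoothAt x hx y' hy')).continuousAt.tendsto.comp hyl
    have hle : ∀ k, w (φ k) ≤
        -c x (y (φ k)) + c (expCoordInv c U y₀ q') (y (φ k)) + u (expCoordInv c U y₀ q') := by
      intro k
      have h1 : -c (expCoordInv c U y₀ q') (y (φ k)) - u (expCoordInv c U y₀ q') ≤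
          cStarTransform c (closure U) u (y (φ k)) :=
        le_csSup (hb1 _ (hyV (φ k))) ⟨_, hx', rfl⟩
      rw [← hyw (φ k)]
      simp only
      linarith
    have hux : u x = sSup ((fun y => -c x y - cStarTransform c (closure U) u y) '' closure V) :=
      hu3 x hx
    have hlim := le_of_tendsto_of_tendsto (hwl.comp hφ.tendsto_atTop)
      (((hlimc x hx).neg.add (hlimc _ hx')).add_const _) (Eventually.of_forall hle)
    rw [← hux] at hlim
    simp only [modCost, modPot, ← hxdef]
    linarith

/-- The equation says that `q` attains the supremum defining the transform at `y`. Finiteness of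
that supremum matters, since `sSup` of an unbounded real set is `0`. -/
theorem cSubdiff_eq (h : CrossCurvedCost U V c) (hy₀ : y₀ ∈ closure V) {u : E n → ℝ}
    (hu : IsCConvex c (closure U) (closure V) u) {A : Set (E n)} (hA : A ⊆ coordDomain c U y₀) :
    cSubdiff (modCost c U y₀) (coordDomain c U y₀) (closure V) (modPot c U y₀ u) A =
      {y | ∃ q ∈ A, IsSupport (modCost c U y₀) (coordDomain c U y₀) (closure V)
        (modPot c U y₀ u) q y} := by
  obtain ⟨-, hmem, -, -⟩ := h.expCoordInv_props hy₀
  ext y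
  simp only [cSubdiff, mem_ofPred_eq]
  constructor
  · rintro ⟨q, hqA, hq, hy, he⟩
    refine ⟨q, hqA, hy, fun q' hq' => ?_⟩
    have hbdd : BddAbove ((fun q' => -modCost c U y₀ q' y - modPot c U y₀ u q') ''
        coordDomain c U y₀) := by
      obtain ⟨M, hM⟩ := hu.1 y hy
      refine ⟨M, ?_⟩
      rintro _ ⟨q', hq', rfl⟩
      have := hM ⟨_, (hmem q' hq').1, rfl⟩
      simp only [modCost, modPot] at this ⊢
      linarith
    have : -modCost c U y₀ q' y - modPot c U y₀ u q' ≤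
        cStarTransform (modCost c U y₀) (coordDomain c U y₀) (modPot c U y₀ u) y :=
      le_csSup hbdd ⟨q', hq', rfl⟩
    linarith
  · rintro ⟨q, hqA, hy, hs⟩
    refine ⟨q, hqA, hA hqA, hy, ?_⟩
    have : IsGreatest ((fun q' => -modCost c U y₀ q' y - modPot c U y₀ u q') ''
        coordDomain c U y₀) (-modCost c U y₀ q y - modPot c U y₀ u q) := by
      refine ⟨⟨q, hA hqA, rfl⟩, ?_⟩
      rintro _ ⟨q', hq', rfl⟩
      have := hs q' hq'
      simp only
      linarith
    have he : cStarTransform (modCost c U y₀) (coordDomain c U y₀) (modPot c U y₀ u) y =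
        -modCost c U y₀ q y - modPot c U y₀ u q := this.csSup_eq
    rw [he]; ring

end CrossCurvedCost

/-! ### Mixed derivatives: oscillation of gradients and volumes of their images -/

theorem fderiv_fst_eq {c : E n → E n → ℝ} {x y : E n}
    (h : DifferentiableAt ℝ (fun p : E n × E n => c p.1 p.2) (x, y)) (v : E n) :
    fderiv ℝ (fun x' => c x' y) x v = dirDeriv (v, 0) (fun p : E n × E n => c p.1 p.2) (x, y) := by
  have := HasFDerivAt.comp x (g := fun p : E n × E n => c p.1 p.2) (f := fun x' => (x', y))
    h.hasFDerivAt (hasFDerivAt_prodMk_left x y)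
  rw [show (fun x' => c x' y) = (fun p : E n × E n => c p.1 p.2) ∘ fun x' => (x', y) from rfl,
    this.fderiv]
  simp [dirDeriv]

/-- Symmetry of the mixed second derivative. -/
theorem hasFDerivAt_Dx {c : E n → E n → ℝ} {x y : E n}
    (h : ContDiffAt ℝ 3 (fun p : E n × E n => c p.1 p.2) (x, y)) :
    HasFDerivAt (fun y' => Dx c x y') (ContinuousLinearMap.adjoint (Dxy c x y)) y := by
  set F := fun p : E n × E n => c p.1 p.2
  obtain ⟨O', hO', hG'⟩ := h.contDiffOn le_rfl (by simp)
  have hO := isOpen_interior (s := O')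
  have hmem : (x, y) ∈ interior O' :=
    mem_interior_iff_mem_nhds.2 (by simpa [nhdsWithin_univ] using hO')
  have hF : ContDiffOn ℝ (2 + 1 : ℕ) F (interior O') := hG'.mono interior_subset
  have hdF : ∀ w, DifferentiableAt ℝ (dirDeriv w F) (x, y) := fun w =>
    ((contDiffOn_dirDeriv hO hF w).contDiffAt (hO.mem_nhds hmem)).differentiableAt (by norm_num)
  have hFd : ∀ p ∈ interior O', DifferentiableAt ℝ F p := fun p hp =>
    (hF.contDiffAt (hO.mem_nhds hp)).differentiableAt (by norm_num)
  have hDx : DifferentiableAt ℝ (fun y' => Dx c x y') y :=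
    (contDiffAt_right (contDiffAt_Dx (k := 2) h)).differentiableAt (by norm_num)
  have hDy : DifferentiableAt ℝ (fun x' => Dy c x' y) x :=
    (contDiffAt_left (contDiffAt_Dy (k := 2) h)).differentiableAt (by norm_num)
  refine hDx.hasFDerivAt.congr_fderiv (ContinuousLinearMap.ext fun w => ?_)
  refine ext_inner_right ℝ fun v => ?_
  rw [ContinuousLinearMap.adjoint_inner_left]
  have e1 : ⟪fderiv ℝ (fun y' => Dx c x y') y w, v⟫ =
      dirDeriv (0, w) (dirDeriv (v, 0) F) (x, y) := by
    have k1 : fderiv ℝ (fun y' => ⟪v, Dx c x y'⟫) y w = ⟪v, fderiv ℝ (fun y' => Dx c x y') y w⟫ := by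
      rw [fderiv_inner_apply ℝ (differentiableAt_const v) hDx]; simp
    rw [real_inner_comm, ← k1, ← fderiv_snd_eq (c := fun x y => dirDeriv (v, 0) F (x, y)) (hdF _)]
    refine congrArg (fun L : E n →L[ℝ] ℝ => L w) (Filter.EventuallyEq.fderiv_eq ?_)
    have : ∀ᶠ y' in 𝓝 y, (x, y') ∈ interior O' :=
      (Continuous.prodMk_right x).continuousAt.eventually (hO.mem_nhds hmem)
    filter_upwards [this] with y' hy'
    rw [real_inner_comm, inner_Dx, fderiv_fst_eq (hFd _ hy')]
  have e2 : ⟪w, Dxy c x y v⟫ = dirDeriv (v, 0) (dirDeriv (0, w) F) (x, y) := by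
    have k1 : fderiv ℝ (fun x' => ⟪w, Dy c x' y⟫) x v = ⟪w, Dxy c x y v⟫ := by
      rw [fderiv_inner_apply ℝ (differentiableAt_const w) hDy]; simp [Dxy]
    rw [← k1, ← fderiv_fst_eq (c := fun x y => dirDeriv (0, w) F (x, y)) (hdF _)]
    refine congrArg (fun L : E n →L[ℝ] ℝ => L v) (Filter.EventuallyEq.fderiv_eq ?_)
    have : ∀ᶠ x' in 𝓝 x, (x', y) ∈ interior O' :=
      (Continuous.prodMk_left y).continuousAt.eventually (hO.mem_nhds hmem)
    filter_upwards [this] with x' hx'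
    rw [real_inner_comm, inner_Dy, fderiv_snd_eq (hFd _ hx')]
  rw [e1, e2, dirDeriv_comm hO (hF.of_le (by norm_cast)) _ _ hmem]

theorem abs_det_neg_adjoint (A : E n →L[ℝ] E n) :
    |(-ContinuousLinearMap.adjoint A).det| = |A.det| := by
  have h1 : (ContinuousLinearMap.adjoint A).det = A.det := by
    set b := EuclideanSpace.basisFun (Fin n) ℝ
    change LinearMap.det ((ContinuousLinearMap.adjoint A : E n →L[ℝ] E n) : E n →ₗ[ℝ] E n) =
      LinearMap.det (A : E n →ₗ[ℝ] E n)
    rw [← LinearMap.det_toMatrix b.toBasis, ← LinearMap.det_toMatrix b.toBasis]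
    have := LinearMap.toMatrix_adjoint b b (A : E n →ₗ[ℝ] E n)
    rw [LinearMap.adjoint_eq_toCLM_adjoint] at this
    rw [show ((A : E n →ₗ[ℝ] E n).toContinuousLinearMap) = A from by ext1; rfl] at this
    rw [this, Matrix.det_conjTranspose]
    simp
  have h2 : (-ContinuousLinearMap.adjoint A).det =
      (-1) ^ n * (ContinuousLinearMap.adjoint A).det := by
    have : -ContinuousLinearMap.adjoint A = (-1 : ℝ) • ContinuousLinearMap.adjoint A := by simp
    rw [this]
    change LinearMap.det ((-1 : ℝ) • ((ContinuousLinearMap.adjoint A : E n →L[ℝ] E n) :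
      E n →ₗ[ℝ] E n)) = _
    rw [LinearMap.det_smul, finrank_euclideanSpace_fin]
  rw [h2, abs_mul, abs_pow, abs_neg, abs_one, one_pow, one_mul, h1]

theorem det_ne_zero_of_isInvertible {A : E n →L[ℝ] E n} (hA : A.IsInvertible) : A.det ≠ 0 := by
  obtain ⟨e, rfl⟩ := hA
  exact (LinearEquiv.isUnit_det' e.toLinearEquiv).ne_zero

/-- A function continuous on an open set is bounded at the points of its closure where it is still
continuous by the essential supremum. -/
theorem norm_le_linftyNorm {F : Type*} [NormedAddCommGroup F] {f : E n → E n → F}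
    {A B : Set (E n)} {O : Set (E n × E n)} (hO : IsOpen O) (hOs : O ⊆ A ×ˢ B) {M : ℝ}
    (hM : ∀ᵐ p ∂volume.restrict (A ×ˢ B), ‖f p.1 p.2‖ ≤ M)
    {S : Set (E n × E n)} (hOS : O ⊆ S) (hf : ContinuousOn (fun p : E n × E n => f p.1 p.2) S)
    {x y : E n} (hxy : (x, y) ∈ closure O) (hS : (x, y) ∈ S) : ‖f x y‖ ≤ linftyNorm f A B := by
  have htop : eLpNorm (fun p : E n × E n => f p.1 p.2) ⊤ (volume.restrict (A ×ˢ B)) ≠ ⊤ := by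
    rw [eLpNorm_exponent_top]
    exact ((eLpNormEssSup_le_of_ae_bound hM).trans_lt ENNReal.ofReal_lt_top).ne
  have hae : ∀ᵐ p ∂(volume.restrict O), ‖f p.1 p.2‖ ≤ linftyNorm f A B := by
    have h1 : ∀ᵐ p ∂(volume.restrict (A ×ˢ B)), ‖f p.1 p.2‖ ≤ linftyNorm f A B := by
      filter_upwards [ae_le_eLpNormEssSup (f := fun p : E n × E n => f p.1 p.2)
        (μ := volume.restrict (A ×ˢ B))] with p hp
      rw [← eLpNorm_exponent_top] at hp
      have := ENNReal.toReal_mono htop hp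
      rwa [toReal_enorm] at this
    exact ae_mono (Measure.restrict_mono hOs le_rfl) h1
  have hin : ∀ p ∈ O, ‖f p.1 p.2‖ ≤ linftyNorm f A B := by
    intro p hp
    by_contra! hlt
    have hcont : ContinuousAt (fun p : E n × E n => ‖f p.1 p.2‖) p :=
      ((hf.mono hOS).continuousAt (hO.mem_nhds hp)).norm
    have hev : ∀ᶠ p' in 𝓝 p, p' ∈ O ∧ linftyNorm f A B < ‖f p'.1 p'.2‖ :=
      (show ∀ᶠ p' in 𝓝 p, p' ∈ O from hO.mem_nhds hp).and (hcont.eventually (lt_mem_nhds hlt))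
    have hpos : 0 < volume {p' | p' ∈ O ∧ linftyNorm f A B < ‖f p'.1 p'.2‖} :=
      Measure.measure_pos_of_mem_nhds volume hev
    rw [ae_iff, Measure.restrict_apply' hO.measurableSet] at hae
    refine hpos.ne' (measure_mono_null ?_ hae)
    rintro p' ⟨h1, h2⟩
    exact ⟨not_le.2 h2, h1⟩
  have hne : (𝓝[O] (x, y)).NeBot := mem_closure_iff_nhdsWithin_neBot.1 hxy
  refine le_of_tendsto (((hf (x, y) hS).mono hOS).norm.tendsto) ?_
  filter_upwards [self_mem_nhdsWithin] with p hp using hin p hp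

namespace CrossCurvedCost

variable {U V : Set (E n)} {c : E n → E n → ℝ} {y₀ : E n}

theorem norm_le_linftyNorm {F : Type*} [NormedAddCommGroup F] (h : CrossCurvedCost U V c)
    {f : E n → E n → F}
    (hf : ∀ x ∈ closure U, ∀ y ∈ closure V, ContinuousAt (fun p : E n × E n => f p.1 p.2) (x, y))
    {x y : E n} (hx : x ∈ closure U) (hy : y ∈ closure V) : ‖f x y‖ ≤ linftyNorm f U V := by
  have hc : ContinuousOn (fun p : E n × E n => f p.1 p.2) (closure U ×ˢ closure V) :=
    fun p hp => (hf p.1 hp.1 p.2 hp.2).continuousWithinAt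
  obtain ⟨M, hM⟩ := (h.isCompact_U.prod h.isCompact_V).exists_bound_of_continuousOn hc
  refine OptTransport.norm_le_linftyNorm (h.isOpen_U.prod h.isOpen_V) subset_rfl (M := M) ?_
    (Set.prod_mono subset_closure subset_closure) hc ?_ ⟨hx, hy⟩
  · refine ae_restrict_of_forall_mem (h.isOpen_U.prod h.isOpen_V).measurableSet fun p hp => ?_
    exact hM p ⟨subset_closure hp.1, subset_closure hp.2⟩
  · rw [closure_prod_eq]; exact ⟨hx, hy⟩

theorem hasFDerivAt_Dx (h : CrossCurvedCost U V c) {x y : E n} (hx : x ∈ closure U)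
    (hy : y ∈ closure V) :
    HasFDerivAt (fun y' => Dx c x y') (ContinuousLinearMap.adjoint (Dxy c x y)) y :=
  OptTransport.hasFDerivAt_Dx ((h.smoothAt x hx y hy).of_le (by norm_num))

theorem norm_coordDeriv_le (h : CrossCurvedCost U V c) (hy₀ : y₀ ∈ closure V) {Bm : ℝ}
    (hBm : ∀ x ∈ closure U, ∀ y ∈ closure V, ‖(Dxy c x y).inverse‖ ≤ Bm) {q : E n}
    (hq : q ∈ coordDomain c U y₀) : ‖coordDeriv c U y₀ q‖ ≤ Bm := by
  have hx := ((h.expCoordInv_props hy₀).2.1 q hq).1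
  have : coordDeriv c U y₀ q = -(Dxy c (expCoordInv c U y₀ q) y₀).inverse := by
    rw [coordDeriv_eq]
    have hi := h.isInvertible_Dxy hx hy₀
    refine ContinuousLinearMap.inverse_eq ?_ ?_
    · simp [hi.self_comp_inverse]
    · simp [hi.inverse_comp_self]
  rw [this, norm_neg]
  exact hBm _ hx _ hy₀

theorem hasFDerivAt_modGrad (h : CrossCurvedCost U V c) (hy₀ : y₀ ∈ closure V) {q y : E n}
    (hq : q ∈ coordDomain c U y₀) (hy : y ∈ closure V) :
    HasFDerivAt (modGrad c U y₀ q) (-ContinuousLinearMap.adjoint (mixedDeriv c U y₀ q y)) y := by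
  have hx := ((h.expCoordInv_props hy₀).2.1 q hq).1
  have h1 := (h.hasFDerivAt_Dx hx hy).const_sub (Dx c (expCoordInv c U y₀ q) y₀)
  refine (HasFDerivAt.comp y (ContinuousLinearMap.adjoint (coordDeriv c U y₀ q)).hasFDerivAt
    h1).congr_fderiv ?_
  rw [mixedDeriv, ContinuousLinearMap.adjoint_comp, ContinuousLinearMap.comp_neg]

/-- The product rule combined with the resolvent identity `L - L' = L (A - A') L'`; in `q` the mixed
derivative of `c` is Lipschitz with constant `D * Bm`. The two terms merge because `1 ≤ Bp * Bm`. -/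
theorem norm_mixedDeriv_sub_le (h : CrossCurvedCost U V c) (hy₀ : y₀ ∈ closure V) {Bp Bm D : ℝ}
    (hBp : ∀ x ∈ closure U, ∀ y ∈ closure V, ‖Dxy c x y‖ ≤ Bp)
    (hBm : ∀ x ∈ closure U, ∀ y ∈ closure V, ‖(Dxy c x y).inverse‖ ≤ Bm)
    (hD : ∀ x ∈ closure U, ∀ y ∈ closure V, ‖Dxxy c x y‖ ≤ D) (hB1 : 1 ≤ Bp * Bm)
    {q q' y : E n} (hq : q ∈ coordDomain c U y₀) (hq' : q' ∈ coordDomain c U y₀)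
    (hy : y ∈ closure V) :
    ‖mixedDeriv c U y₀ q y - mixedDeriv c U y₀ q' y‖ ≤ 2 * Bp * Bm ^ 3 * D * ‖q - q'‖ := by
  obtain ⟨-, hmem, -, hder⟩ := h.expCoordInv_props hy₀
  have hx := (hmem q hq).1
  have hx' := (hmem q' hq').1
  have hBm0 : 0 ≤ Bm := (norm_nonneg _).trans (hBm _ hx _ hy)
  have hBp0 : 0 ≤ Bp := (norm_nonneg _).trans (hBp _ hx _ hy)
  have hD0 : 0 ≤ D := (norm_nonneg (Dxxy c _ y)).trans (hD _ hx _ hy)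
  have hlip : ∀ y ∈ closure V, ‖Dxy c (expCoordInv c U y₀ q) y - Dxy c (expCoordInv c U y₀ q') y‖ ≤
      D * Bm * ‖q - q'‖ := by
    intro y hy
    refine (h.convex_coordDomain hy₀).norm_image_sub_le_of_norm_hasFDerivWithin_le
      (f := fun q => Dxy c (expCoordInv c U y₀ q) y)
      (f' := fun q => (Dxxy c (expCoordInv c U y₀ q) y).comp (coordDeriv c U y₀ q))
      (fun r hr => ?_) (fun r hr => ?_) hq' hq
    · exact HasFDerivAt.comp_hasFDerivWithinAt r (g := fun x => Dxy c x y)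
        ((contDiffAt_left (h.contDiffAt_Dxy (hmem r hr).1 hy)).differentiableAt
          (by norm_num)).hasFDerivAt (hder r hr)
    · exact (ContinuousLinearMap.opNorm_comp_le _ _).trans (mul_le_mul
        (hD _ (hmem r hr).1 _ hy) (h.norm_coordDeriv_le hy₀ hBm hr) (norm_nonneg _) hD0)
  set L := coordDeriv c U y₀ q
  set L' := coordDeriv c U y₀ q'
  have hL : ‖L‖ ≤ Bm := h.norm_coordDeriv_le hy₀ hBm hq
  have hL' : ‖L'‖ ≤ Bm := h.norm_coordDeriv_le hy₀ hBm hq'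
  set M := Dxy c (expCoordInv c U y₀ q) y
  set M' := Dxy c (expCoordInv c U y₀ q') y
  set A := Dxy c (expCoordInv c U y₀ q) y₀ with hA
  set A' := Dxy c (expCoordInv c U y₀ q') y₀ with hA'
  have hLL : L - L' = L.comp ((A - A').comp L') := by
    have hi : (-A).IsInvertible := by
      have := (h.twist_x y₀ hy₀).2 _ hx; rwa [fderiv_fun_neg] at this
    have hi' : (-A').IsInvertible := by
      have := (h.twist_x y₀ hy₀).2 _ hx'; rwa [fderiv_fun_neg] at this
    have e1 : L.comp (-A) = .id ℝ (E n) := by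
      rw [show L = (-A).inverse from coordDeriv_eq c U y₀ q]; exact hi.inverse_comp_self
    have e2 : (-A').comp L' = .id ℝ (E n) := by
      rw [show L' = (-A').inverse from coordDeriv_eq c U y₀ q']; exact hi'.self_comp_inverse
    have : A - A' = -A' - -A := by abel
    rw [this, ContinuousLinearMap.sub_comp, ContinuousLinearMap.comp_sub, e2,
      ← ContinuousLinearMap.comp_assoc, e1]
    simp
  have hLLn : ‖L - L'‖ ≤ Bm * (D * Bm * ‖q - q'‖ * Bm) := by
    rw [hLL]
    refine (ContinuousLinearMap.opNorm_comp_le _ _).trans (mul_le_mul hL ?_ (norm_nonneg _) hBm0)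
    exact (ContinuousLinearMap.opNorm_comp_le _ _).trans
      (mul_le_mul (hlip y₀ hy₀) hL' (norm_nonneg _) (by positivity))
  have hsplit : mixedDeriv c U y₀ q y - mixedDeriv c U y₀ q' y =
      (M - M').comp L + M'.comp (L - L') := by
    rw [ContinuousLinearMap.sub_comp, ContinuousLinearMap.comp_sub]
    simp only [mixedDeriv, M, M', L, L']
    abel
  rw [hsplit]
  have k1 : ‖(M - M').comp L‖ ≤ D * Bm * ‖q - q'‖ * Bm :=
    (ContinuousLinearMap.opNorm_comp_le _ _).trans
      (mul_le_mul (hlip y hy) hL (norm_nonneg _) (by positivity))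
  have k2 : ‖M'.comp (L - L')‖ ≤ Bp * (Bm * (D * Bm * ‖q - q'‖ * Bm)) :=
    (ContinuousLinearMap.opNorm_comp_le _ _).trans
      (mul_le_mul (hBp _ hx' _ hy) hLLn (norm_nonneg _) hBp0)
  refine (norm_add_le _ _).trans ((add_le_add k1 k2).trans ?_)
  have : D * Bm * ‖q - q'‖ * Bm * 1 ≤ D * Bm * ‖q - q'‖ * Bm * (Bp * Bm) := by gcongr
  linarith

/-- Both gradients vanish at `y₀`, so their difference is estimated along the curve from `y₀` to `y`
that is a segment in the coordinate `-Dx c x' ·`. The speed of this curve is at most `Bm * Bp *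
‖modGrad c U y₀ q' y‖`, which makes the error relative to the gradient. -/
theorem norm_modGrad_sub_le (h : CrossCurvedCost U V c) (hy₀ : y₀ ∈ closure V) {Bp Bm D : ℝ}
    (hBp : ∀ x ∈ closure U, ∀ y ∈ closure V, ‖Dxy c x y‖ ≤ Bp)
    (hBm : ∀ x ∈ closure U, ∀ y ∈ closure V, ‖(Dxy c x y).inverse‖ ≤ Bm)
    (hD : ∀ x ∈ closure U, ∀ y ∈ closure V, ‖Dxxy c x y‖ ≤ D) (hB1 : 1 ≤ Bp * Bm)
    {q q' y : E n} (hq : q ∈ coordDomain c U y₀) (hq' : q' ∈ coordDomain c U y₀)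
    (hy : y ∈ closure V) :
    ‖modGrad c U y₀ q y - modGrad c U y₀ q' y‖ ≤
      2 * Bp ^ 2 * Bm ^ 4 * D * ‖q - q'‖ * ‖modGrad c U y₀ q' y‖ := by
  obtain ⟨-, hmem, -, -⟩ := h.expCoordInv_props hy₀
  set x' := expCoordInv c U y₀ q' with hx'def
  have hx' : x' ∈ closure U := (hmem q' hq').1
  have hBm0 : 0 ≤ Bm := (norm_nonneg _).trans (hBm _ hx' _ hy)
  have hBp0 : 0 ≤ Bp := (norm_nonneg _).trans (hBp _ hx' _ hy)
  have hD0 : 0 ≤ D := (norm_nonneg (Dxxy c x' y)).trans (hD _ hx' _ hy)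
  set ψ : E n → E n := fun y => -Dx c x' y with hψ
  have hψd : ∀ y ∈ closure V,
      HasFDerivAt ψ (-ContinuousLinearMap.adjoint (Dxy c x' y)) y := fun y hy =>
    (h.hasFDerivAt_Dx hx' hy).neg
  obtain ⟨gl, gm, -, gd⟩ := IsDiffeoOntoRange.invFunOn_props h.isCompact_V (h.twist_y x' hx')
    fun y hy => (hψd y hy).differentiableAt
  set g := Function.invFunOn ψ (closure V)
  have hconv : Convex ℝ (ψ '' closure V) := (h.swap.convex_image_closure hx').2
  set η := ψ y - ψ y₀ with hη
  have hseg : ∀ t ∈ Icc (0 : ℝ) 1, ψ y₀ + t • η ∈ ψ '' closure V := fun t ht =>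
    hconv.add_smul_sub_mem ⟨y₀, hy₀, rfl⟩ ⟨y, hy, rfl⟩ ht
  set Y : ℝ → E n := fun t => g (ψ y₀ + t • η) with hY
  have hYm : ∀ t ∈ Icc (0 : ℝ) 1, Y t ∈ closure V := fun t ht => (gm _ (hseg t ht)).1
  have hYd : ∀ t ∈ Icc (0 : ℝ) 1,
      HasDerivWithinAt Y ((fderiv ℝ ψ (Y t)).inverse η) (Icc 0 1) t := by
    intro t ht
    have h1 : HasDerivWithinAt (fun t : ℝ => ψ y₀ + t • η) η (Icc 0 1) t := by
      simpa using (((hasDerivAt_id t).smul_const η).const_add (ψ y₀)).hasDerivWithinAt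
    exact (gd _ (hseg t ht)).comp_hasDerivWithinAt t h1 hseg
  have hYn : ∀ t ∈ Icc (0 : ℝ) 1, ‖(fderiv ℝ ψ (Y t)).inverse η‖ ≤ Bm * ‖η‖ := by
    intro t ht
    have hYt := hYm t ht
    set w := (fderiv ℝ ψ (Y t)).inverse η
    have hw : fderiv ℝ ψ (Y t) w = η := ((h.twist_y x' hx').2 _ hYt).self_apply_inverse η
    rw [(hψd _ hYt).fderiv] at hw
    have hw2 : w = -ContinuousLinearMap.adjoint (Dxy c x' (Y t)).inverse η := by
      rw [← hw, neg_apply, map_neg, neg_neg, ← ContinuousLinearMap.comp_apply,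
        ← ContinuousLinearMap.adjoint_comp, (h.isInvertible_Dxy hx' hYt).self_comp_inverse]
      refine ext_inner_right ℝ fun v => ?_
      rw [ContinuousLinearMap.adjoint_inner_left]; rfl
    rw [hw2, norm_neg]
    refine (ContinuousLinearMap.le_opNorm _ _).trans ?_
    rw [LinearIsometryEquiv.norm_map]
    exact mul_le_mul_of_nonneg_right (hBm _ hx' _ hYt) (norm_nonneg _)
  have hηn : ‖η‖ ≤ Bp * ‖modGrad c U y₀ q' y‖ := by
    have e1 : Dx c x' y₀ - Dx c x' y = η := by simp only [hη, hψ]; abel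
    have e2 : η = -ContinuousLinearMap.adjoint (Dxy c x' y₀) (modGrad c U y₀ q' y) := by
      have hi : (-Dxy c x' y₀).IsInvertible := by
        have := (h.twist_x y₀ hy₀).2 _ hx'; rwa [fderiv_fun_neg] at this
      have e3 : (coordDeriv c U y₀ q').comp (-Dxy c x' y₀) = .id ℝ (E n) := by
        rw [coordDeriv_eq]; exact hi.inverse_comp_self
      rw [modGrad, ← hx'def, e1, ← neg_apply, ← map_neg, ← ContinuousLinearMap.comp_apply,
        ← ContinuousLinearMap.adjoint_comp, e3]
      refine ext_inner_right ℝ fun v => ?_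
      rw [ContinuousLinearMap.adjoint_inner_left]; rfl
    rw [e2, norm_neg]
    refine (ContinuousLinearMap.le_opNorm _ _).trans ?_
    rw [LinearIsometryEquiv.norm_map]
    exact mul_le_mul_of_nonneg_right (hBp _ hx' _ hy₀) (norm_nonneg _)
  set f : ℝ → E n := fun t => modGrad c U y₀ q (Y t) - modGrad c U y₀ q' (Y t) with hf
  have hfd : ∀ t ∈ Icc (0 : ℝ) 1, HasDerivWithinAt f
      (-ContinuousLinearMap.adjoint (mixedDeriv c U y₀ q (Y t) - mixedDeriv c U y₀ q' (Y t))
        ((fderiv ℝ ψ (Y t)).inverse η)) (Icc 0 1) t := by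
    intro t ht
    have h1 := (h.hasFDerivAt_modGrad hy₀ hq (hYm t ht)).comp_hasDerivWithinAt t (hYd t ht)
    have h2 := (h.hasFDerivAt_modGrad hy₀ hq' (hYm t ht)).comp_hasDerivWithinAt t (hYd t ht)
    refine (h1.sub h2).congr_deriv ?_
    simp only [map_sub, neg_apply, sub_apply]
    abel
  have hbound := norm_image_sub_le_of_norm_deriv_le_segment_01' hfd (C :=
    2 * Bp * Bm ^ 3 * D * ‖q - q'‖ * (Bm * (Bp * ‖modGrad c U y₀ q' y‖))) fun t ht => by
      have ht' : t ∈ Icc (0 : ℝ) 1 := ⟨ht.1, ht.2.le⟩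
      rw [norm_neg]
      refine (ContinuousLinearMap.le_opNorm _ _).trans ?_
      rw [LinearIsometryEquiv.norm_map]
      refine mul_le_mul (h.norm_mixedDeriv_sub_le hy₀ hBp hBm hD hB1 hq hq' (hYm t ht'))
        ((hYn t ht').trans (by gcongr)) (norm_nonneg _) (by positivity)
  have hY0 : Y 0 = y₀ := by simp only [hY, zero_smul, add_zero]; exact gl y₀ hy₀
  have hY1 : Y 1 = y := by
    simp only [hY, one_smul, hη, add_sub_cancel]; exact gl y hy
  have hf0 : f 0 = 0 := by simp only [hf, hY0]; simp [modGrad]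
  rw [hf0, sub_zero] at hbound
  simp only [hf, hY1] at hbound
  linarith

/-- Interior points are needed: `fderiv` sees a full neighbourhood, and the inverse coordinate is
meaningless outside its domain. -/
theorem Dxy_modCost (h : CrossCurvedCost U V c) (hy₀ : y₀ ∈ closure V) {q y : E n}
    (hq : q ∈ interior (coordDomain c U y₀)) (hy : y ∈ closure V) :
    Dxy (modCost c U y₀) q y = mixedDeriv c U y₀ q y := by
  obtain ⟨-, hmem, -, hder⟩ := h.expCoordInv_props hy₀
  have hqX := interior_subset hq
  have h1 : (fun q' => Dy (modCost c U y₀) q' y) = fun q' => Dy c (expCoordInv c U y₀ q') y := by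
    funext q'
    simp only [Dy, gradient, modCost]
    rw [fderiv_sub_const]
  rw [Dxy, h1]
  exact (HasFDerivAt.comp q (g := fun x => Dy c x y)
    ((contDiffAt_left (h.contDiffAt_Dy' (hmem q hqX).1 hy)).differentiableAt
      (by norm_num)).hasFDerivAt
    ((hder q hqX).hasFDerivAt (mem_interior_iff_mem_nhds.1 hq))).fderiv

theorem continuousOn_det_mixedDeriv (h : CrossCurvedCost U V c) (hy₀ : y₀ ∈ closure V) :
    ContinuousOn (fun r : E n × E n => (mixedDeriv c U y₀ r.1 r.2).det)
      (coordDomain c U y₀ ×ˢ closure V) := by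
  have h1 : ContinuousOn (fun r : E n × E n => mixedDeriv c U y₀ r.1 r.2)
      (coordDomain c U y₀ ×ˢ closure V) :=
    (h.continuousOn_comp_coord hy₀ (g := Dxy c) fun x hx y hy =>
      (h.contDiffAt_Dxy hx hy).continuousAt).clm_comp
      ((h.continuousOn_coordDeriv hy₀).comp continuousOn_fst fun r hr => hr.1)
  exact ContinuousLinearMap.continuous_det.comp_continuousOn h1

theorem det_mixedDeriv_ne_zero (h : CrossCurvedCost U V c) (hy₀ : y₀ ∈ closure V) {q y : E n}
    (hq : q ∈ coordDomain c U y₀) (hy : y ∈ closure V) : (mixedDeriv c U y₀ q y).det ≠ 0 :=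
  det_ne_zero_of_isInvertible
    ((h.isInvertible_Dxy ((h.expCoordInv_props hy₀).2.1 q hq).1 hy).comp
      (h.isInvertible_coordDeriv hy₀ hq))

/-- `g` stands for the identity in `γ⁺` and for inversion in `γ⁻`. The continuous `mixedDeriv` is
known to be the mixed derivative only over `interior Z`, but the frontier of a convex set is null
and does not affect the essential supremum. -/
theorem le_linftyNorm_det (h : CrossCurvedCost U V c) (hy₀ : y₀ ∈ closure V) {Z : Set (E n)}
    (hZ : Convex ℝ Z) (hZc : IsClosed Z) (hZX : Z ⊆ coordDomain c U y₀) {g : ℝ → ℝ}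
    (hg : ∀ t ≠ 0, ContinuousAt g t) {q y : E n} (hq : q ∈ interior Z) (hy : y ∈ closure V) :
    |g (mixedDeriv c U y₀ q y).det| ≤
      linftyNorm (fun q y => g (Dxy (modCost c U y₀) q y).det) Z V := by
  have hc : ContinuousOn (fun r : E n × E n => g (mixedDeriv c U y₀ r.1 r.2).det)
      (coordDomain c U y₀ ×ˢ closure V) := fun r hr =>
    ContinuousAt.comp_continuousWithinAt (f := fun r : E n × E n => (mixedDeriv c U y₀ r.1 r.2).det)
      (hg _ (h.det_mixedDeriv_ne_zero hy₀ hr.1 hr.2)) (h.continuousOn_det_mixedDeriv hy₀ r hr)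
  have heq : ∀ r ∈ interior Z ×ˢ closure V, g (Dxy (modCost c U y₀) r.1 r.2).det =
      g (mixedDeriv c U y₀ r.1 r.2).det := fun r hr => by
    rw [h.Dxy_modCost hy₀ (interior_mono hZX hr.1) hr.2]
  obtain ⟨M, hM⟩ := ((h.isCompact_coordDomain hy₀).prod h.isCompact_V).exists_bound_of_continuousOn hc
  have hsub : interior Z ×ˢ closure V ⊆ coordDomain c U y₀ ×ˢ closure V :=
    Set.prod_mono (interior_subset.trans hZX) subset_rfl
  rw [← heq (q, y) ⟨hq, hy⟩, ← Real.norm_eq_abs]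
  refine OptTransport.norm_le_linftyNorm (f := fun q y => g (Dxy (modCost c U y₀) q y).det)
    (O := interior Z ×ˢ V) (S := interior Z ×ˢ closure V) (M := M)
    (isOpen_interior.prod h.isOpen_V) (Set.prod_mono interior_subset subset_rfl) ?_
    (Set.prod_mono subset_rfl subset_closure) ((hc.mono hsub).congr heq) ?_ ⟨hq, hy⟩
  · rw [ae_restrict_iff' (hZc.measurableSet.prod h.isOpen_V.measurableSet)]
    have h0 : volume (frontier Z ×ˢ (univ : Set (E n))) = 0 := by
      rw [Measure.volume_eq_prod, Measure.prod_prod, hZ.addHaar_frontier volume, zero_mul]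
    filter_upwards [compl_mem_ae_iff.2 h0] with r hr hrZ
    have hr1 : r.1 ∈ interior Z := by
      by_contra hni
      exact hr ⟨⟨subset_closure hrZ.1, hni⟩, mem_univ _⟩
    have hr' : r ∈ interior Z ×ˢ closure V := ⟨hr1, subset_closure hrZ.2⟩
    rw [heq r hr']
    exact hM r (hsub hr')
  · rw [closure_prod_eq]
    exact ⟨subset_closure hq, hy⟩

/-- The area formula, with injectivity in `y` from the twist condition. -/
theorem volume_image_modGrad (h : CrossCurvedCost U V c) (hy₀ : y₀ ∈ closure V)
    {u : E n → ℝ} (hu : IsCConvex c (closure U) (closure V) u) {q : E n}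
    (hq : q ∈ coordDomain c U y₀) {A : Set (E n)} (hA : A ⊆ closure V) (hAc : IsCompact A) :
    volume (modGrad c U y₀ q '' A) =
      ∫⁻ y in A, ENNReal.ofReal |(mixedDeriv c U y₀ q y).det| := by
  rw [← lintegral_abs_det_fderiv_eq_addHaar_image volume hAc.measurableSet
    (fun y hy => (h.hasFDerivAt_modGrad hy₀ hq (hA hy)).hasFDerivWithinAt)
    (((h.convexCost hy₀ hu).inj q hq).mono hA)]
  simp_rw [abs_det_neg_adjoint]

theorem volume_image_modGrad_le (h : CrossCurvedCost U V c) (hy₀ : y₀ ∈ closure V)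
    {u : E n → ℝ} (hu : IsCConvex c (closure U) (closure V) u) {Z : Set (E n)}
    (hZ : Convex ℝ Z) (hZc : IsClosed Z) (hZX : Z ⊆ coordDomain c U y₀) {q : E n}
    (hq : q ∈ interior Z) {A : Set (E n)} (hA : A ⊆ closure V) (hAc : IsCompact A) :
    volume (modGrad c U y₀ q '' A) ≤
      ENNReal.ofReal (gammaPlus (modCost c U y₀) Z V) * volume A := by
  rw [h.volume_image_modGrad hy₀ hu (hZX (interior_subset hq)) hA hAc, ← setLIntegral_const]
  refine setLIntegral_mono' hAc.measurableSet fun y hy => ENNReal.ofReal_le_ofReal ?_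
  exact h.le_linftyNorm_det hy₀ hZ hZc hZX (g := fun t => t) (fun _ _ => continuousAt_id) hq (hA hy)

theorem volume_le_image_modGrad (h : CrossCurvedCost U V c) (hy₀ : y₀ ∈ closure V)
    {u : E n → ℝ} (hu : IsCConvex c (closure U) (closure V) u) {Z : Set (E n)}
    (hZ : Convex ℝ Z) (hZc : IsClosed Z) (hZX : Z ⊆ coordDomain c U y₀) {q : E n}
    (hq : q ∈ interior Z) {A : Set (E n)} (hA : A ⊆ closure V) (hAc : IsCompact A) :
    volume A ≤ ENNReal.ofReal (gammaMinus (modCost c U y₀) Z V) *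
      volume (modGrad c U y₀ q '' A) := by
  have hqX := hZX (interior_subset hq)
  rw [h.volume_image_modGrad hy₀ hu hqX hA hAc, ← lintegral_const_mul' _ _ ENNReal.ofReal_ne_top]
  have h1 : volume A = ∫⁻ _ in A, 1 := by simp
  rw [h1]
  refine setLIntegral_mono' hAc.measurableSet fun y hy => ?_
  rw [← ENNReal.ofReal_mul (show 0 ≤ gammaMinus (modCost c U y₀) Z V from ENNReal.toReal_nonneg),
    ← ENNReal.ofReal_one]
  refine ENNReal.ofReal_le_ofReal ?_
  have h2 := h.le_linftyNorm_det hy₀ hZ hZc hZX (g := fun t => t⁻¹)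
    (fun t ht => continuousAt_inv₀ ht) hq (hA hy)
  rw [abs_inv] at h2
  have h3 : 0 < |(mixedDeriv c U y₀ q y).det| :=
    abs_pos.2 (h.det_mixedDeriv_ne_zero hy₀ hqX (hA hy))
  rw [← inv_mul_cancel₀ h3.ne']
  exact mul_le_mul_of_nonneg_right h2 h3.le

/-- On sets of diameter small compared to `1 / invEps`, the gradients of the modified cost
oscillate little relative to their size. -/
theorem norm_modGrad_sub_le_div (h : CrossCurvedCost U V c) (hn : 1 ≤ n) (hy₀ : y₀ ∈ closure V)
    {Z : Set (E n)} (hZX : Z ⊆ coordDomain c U y₀) {K : ℝ} (hK : 0 < K)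
    (hdiam : K * invEps c U V * Metric.diam Z ≤ 1) {q q' y : E n} (hq : q ∈ Z) (hq' : q' ∈ Z)
    (hy : y ∈ closure V) :
    ‖modGrad c U y₀ q y - modGrad c U y₀ q' y‖ ≤ ‖modGrad c U y₀ q' y‖ / K := by
  have hBp : ∀ x ∈ closure U, ∀ y ∈ closure V, ‖Dxy c x y‖ ≤ betaPlus c U V := fun x hx y hy =>
    h.norm_le_linftyNorm (fun x hx y hy => (h.contDiffAt_Dxy hx hy).continuousAt) hx hy
  have hBm : ∀ x ∈ closure U, ∀ y ∈ closure V, ‖(Dxy c x y).inverse‖ ≤ betaMinus c U V :=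
    fun x hx y hy => h.norm_le_linftyNorm (f := fun x y => (Dxy c x y).inverse) (fun x hx y hy =>
      ContinuousAt.comp (g := ContinuousLinearMap.inverse) (f := fun p : E n × E n => Dxy c p.1 p.2)
        ((h.isInvertible_Dxy hx hy).contDiffAt_map_inverse (n := 0)).continuousAt
        (h.contDiffAt_Dxy hx hy).continuousAt) hx hy
  have hD : ∀ x ∈ closure U, ∀ y ∈ closure V,
      ‖Dxxy c x y‖ ≤ linftyNorm (fun x y => Dxxy c x y) U V := fun x hx y hy =>
    h.norm_le_linftyNorm (fun x hx y hy => (h.contDiffAt_Dxxy hx hy).continuousAt) hx hy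
  set Bp := betaPlus c U V
  set Bm := betaMinus c U V
  set D := linftyNorm (fun x y => Dxxy c x y) U V
  have hx := ((h.expCoordInv_props hy₀).2.1 q (hZX hq)).1
  have hBp0 : 0 ≤ Bp := ENNReal.toReal_nonneg
  have hBm0 : 0 ≤ Bm := ENNReal.toReal_nonneg
  have hD0 : 0 ≤ D := ENNReal.toReal_nonneg
  have hB1 : 1 ≤ Bp * Bm := by
    have : NeZero n := ⟨by omega⟩
    have : Nontrivial (E n) := by
      refine ⟨EuclideanSpace.single 0 1, 0, fun h0 => ?_⟩
      have := congrArg (fun v : E n => v 0) h0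
      simp at this
    rw [← ContinuousLinearMap.norm_id (𝕜 := ℝ) (E := E n),
      ← (h.isInvertible_Dxy hx hy).self_comp_inverse]
    exact (ContinuousLinearMap.opNorm_comp_le _ _).trans
      (mul_le_mul (hBp _ hx _ hy) (hBm _ hx _ hy) (norm_nonneg _) hBp0)
  refine (h.norm_modGrad_sub_le hy₀ hBp hBm hD hB1 (hZX hq) (hZX hq') hy).trans ?_
  rw [div_eq_inv_mul]
  refine mul_le_mul_of_nonneg_right ?_ (norm_nonneg _)
  have hbd : Bornology.IsBounded Z := (h.isCompact_coordDomain hy₀).isBounded.subset hZX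
  have h1 : ‖q - q'‖ ≤ Metric.diam Z := by
    rw [← dist_eq_norm]; exact Metric.dist_le_diam_of_mem hbd hq hq'
  rw [← one_div, le_div_iff₀ hK]
  refine le_trans ?_ hdiam
  -- `invEps` carries the further factor `(Bp * Bm) ^ 2`, which is at least `1`.
  have h2 : 2 * Bp ^ 2 * Bm ^ 4 * D ≤ invEps c U V := by
    have h3 : 1 ≤ (Bp * Bm) ^ 2 := one_le_pow₀ hB1
    have h4 : 0 ≤ 2 * Bp ^ 2 * Bm ^ 4 * D := by positivity
    have h5 := mul_le_mul_of_nonneg_left h3 h4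
    have h6 : invEps c U V = 2 * Bp ^ 2 * Bm ^ 4 * D * (Bp * Bm) ^ 2 := by
      simp only [invEps, Bp, Bm, D]; ring
    rw [h6]; linarith
  have h7 : 2 * Bp ^ 2 * Bm ^ 4 * D * ‖q - q'‖ ≤ invEps c U V * Metric.diam Z :=
    mul_le_mul h2 h1 (norm_nonneg _) ((by positivity : 0 ≤ 2 * Bp ^ 2 * Bm ^ 4 * D).trans h2)
  have := mul_le_mul_of_nonneg_left h7 hK.le
  linarith

end CrossCurvedCost

/-! ### Chords, supporting hyperplanes and the final estimates -/

theorem diam_inter_line_le_maxSegmentLength {Z : Set (E n)} (hZ : Bornology.IsBounded Z)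
    (e p : E n) : Metric.diam (Z ∩ range fun t : ℝ => p + t • e) ≤ maxSegmentLength Z e := by
  refine le_ciSup (f := fun p : E n => Metric.diam (Z ∩ range fun t : ℝ => p + t • e)) ?_ p
  refine ⟨Metric.diam Z, ?_⟩
  rintro _ ⟨p, rfl⟩
  exact Metric.diam_mono inter_subset_left hZ

theorem maxSegmentLength_pos {Z : Set (E n)} (hZ : Bornology.IsBounded Z) {e q : E n}
    (he : e ≠ 0) (hq : q ∈ interior Z) : 0 < maxSegmentLength Z e := by
  have hc : ContinuousAt (fun t : ℝ => q + t • e) 0 := by fun_prop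
  have hev : ∀ᶠ t : ℝ in 𝓝 0, q + t • e ∈ Z := by
    refine hc.eventually ?_
    simpa using mem_interior_iff_mem_nhds.1 hq
  obtain ⟨δ, hδ, hball⟩ := Metric.eventually_nhds_iff.1 hev
  have hmem : q + (δ / 2) • e ∈ Z := hball (by
    rw [Real.dist_eq, sub_zero, abs_of_pos (half_pos hδ)]; linarith)
  refine lt_of_lt_of_le ?_ (diam_inter_line_le_maxSegmentLength hZ e q)
  refine Metric.diam_pos ⟨q, ⟨interior_subset hq, 0, by simp⟩, q + (δ / 2) • e,
    ⟨hmem, δ / 2, rfl⟩, fun h0 => ?_⟩ (hZ.subset inter_subset_left)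
  have : (δ / 2) • e = 0 := by simpa using h0
  rcases smul_eq_zero.1 this with h1 | h1
  · linarith
  · exact he h1

/-- Only this half of the distance formula is needed, and Cauchy–Schwarz against points of the
hyperplane gives it. -/
theorem sub_div_norm_le_infDist_hyperplane {e q : E n} {a : ℝ} (he : e ≠ 0)
    (hne : (hyperplane e a).Nonempty) :
    |a - ⟪e, q⟫| / ‖e‖ ≤ Metric.infDist q (hyperplane e a) := by
  rw [Metric.le_infDist hne]
  intro w hw
  have hw' : ⟪e, w⟫ = a := hw
  rw [div_le_iff₀ (norm_pos_iff.2 he), dist_comm, dist_eq_norm, mul_comm, ← hw', ← inner_sub_right]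
  exact abs_real_inner_le_norm _ _

end OptTransport

open OptTransport in
theorem proposition6p6 (n : ℕ) (hn : 1 ≤ n) :
    ∃ K C C₁ C₂ : ℝ, 0 < K ∧ 0 < C ∧ 0 < C₁ ∧ 0 < C₂ ∧
      ∀ (U V : Set (OptTransport.E n)) (c : OptTransport.E n → OptTransport.E n → ℝ),
        OptTransport.IsNonnegCrossCurved U V c →
      ∀ y₀ ∈ closure V, ∀ u : OptTransport.E n → ℝ,
        OptTransport.IsCConvex c (closure U) (closure V) u →
      ∀ lam : ℝ, 0 < lam →
      ∀ Z : Set (OptTransport.E n), Z = OptTransport.zeroSection c U y₀ u →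
      ∀ ct : OptTransport.E n → OptTransport.E n → ℝ, ct = OptTransport.modCost c U y₀ →
      ∀ ut : OptTransport.E n → ℝ, ut = OptTransport.modPot c U y₀ u →
        (interior Z).Nonempty →
        OptTransport.CMongeAmpereBounds ct (OptTransport.coordDomain c U y₀) (closure V) ut
          lam (1 / lam) Z →
        (∀ q ∈ frontier Z, ut q = 0) →
        K * OptTransport.invEps c U V * Metric.diam Z ≤ 1 →
          (C₁ * (lam / OptTransport.gammaMinus ct Z V) ≤
              |sInf (ut '' Z)| ^ n / (volume Z).toReal ^ 2 ∧
            |sInf (ut '' Z)| ^ n / (volume Z).toReal ^ 2 ≤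
              C₂ * (OptTransport.gammaPlus ct Z V / lam)) ∧
          ∀ (e : OptTransport.E n) (a b : ℝ), e ≠ 0 →
            OptTransport.SupportFromOppositeSides Z e a b →
            ∀ q ∈ interior Z,
              |ut q| ^ n / (volume Z).toReal ^ 2 ≤
                C * (OptTransport.gammaPlus ct Z V / lam) *
                  (min (Metric.infDist q (OptTransport.hyperplane e a))
                      (Metric.infDist q (OptTransport.hyperplane e b)) /
                    OptTransport.maxSegmentLength Z e) := by
  obtain ⟨K, hK, hdet⟩ := exists_det_perturbation n
  have hn0 : (0 : ℝ) < n := by exact_mod_cast hn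
  refine ⟨K, 2 * ((n : ℝ) ^ n) ^ 2, ((64 * (n : ℝ) ^ 2) ^ n)⁻¹, 2 * ((n : ℝ) ^ n) ^ 2, hK,
    by positivity, by positivity, by positivity, ?_⟩
  rintro U V c hc y₀ hy₀ u hu lam hlam Z hZ ct rfl ut rfl hint hMA hfr hdiam
  have h := hc.crossCurvedCost
  have S := h.convexCost hy₀ hu
  set γm := gammaMinus (modCost c U y₀) Z V
  set γp := gammaPlus (modCost c U y₀) Z V
  have hγm : 0 ≤ γm := ENNReal.toReal_nonneg
  have hγp : 0 ≤ γp := ENNReal.toReal_nonneg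
  have hZconv : Convex ℝ Z := hZ ▸ S.convex_sublevel
  have hZc : IsCompact Z := hZ ▸ S.isCompact_sublevel
  have hZX : Z ⊆ coordDomain c U y₀ := hZ ▸ fun q h => h.1
  have hZu : ∀ q ∈ Z, modPot c U y₀ u q ≤ 0 := fun q h => by rw [hZ] at h; exact h.2
  have hvpos : 0 < (volume Z).toReal :=
    ENNReal.toReal_pos ((isOpen_interior.measure_pos volume hint).trans_le
      (measure_mono interior_subset)).ne' hZc.measure_lt_top.ne
  have hMAu : volume {y | ∃ q ∈ Z, IsSupport (modCost c U y₀) (coordDomain c U y₀) (closure V)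
      (modPot c U y₀ u) q y} ≤ ENNReal.ofReal (1 / lam) * volume Z := by
    rw [← h.cSubdiff_eq hy₀ hu hZX]
    exact (hMA Z subset_rfl hZc.measurableSet).2
  -- Both upper bounds come from this inequality between a chord of length `r` and the distance from
  -- `q₀` to the supporting hyperplane normal to it. The condition on `diam Z` enters here; its
  -- product form includes the case `ε_c = ∞`.
  have hupper : ∀ q₀ ∈ interior Z, ∀ z ∈ Z, ∀ z' ∈ Z, ∀ e q₁ : E n, ‖e‖ = 1 → ∀ r : ℝ, 0 < r →
      z - z' = r • e → (∀ q ∈ Z, inner ℝ e q ≤ inner ℝ e q₁) → (-modPot c U y₀ u q₀) ^ n * r ≤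
        2 * ((n : ℝ) ^ n) ^ 2 * (γp / lam) * (volume Z).toReal ^ 2 * inner ℝ e (q₁ - q₀) :=
    fun q₀ hq₀ z hz z' hz' e q₁ he r hr hzz hmax =>
      S.pow_mul_le hn hdet hZ hfr hq₀
        (fun q hq q' hq' y hy => h.norm_modGrad_sub_le_div hn hy₀ hZX hK hdiam hq hq' hy) hγp hlam
        (fun A hA hAc => h.volume_image_modGrad_le hy₀ hu hZconv hZc.isClosed hZX hq₀ hA hAc)
        hMAu hz hz' he hr hzz hmax
  have hne : Z.Nonempty := hint.mono interior_subset
  have hcont : ContinuousOn (modPot c U y₀ u) Z := S.continuousOn.mono hZX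
  obtain ⟨q₀, hq₀, hsInf, hmin⟩ := hZc.exists_sInf_image_eq_and_le hne hcont
  have hh : |sInf (modPot c U y₀ u '' Z)| = -modPot c U y₀ u q₀ := by
    rw [hsInf, abs_of_nonpos (hZu q₀ hq₀)]
  set C' := 2 * ((n : ℝ) ^ n) ^ 2 * (γp / lam) with hC'
  have hC'0 : 0 ≤ C' := by positivity
  rw [hh]
  refine ⟨⟨?_, ?_⟩, ?_⟩
  · have hlow := S.mul_sq_volume_le hn hZ hint (h := -modPot c U y₀ u q₀)
      (fun q hq => by rw [neg_neg]; exact hmin q hq) hγm hlam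
      (fun q₀ hq₀ A hA hAc =>
        h.volume_le_image_modGrad hy₀ hu hZconv hZc.isClosed hZX hq₀ hA hAc)
      (fun Q hQ hQc => by
        rw [← h.cSubdiff_eq hy₀ hu (hQ.trans hZX)]
        exact (hMA Q hQ hQc.measurableSet).1)
    have hu0 : 0 ≤ (-modPot c U y₀ u q₀) ^ n := pow_nonneg (neg_nonneg.2 (hZu q₀ hq₀)) n
    rcases hγm.eq_or_lt with h0 | h0
    -- Division by `0` gives `0`, so a vanishing `γ⁻` leaves a trivial bound.
    · rw [← h0, div_zero, mul_zero]; positivity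
    · rw [le_div_iff₀ (by positivity), inv_mul_eq_div, div_mul_eq_mul_div,
        div_le_iff₀ (by positivity), div_mul_eq_mul_div, div_le_iff₀ h0]
      linarith
  · rw [div_le_iff₀ (by positivity)]
    have hu0 : 0 ≤ (-modPot c U y₀ u q₀) ^ n := pow_nonneg (neg_nonneg.2 (hZu q₀ hq₀)) n
    rcases hu0.eq_or_lt with h0 | h0
    · rw [← h0]; positivity
    -- A nonzero minimum is attained inside, as the potential vanishes on the frontier.
    have hq₀i : q₀ ∈ interior Z := by
      by_contra hni
      rw [hfr q₀ ⟨subset_closure hq₀, hni⟩, neg_zero, zero_pow (by omega)] at h0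
      exact lt_irrefl _ h0
    have hdpos : 0 < Metric.diam Z := by
      refine Metric.diam_pos ?_ hZc.isBounded
      by_contra hns
      rw [not_nontrivial_iff] at hns
      have : NeZero n := ⟨by omega⟩
      have : Nontrivial (E n) := by
        refine ⟨EuclideanSpace.single 0 1, 0, fun h0 => ?_⟩
        have := congrArg (fun v : E n => v 0) h0
        simp at this
      exact hvpos.ne' (by rw [hns.measure_zero]; rfl)
    -- Every pair of points serves as a chord, with `⟪e, q₁ - q₀⟫ ≤ diam Z`. The supremum over pairs
    -- puts `diam Z` on both sides, where it cancels.
    have hle : Metric.diam Z ≤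
        C' * (volume Z).toReal ^ 2 * Metric.diam Z / (-modPot c U y₀ u q₀) ^ n := by
      refine Metric.diam_le_of_forall_dist_le (by positivity) fun z hz z' hz' => ?_
      rcases eq_or_ne z z' with rfl | hzz
      · rw [dist_self]; positivity
      have hr : 0 < ‖z - z'‖ := norm_pos_iff.2 (sub_ne_zero.2 hzz)
      set e := ‖z - z'‖⁻¹ • (z - z') with he
      have he1 : ‖e‖ = 1 := by
        rw [he, norm_smul, norm_inv, norm_norm, inv_mul_cancel₀ hr.ne']
      obtain ⟨q₁, hq₁, hmax⟩ := hZc.exists_isMaxOn hne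
        (f := fun q => inner ℝ e q) (by fun_prop)
      have key := hupper q₀ hq₀i z hz z' hz' e q₁ he1 ‖z - z'‖ hr
        (by rw [he, smul_smul, mul_inv_cancel₀ hr.ne', one_smul]) hmax
      have hin : inner ℝ e (q₁ - q₀) ≤ Metric.diam Z := by
        refine (real_inner_le_norm _ _).trans ?_
        rw [he1, one_mul, ← dist_eq_norm]
        exact Metric.dist_le_diam_of_mem hZc.isBounded hq₁ hq₀
      rw [le_div_iff₀ h0, dist_eq_norm, mul_comm]
      exact key.trans (mul_le_mul_of_nonneg_left hin (by positivity))
    rw [le_div_iff₀ h0, mul_comm] at hle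
    exact le_of_mul_le_mul_right hle hdpos
  · rintro e a b he ⟨⟨qa, hqa, hqa'⟩, ⟨qb, hqb, hqb'⟩, hab⟩ q hq
    have hqZ := interior_subset hq
    have hℓ := maxSegmentLength_pos hZc.isBounded he hq
    set ℓ := maxSegmentLength Z e
    set m := min (Metric.infDist q (hyperplane e a)) (Metric.infDist q (hyperplane e b)) with hm
    have hm0 : 0 ≤ m := le_min Metric.infDist_nonneg Metric.infDist_nonneg
    have hen : 0 < ‖e‖ := norm_pos_iff.2 he
    rw [abs_of_nonpos (hZu q hqZ), div_le_iff₀ (by positivity)]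
    have hu0 : 0 ≤ (-modPot c U y₀ u q) ^ n := pow_nonneg (neg_nonneg.2 (hZu q hqZ)) n
    rcases hu0.eq_or_lt with h0 | h0
    · rw [← h0]; positivity
    have hqa'' : inner ℝ e qa = a := hqa'
    have hqb'' : inner ℝ e qb = b := hqb'
    have hunit : ‖‖e‖⁻¹ • e‖ = 1 := by
      rw [norm_smul, norm_inv, norm_norm, inv_mul_cancel₀ hen.ne']
    have key : ∀ z ∈ Z, ∀ z' ∈ Z, ∀ s : ℝ, 0 < s → z - z' = s • e →
        (-modPot c U y₀ u q) ^ n * ‖z - z'‖ ≤ C' * (volume Z).toReal ^ 2 * m := by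
      intro z hz z' hz' s hs hzz
      have hr : ‖z - z'‖ = s * ‖e‖ := by rw [hzz, norm_smul, Real.norm_of_nonneg hs.le]
      rw [hm, mul_min_of_nonneg _ _ (by positivity : 0 ≤ C' * (volume Z).toReal ^ 2)]
      refine le_min ?_ ?_
      · refine (hupper q hq z hz z' hz' (‖e‖⁻¹ • e) qa hunit ‖z - z'‖ (by rw [hr]; positivity)
          (by rw [hr, hzz, smul_smul, mul_assoc, mul_inv_cancel₀ hen.ne', mul_one])
          fun q' hq' => ?_).trans (mul_le_mul_of_nonneg_left ?_ (by positivity))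
        · rw [real_inner_smul_left, real_inner_smul_left, hqa'']
          exact mul_le_mul_of_nonneg_left (hab q' hq').2 (by positivity)
        · refine le_trans ?_ (sub_div_norm_le_infDist_hyperplane he ⟨qa, hqa'⟩)
          rw [real_inner_smul_left, inner_sub_right, hqa'', div_eq_inv_mul]
          exact mul_le_mul_of_nonneg_left (le_abs_self _) (by positivity)
      -- For the opposite hyperplane the chord is reversed and the outer normal is `-e`.
      · rw [norm_sub_rev] at hr ⊢
        refine (hupper q hq z' hz' z hz (-(‖e‖⁻¹ • e)) qb (by rw [norm_neg, hunit]) ‖z' - z‖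
          (by rw [hr]; positivity)
          (by rw [hr, ← neg_sub, hzz, smul_neg, smul_smul, mul_assoc, mul_inv_cancel₀ hen.ne',
            mul_one])
          fun q' hq' => ?_).trans (mul_le_mul_of_nonneg_left ?_ (by positivity))
        · rw [inner_neg_left, inner_neg_left, real_inner_smul_left, real_inner_smul_left, hqb'']
          exact neg_le_neg (mul_le_mul_of_nonneg_left (hab q' hq').1 (by positivity))
        · refine le_trans ?_ (sub_div_norm_le_infDist_hyperplane he ⟨qb, hqb'⟩)
          rw [inner_neg_left, real_inner_smul_left, inner_sub_right, hqb'', div_eq_inv_mul,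
            ← mul_neg]
          exact mul_le_mul_of_nonneg_left (neg_le_abs _) (by positivity)
    -- The bound is uniform over chords parallel to `e`, so it passes to the maximal length; a chord
    -- may be traversed in either order.
    have hle : ℓ ≤ C' * (volume Z).toReal ^ 2 * m / (-modPot c U y₀ u q) ^ n := by
      refine ciSup_le fun p => Metric.diam_le_of_forall_dist_le (by positivity) ?_
      rintro z ⟨hz, t, rfl⟩ z' ⟨hz', t', rfl⟩
      rw [le_div_iff₀ h0, dist_eq_norm, mul_comm]
      rcases lt_trichotomy t t' with ht | rfl | ht
      · rw [norm_sub_rev]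
        exact key _ hz' _ hz (t' - t) (by linarith) (by module)
      · rw [sub_self, norm_zero, mul_zero]; positivity
      · exact key _ hz _ hz' (t - t') (by linarith) (by module)
    rw [le_div_iff₀ h0] at hle
    rw [mul_div_assoc', div_mul_eq_mul_div, le_div_iff₀ hℓ]
    linarith
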